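/- **Setting.** Let $d\ge 2$. Write $\langle x\rangle=(1+|x|^2)^{1/2}$, and normalise the Fourier transform as $\hat f(\xi)=(2\pi)^{-d/2}\int_{\mathbb R^d}e^{-\mathrm i x\cdot\xi}f(x)\,dx$, so that $-\Delta$ has symbol $|\xi|^2$. Fix smooth functions $\chi,\varphi:\mathbb R^d\to\mathbb R$ with $\operatorname{supp}\chi\subseteq\{|\xi|\le 4/3\}$, $\chi=1$ on $\{|\xi|\le 3/4\}$, $\operatorname{supp}\varphi\subseteq\{3/4\le|\xi|\le 8/3\}$ and $\chi(\xi)+\sum_{n\ge0}\varphi(2^{-n}\xi)=1$ for all $\xi$. Put $\Delta_{-1}=\chi(D)$ and $\Delta_n=\varphi(2^{-n}D)$ for $n\ge0$. For $r,\eta\in\mathbb R$ let $H^r(\langle x\rangle^{\eta})$ be the space of all $u\in\mathcal S'(\mathbb R^d)$ with $$\|u\|_{H^r(\langle x\rangle^{\eta})}=\Big(\sum_{n\ge-1}2^{2nr}\int_{\mathbb R^d}|\Delta_nu(x)|^2\langle x\rangle^{2\eta}\,dx\Big)^{1/2}<\infty .$$ For $k>0$, $\gamma\in\mathbb R^d$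 and $\tau\in\mathbb R$ put $r_{k,\gamma}=(k^2+|\gamma|^2)^{1/2}$ and $$m_{k,\gamma,\tau}(\xi)=|\xi|^2-k^2-|\gamma|^2+2\mathrm i\gamma\cdot\xi-\mathrm i\tau .$$ Let $\psi:\mathbb R\to[0,1]$ be smooth with support in $(-1,1)$ and $\psi=1$ on $(-1/2,1/2)$, and for $\epsilon_0>0$ put $\psi_0(\rho)=\psi(|\rho-r_{k,\gamma}|/\epsilon_0)$. For $f,g\in\mathcal S(\mathbb R^d)$ and $\sigma\in[0,2]$ put $F=\hat f\,\overline{\hat g}$ and $$I^{(1,\sigma)}(f,g)=\int_0^\infty\!\!\int_{\mathbb S^{d-1}}\frac{(1+\rho^2)^{\sigma/2}F(\rho\omega)}{m_{k,\gamma,\tau}(\rho\omega)}\,(1-\psi_0(\rho))\,\rho^{d-1}\,d\omega\,d\rho,$$ $$I^{(2,\sigma)}(f,g)=\int_0^\infty\!\!\int_{\mathbb S^{d-1}}\frac{(1+\rho^2)^{\sigma/2}F(r_{k,\gamma}\omega)}{m_{k,\gamma,\tau}(\rho\omega)}\,\psi_0(\rho)\,\rho^{d-1}\,d\omega\,d\rho,$$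 $$I^{(3,\sigma)}(f,g)=\int_0^\infty\!\!\int_{\mathbb S^{d-1}}\frac{(1+\rho^2)^{\sigma/2}\big(F(\rho\omega)-F(r_{k,\gamma}\omega)\big)}{m_{k,\gamma,\tau}(\rho\omega)}\,\psi_0(\rho)\,\rho^{d-1}\,d\omega\,d\rho .$$ The regularized Faddeev-type operator $\mathcal H_{k,\gamma,\tau}=\mathcal H_{k,\gamma,\tau}(\cdot\,;\psi,\epsilon_0)$ is the linear operator $\mathcal S(\mathbb R^d)\to\mathcal S'(\mathbb R^d)$ determined by $$\big\langle(I-\Delta)^{\sigma/2}\mathcal H_{k,\gamma,\tau}f,\,g\big\rangle=\sum_{j=1}^3I^{(j,\sigma)}(f,g)\qquad\text{for all }f,g\in\mathcal S(\mathbb R^d),\ \sigma\in[0,2],$$ where $\langle u,g\rangle=u(\overline g)$. **Theorem.** Let $r\in\mathbb R$, $s\in[0,2]$ and $\eta_0>1/2$. There is a constant $C>0$, depending only on $d,r,s,\eta_0$ and the pair $(\chi,\varphi)$, such that the following holds for every $\psi$ as above, all $k>0$ and $\gamma\in\mathbb R^d$, all $\epsilon_0\in(0,\min\{r_{k,\gamma}/4,1\})$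 and all $\tau\in(-\epsilon_0^2,0)\cup(0,\epsilon_0^2)$. 1. The integrals $I^{(j,\sigma)}(f,g)$ converge absolutely for all $f,g\in\mathcal S(\mathbb R^d)$ and $\sigma\in[0,2]$, and $\mathcal H_{k,\gamma,\tau}$ is well defined. 2. For every $\eta\ge\eta_0$, $\mathcal H_{k,\gamma,\tau}$ extends to a bounded linear operator from $H^r(\langle x\rangle^{\eta})$ into $H^{r+s}(\langle x\rangle^{-\eta})$, and $$\|\mathcal H_{k,\gamma,\tau}f\|_{H^{r+s}(\langle x\rangle^{-\eta})}\le C\,\frac{(1+r_{k,\gamma})^s}{\epsilon_0\,r_{k,\gamma}}\,\|f\|_{H^r(\langle x\rangle^{\eta})}\qquad\text{for all }f\in H^r(\langle x\rangle^{\eta}).$$ 3. For every $f\in\mathcal S(\mathbb R^d)$, in the sense of distributions, $$-(\Delta+k^2+|\gamma|^2-2\gamma\cdot\nabla+\mathrm i\tau)\,\mathcal H_{k,\gamma,\tau}f=f=-\mathcal H_{k,\gamma,\tau}\,(\Delta+k^2+|\gamma|^2-2\gamma\cdot\nabla+\mathrm i\tau)f .$$ -/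

import Mathlib

open MeasureTheory Set
open scoped SchwartzMap FourierTransform ENNReal ContDiff LineDeriv Laplacian

noncomputable section

namespace Faddeev

/-- Euclidean space `ℝᵈ`. -/
abbrev Space (d : ℕ) := EuclideanSpace ℝ (Fin d)

variable {d : ℕ}

/-! ### Fourier side

The Fourier transform is normalised as `f̂(ξ) = (2π)^{-d/2} ∫ e^{-i x·ξ} f(x) dx`. Thus `∇` has symbol
`iξ`, `-Δ` has symbol `|ξ|²`, and Plancherel's identity holds without a constant. Mathlib's `𝓕` uses
`e^{-2πi x·ξ}`, so `f̂(ξ) = (2π)^{-d/2} (𝓕 f)(ξ/2π)` and the operator `a(D)` with symbol `a(ξ)` is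
Mathlib's multiplier with the function `ξ ↦ a(2πξ)`. -/

/-- `f̂(ξ) = (2π)^{-d/2} ∫ e^{-i x·ξ} f(x) dx`. -/
def fhat (f : 𝓢(Space d, ℂ)) (ξ : Space d) : ℂ :=
  ((2 * Real.pi) ^ (-(d : ℝ) / 2) : ℝ) * 𝓕 f ((2 * Real.pi)⁻¹ • ξ)

/-- The operator `a(D)` on tempered distributions; `a` is smooth of temperate growth in all uses. -/
def multiplier (a : Space d → ℝ) : 𝓢'(Space d, ℂ) →L[ℂ] 𝓢'(Space d, ℂ) :=
  TemperedDistribution.fourierMultiplierCLM ℂ (fun ξ => (a ((2 * Real.pi) • ξ) : ℂ))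

/-- The Japanese bracket to the power `η`: `⟨x⟩^η = (1 + |x|²)^{η/2}`. -/
def bracket (η : ℝ) (x : Space d) : ℝ := (1 + ‖x‖ ^ 2) ^ (η / 2)

/-- `(I - Δ)^{s/2}` on tempered distributions. -/
def bessel (s : ℝ) : 𝓢'(Space d, ℂ) →L[ℂ] 𝓢'(Space d, ℂ) := multiplier (bracket s)

/-- The complex conjugate of a Schwartz function. -/
def conjS (g : 𝓢(Space d, ℂ)) : 𝓢(Space d, ℂ) :=
  SchwartzMap.postcompCLM (𝕜 := ℝ) (Complex.conjCLE : ℂ →L[ℝ] ℂ) g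

/-- The sesquilinear pairing `⟨u, g⟩ = u(ḡ)`, which is `∫ u ḡ dx` when `u` is a function. -/
def pairing (u : 𝓢'(Space d, ℂ)) (g : 𝓢(Space d, ℂ)) : ℂ := u (conjS g)

/-! ### Weighted Sobolev spaces `H^r(ρ) = B^r_{2,2}(ρ)` -/

/-- An admissible dyadic partition pair `(χ, φ)`. The supports below make the supports of
`φ(2^{-i}·)` and `φ(2^{-j}·)` disjoint for `|i - j| ≥ 2`, and those of `χ` and `φ(2^{-i}·)` disjoint
for `i ≥ 1`. -/
structure DyadicPair (d : ℕ) where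
  χ : Space d → ℝ
  φ : Space d → ℝ
  χ_smooth : ContDiff ℝ ∞ χ
  φ_smooth : ContDiff ℝ ∞ φ
  sum_eq_one : ∀ ξ, χ ξ + ∑' n : ℕ, φ (((2 : ℝ) ^ n)⁻¹ • ξ) = 1
  χ_supp : ∀ ξ, χ ξ ≠ 0 → ‖ξ‖ ≤ 4 / 3
  χ_eq_one : ∀ ξ, ‖ξ‖ ≤ 3 / 4 → χ ξ = 1
  φ_supp : ∀ ξ, φ ξ ≠ 0 → 3 / 4 ≤ ‖ξ‖ ∧ ‖ξ‖ ≤ 8 / 3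

/-- Dyadic symbols, with the index shifted by one: `0 ↦ χ` and `n + 1 ↦ φ(2^{-n}·)`. -/
def DyadicPair.symbol (P : DyadicPair d) : ℕ → Space d → ℝ
  | 0 => P.χ
  | n + 1 => fun ξ => P.φ (((2 : ℝ) ^ n)⁻¹ • ξ)

/-- The Littlewood--Paley block `Δ_{n-1}` (the first one, `n = 0`, is `Δ_{-1} = χ(D)`). -/
def DyadicPair.block (P : DyadicPair d) (n : ℕ) : 𝓢'(Space d, ℂ) →L[ℂ] 𝓢'(Space d, ℂ) :=
  multiplier (P.symbol n)

/-- The tempered distribution `v` is given by integration against the function `F`. -/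
def Represents (v : 𝓢'(Space d, ℂ)) (F : Space d → ℂ) : Prop :=
  AEStronglyMeasurable F volume ∧
    ∀ φ : 𝓢(Space d, ℂ), Integrable (fun x => φ x * F x) volume ∧ v φ = ∫ x, φ x * F x

/-- The norm of `L²(ρ)`, `(∫ |v|² ρ² dx)^{1/2}`, of a tempered distribution; it is `∞` if `v` is not
given by a function. (The function is unique almost everywhere, so the infimum is over one value.) -/
def weightedL2Norm (ρ : Space d → ℝ) (v : 𝓢'(Space d, ℂ)) : ℝ≥0∞ :=
  ⨅ (F : Space d → ℂ) (_ : Represents v F), eLpNorm (fun x => (ρ x : ℂ) * F x) 2 volume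

/-- The norm of `H^r(ρ)`, `(∑_{n ≥ -1} 2^{2nr} ‖Δ_n u‖²_{L²(ρ)})^{1/2}`, with the index shifted by
one. -/
def sobolevNorm (P : DyadicPair d) (r : ℝ) (ρ : Space d → ℝ) (u : 𝓢'(Space d, ℂ)) : ℝ≥0∞ :=
  (∑' n : ℕ, (ENNReal.ofReal ((2 : ℝ) ^ (((n : ℝ) - 1) * r)) *
    weightedL2Norm ρ (P.block n u)) ^ 2) ^ (1 / 2 : ℝ)

lemma Represents.add {u v : 𝓢'(Space d, ℂ)} {F G : Space d → ℂ} (hF : Represents u F)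
    (hG : Represents v G) : Represents (u + v) (F + G) := by
  refine ⟨hF.1.add hG.1, fun φ => ?_⟩
  have h1 := (hF.2 φ).1
  have h2 := (hG.2 φ).1
  have e : (fun x => φ x * (F + G) x) = fun x => φ x * F x + φ x * G x := by
    funext x; simp [mul_add]
  rw [e]
  refine ⟨h1.add h2, ?_⟩
  rw [integral_add h1 h2, ← (hF.2 φ).2, ← (hG.2 φ).2]
  rfl

lemma Represents.smul {u : 𝓢'(Space d, ℂ)} {F : Space d → ℂ} (c : ℂ) (hF : Represents u F) :
    Represents (c • u) (c • F) := by
  refine ⟨hF.1.const_smul c, fun φ => ?_⟩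
  have e : (fun x => φ x * (c • F) x) = fun x => c * (φ x * F x) := by
    funext x; simp [mul_left_comm]
  rw [e]
  refine ⟨(hF.2 φ).1.const_mul c, ?_⟩
  rw [integral_const_mul, ← (hF.2 φ).2]
  rfl

lemma weightedL2Norm_add_le {ρ : Space d → ℝ} (hρ : Continuous ρ) (u v : 𝓢'(Space d, ℂ)) :
    weightedL2Norm ρ (u + v) ≤ weightedL2Norm ρ u + weightedL2Norm ρ v := by
  simp only [weightedL2Norm]
  refine ENNReal.le_iInf₂_add_iInf₂ fun F hF G hG => ?_
  refine (iInf₂_le (F + G) (hF.add hG)).trans ?_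
  have hm : AEStronglyMeasurable (fun x => (ρ x : ℂ)) (volume : Measure (Space d)) :=
    (Complex.continuous_ofReal.comp hρ).aestronglyMeasurable
  have e : (fun x => (ρ x : ℂ) * (F + G) x) =
      (fun x => (ρ x : ℂ) * F x) + fun x => (ρ x : ℂ) * G x := by
    funext x; simp [mul_add]
  rw [e]
  exact eLpNorm_add_le (hm.mul hF.1) (hm.mul hG.1) (by norm_num)

lemma weightedL2Norm_zero (ρ : Space d → ℝ) : weightedL2Norm ρ (0 : 𝓢'(Space d, ℂ)) = 0 := by
  refine le_antisymm ?_ bot_le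
  refine (iInf₂_le 0 ⟨aestronglyMeasurable_zero, fun φ => ?_⟩).trans (by simp)
  simp

lemma weightedL2Norm_smul_le (ρ : Space d → ℝ) (c : ℂ) (u : 𝓢'(Space d, ℂ)) :
    weightedL2Norm ρ (c • u) ≤ ‖c‖ₑ * weightedL2Norm ρ u := by
  rcases eq_or_ne c 0 with rfl | hc
  · have h0 : (0 : ℂ) • u = 0 := by
      ext φ
      exact zero_smul ℂ (u φ)
    rw [h0, weightedL2Norm_zero]
    exact bot_le
  have hc0 : ‖c‖ₑ ≠ 0 := by simpa using hc
  have hct : ‖c‖ₑ ≠ ⊤ := enorm_ne_top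
  rw [mul_comm, ← ENNReal.div_le_iff_le_mul (Or.inl hc0) (Or.inl hct)]
  refine le_iInf₂ fun F hF => ?_
  rw [ENNReal.div_le_iff_le_mul (Or.inl hc0) (Or.inl hct)]
  refine (iInf₂_le (c • F) (hF.smul c)).trans ?_
  have e : (fun x => (ρ x : ℂ) * (c • F) x) = c • fun x => (ρ x : ℂ) * F x := by
    funext x; simp [mul_left_comm]
  rw [e, eLpNorm_const_smul, mul_comm]

lemma sobolevNorm_lt_top_iff (P : DyadicPair d) (r : ℝ) (ρ : Space d → ℝ)
    (u : 𝓢'(Space d, ℂ)) : sobolevNorm P r ρ u < ⊤ ↔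
      ∑' n : ℕ, (ENNReal.ofReal ((2 : ℝ) ^ (((n : ℝ) - 1) * r)) *
        weightedL2Norm ρ (P.block n u)) ^ 2 < ⊤ := by
  unfold sobolevNorm
  exact ENNReal.rpow_lt_top_iff_of_pos (by norm_num)

lemma continuous_bracket (η : ℝ) : Continuous (bracket η : Space d → ℝ) := by
  unfold bracket
  exact Continuous.rpow_const (by fun_prop) fun x => Or.inl (by positivity)

/-- The space `H^r(⟨x⟩^η)` of tempered distributions of finite norm. -/
def sobolev (P : DyadicPair d) (r η : ℝ) : Submodule ℂ 𝓢'(Space d, ℂ) where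
  carrier := {u | sobolevNorm P r (bracket η) u < ⊤}
  zero_mem' := by
    simp [sobolevNorm, weightedL2Norm_zero]
  add_mem' := by
    intro u v hu hv
    simp only [mem_ofPred_eq, sobolevNorm_lt_top_iff] at hu hv ⊢
    have key : ∀ a b : ℝ≥0∞, (a + b) ^ 2 ≤ 4 * (a ^ 2 + b ^ 2) := by
      intro a b
      rcases le_total a b with h | h
      · calc (a + b) ^ 2 ≤ (b + b) ^ 2 := by gcongr
          _ = 4 * b ^ 2 := by ring
          _ ≤ _ := by gcongr; exact le_add_self
      · calc (a + b) ^ 2 ≤ (a + a) ^ 2 := by gcongr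
          _ = 4 * a ^ 2 := by ring
          _ ≤ _ := by gcongr; exact le_self_add
    refine lt_of_le_of_lt ?_ (ENNReal.mul_lt_top (a := 4) (by simp) (ENNReal.add_lt_top.2 ⟨hu, hv⟩))
    rw [← ENNReal.tsum_add, ← ENNReal.tsum_mul_left]
    refine ENNReal.tsum_le_tsum fun n => le_trans ?_ (key _ _)
    rw [map_add, ← mul_add]
    gcongr
    exact weightedL2Norm_add_le (continuous_bracket η) _ _
  smul_mem' := by
    intro c u hu
    simp only [mem_ofPred_eq, sobolevNorm_lt_top_iff] at hu ⊢
    refine lt_of_le_of_lt ?_ (ENNReal.mul_lt_top (a := ‖c‖ₑ ^ 2) (by simp) hu)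
    rw [← ENNReal.tsum_mul_left]
    refine ENNReal.tsum_le_tsum fun n => ?_
    rw [map_smul, ← mul_pow, mul_left_comm]
    gcongr
    exact weightedL2Norm_smul_le _ _ _

/-! ### The regularized Faddeev-type operator -/

/-- `r_{k,γ} = (k² + |γ|²)^{1/2}`. -/
def radius (k : ℝ) (γ : Space d) : ℝ := Real.sqrt (k ^ 2 + ‖γ‖ ^ 2)

/-- The symbol `m_{k,γ,τ}(ξ) = |ξ|² - k² - |γ|² + 2iγ·ξ - iτ`. -/
def symb (k : ℝ) (γ : Space d) (τ : ℝ) (ξ : Space d) : ℂ :=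
  ((‖ξ‖ ^ 2 - k ^ 2 - ‖γ‖ ^ 2 : ℝ) : ℂ) + 2 * Complex.I * (inner ℝ γ ξ : ℝ) - Complex.I * τ

/-- A smooth cutoff `ψ : ℝ → [0,1]` supported in `B(0,1)` with `ψ = 1` on `B(0,1/2)`. -/
structure IsCutoff (ψ : ℝ → ℝ) : Prop where
  smooth : ContDiff ℝ ∞ ψ
  mem_Icc : ∀ x, ψ x ∈ Icc (0 : ℝ) 1
  supp : tsupport ψ ⊆ Metric.ball 0 1
  eq_one : ∀ x ∈ Metric.ball (0 : ℝ) (1 / 2), ψ x = 1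

/-- The rescaled cutoff `ψ(x; r₀, ε₀) = ψ(|x - r₀| / ε₀)` on the real line. -/
def cutoffAt (ψ : ℝ → ℝ) (r₀ ε₀ x : ℝ) : ℝ := ψ (|x - r₀| * ε₀⁻¹)

/-- The unit sphere of `ℝᵈ`. -/
abbrev Sph (d : ℕ) := Metric.sphere (0 : Space d) 1

/-- The product `f̂(ξ) · conj ĝ(ξ)`. -/
def fg (f g : 𝓢(Space d, ℂ)) (ξ : Space d) : ℂ := fhat f ξ * (starRingEnd ℂ) (fhat g ξ)

variable (k : ℝ) (γ : Space d) (τ : ℝ) (ψ : ℝ → ℝ) (ε₀ s : ℝ) (f g : 𝓢(Space d, ℂ))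

/-- The common factor `(1 + r²)^{s/2} r^{d-1} / m_{k,γ,τ}(rθ)` of the three integrands. -/
def kernel (r : ℝ) (θ : Sph d) : ℂ :=
  (((1 + r ^ 2) ^ (s / 2) * r ^ (d - 1) : ℝ) : ℂ) / symb k γ τ (r • (θ : Space d))

/-- The integrand of `I^{(1,s)}`, away from the sphere `|ξ| = r_{k,γ}`. -/
def integrand₁ (r : ℝ) (θ : Sph d) : ℂ :=
  kernel k γ τ s r θ * fg f g (r • (θ : Space d)) *
    ((1 - cutoffAt ψ (radius k γ) ε₀ r : ℝ) : ℂ)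

/-- The integrand of `I^{(2,s)}`, with `f̂` and `ĝ` frozen on the sphere `|ξ| = r_{k,γ}`. -/
def integrand₂ (r : ℝ) (θ : Sph d) : ℂ :=
  kernel k γ τ s r θ * fg f g (radius k γ • (θ : Space d)) *
    (cutoffAt ψ (radius k γ) ε₀ r : ℂ)

/-- The integrand of `I^{(3,s)}`, with the difference. -/
def integrand₃ (r : ℝ) (θ : Sph d) : ℂ :=
  kernel k γ τ s r θ *
    (fg f g (r • (θ : Space d)) - fg f g (radius k γ • (θ : Space d))) *
      (cutoffAt ψ (radius k γ) ε₀ r : ℂ)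

/-- `∫_0^∞ ∫_{S^{d-1}} F(r, θ) dθ dr`, where `dθ` is surface measure. -/
def polarIntegral (F : ℝ → Sph d → ℂ) : ℂ :=
  ∫ r in Ioi (0 : ℝ), ∫ θ : Sph d, F r θ ∂((volume : Measure (Space d)).toSphere)

/-- Absolute convergence of `∫_0^∞ ∫_{S^{d-1}} F(r, θ) dθ dr`. -/
def PolarIntegrable (F : ℝ → Sph d → ℂ) : Prop :=
  Integrable (Function.uncurry F)
    ((volume.restrict (Ioi (0 : ℝ))).prod ((volume : Measure (Space d)).toSphere))

/-- The three integrals that define the operator converge absolutely. -/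
def IntegralsConverge : Prop :=
  PolarIntegrable (integrand₁ k γ τ ψ ε₀ s f g) ∧ PolarIntegrable (integrand₂ k γ τ ψ ε₀ s f g) ∧
    PolarIntegrable (integrand₃ k γ τ ψ ε₀ s f g)

/-- `I^{(1,s)}(f,g) + I^{(2,s)}(f,g) + I^{(3,s)}(f,g)`. -/
def dualityForm : ℂ :=
  polarIntegral (integrand₁ k γ τ ψ ε₀ s f g) + polarIntegral (integrand₂ k γ τ ψ ε₀ s f g) +
    polarIntegral (integrand₃ k γ τ ψ ε₀ s f g)

/-- The duality formula that defines `H_{k,γ,τ}(·; ψ, ε₀) : 𝓢 → 𝓢'`: for every `s ∈ [0,2]`,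
`⟨(I - Δ)^{s/2} H f, g⟩ = I^{(1,s)}(f,g) + I^{(2,s)}(f,g) + I^{(3,s)}(f,g)`. Already the case `s = 0`
determines `H`. -/
def IsRegularizedFaddeev (H : 𝓢(Space d, ℂ) →ₗ[ℂ] 𝓢'(Space d, ℂ)) : Prop :=
  ∀ s ∈ Icc (0 : ℝ) 2, ∀ f g : 𝓢(Space d, ℂ),
    pairing (bessel s (H f)) g = dualityForm k γ τ ψ ε₀ s f g

open Classical in
/-- The regularized Faddeev-type operator `H_{k,γ,τ}(·; ψ, ε₀) : 𝓢 → 𝓢'`, the only operator that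
satisfies the duality formula. (The value `0` is a placeholder for parameters for which there is no
such operator.) -/
def faddeev : 𝓢(Space d, ℂ) →ₗ[ℂ] 𝓢'(Space d, ℂ) :=
  if h : ∃ H : 𝓢(Space d, ℂ) →ₗ[ℂ] 𝓢'(Space d, ℂ), IsRegularizedFaddeev k γ τ ψ ε₀ H then
    h.choose else 0

/-- The differential operator `-(Δ + k² + |γ|² - 2γ·∇ + iτ)`, on Schwartz functions and on tempered
distributions. -/
def diffOp {V : Type*} [AddCommGroup V] [Module ℂ V] [LineDeriv (Space d) V V] [Laplacian V V]
    (u : V) : V :=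
  -(Δ u + ((k ^ 2 + ‖γ‖ ^ 2 : ℝ) : ℂ) • u - (2 : ℂ) • ∂_{γ} u + (Complex.I * τ) • u)

end Faddeev

end

open Faddeev

/-! The cutoff and the frozen values on the sphere cancel. Since `1 / m` is locally integrable, the
three integrals add up to `∫ ⟨ξ⟩^σ f̂ conj(ĝ) / m`, so the operator is the Fourier multiplier `1 /
m`. It inverts the differential operator because `m` vanishes only on a null set. Local
integrability comes from `|m| ≥ |τ|` when `γ = 0`. Otherwise it comes from `|1/m| ≤ |Re m|^(-1/4)
|Im m|^(-3/4)`, integrated first along a direction orthogonal to `γ` and then along `γ`; this needs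
`d ≥ 2`. See `integrable_mul_inv_symb` and `integralsConverge_and_dualityForm_eq`.

The analytic core is the estimate `exists_enorm_integral_invSymb_le`: with `R = radius k γ`, the
bilinear form of `1 / m` is bounded by `C (1/R + 1/R²)` on `L²(⟨x⟩^η)`, `η > 1/2`, uniformly in `τ ≠
0`. On a line `t e + y` the symbol is `4π² (t - z)(t - w)`, and `|z - w|` is the square root of a
discriminant that depends on `y` only. By partial fractions, the Fourier transform of `1 / ((t -
z)(t - w))` is at most `4π / |z - w|`, however close the roots are to the real axis
(`norm_fourier_inv_mul_inv_le`). Only the distance between the roots matters, not their distance to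
the integration line. The transforms of `f` and `g` along the line are superpositions of characters
whose total mass is an `L¹` norm in the direction `e`. The weight controls this mass because `η >
1/2` (`lintegral_sq_lineMass_le`).

It remains to keep the roots apart. Frequencies whose coordinates are all small compared with `R`
are elliptic, since `|m| ≥ R²/2` there. The rest is split by a telescoping partition into pieces on
which one coordinate `ξ_j` is at least of order `R`. On such a piece either the discriminant in the
direction `e_j` is at least of order `R²`, so the roots are of order `R` apart, or it is small
compared with `ξ_j²`, and then `|m|` is at least of order `R²`. The discriminant cutoff is constant
along the lines, so it may be sharp.

For the Sobolev estimate the resolvent is applied block by block. A block at frequency at most of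
order `1 + R` uses the core bound and pays `(1 + R)^s`; the conditions on `ε₀` give `1/R + 1/R² ≤
2/(ε₀ R)`. A block at higher frequency lies where `|m| ≥ |ξ|²/2`, and this gain of two derivatives
covers `s ≤ 2`. A general element of `H^r` need not be a function, so the operator is defined by
splitting: the low frequencies form a weighted `L²` function, on which the resolvent acts by
duality, and the high frequencies are multiplied by a symbol of temperate growth
(`exists_resolvent_operator`). Commutation with the blocks is checked on Schwartz functions and
extended by density in weighted `L²` (`integral_mul_dualResolvent_dualMult`). The bound for `η₀`
implies that for every `η ≥ η₀` with the same constant, by monotonicity of the weights. -/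

noncomputable section

namespace Faddeev

/-! ### Splitting space into lines parallel to a unit vector -/

section LineSplit

variable {V : Type*} [NormedAddCommGroup V] [InnerProductSpace ℝ V] [FiniteDimensional ℝ V]
  [MeasurableSpace V] [BorelSpace V]

/-- The coordinates `(t, y) ↦ t e + y`, `y ⟂ e`. -/
def lineMap (e : V) (p : ℝ × ((ℝ ∙ e)ᗮ : Submodule ℝ V)) : V := p.1 • e + (p.2 : V)

omit [FiniteDimensional ℝ V] [MeasurableSpace V] [BorelSpace V] in
lemma continuous_lineMap (e : V) : Continuous (lineMap e) := by
  unfold lineMap; fun_prop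

lemma measurePreserving_lineMap {e : V} (he : ‖e‖ = 1) :
    MeasurePreserving (lineMap e) (volume.prod volume) volume := by
  have h1 := (LinearIsometryEquiv.toSpanUnitSingleton (𝕜 := ℝ) e he).measurePreserving.prod
    (MeasurePreserving.id (volume : Measure ((ℝ ∙ e)ᗮ : Submodule ℝ V)))
  have h2 := (WithLp.volume_preserving_toLp (ℝ ∙ e : Submodule ℝ V)
    ((ℝ ∙ e)ᗮ : Submodule ℝ V)).comp h1
  have h3 := (ℝ ∙ e : Submodule ℝ V).orthogonalDecomposition.symm.measurePreserving.comp h2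
  have e1 : lineMap e = (ℝ ∙ e : Submodule ℝ V).orthogonalDecomposition.symm ∘
      WithLp.toLp 2 ∘ Prod.map (LinearIsometryEquiv.toSpanUnitSingleton (𝕜 := ℝ) e he) id := by
    funext p
    simp [lineMap]
  rw [e1]
  exact h3

omit [FiniteDimensional ℝ V] [MeasurableSpace V] [BorelSpace V] in
lemma inner_orthogonal_right {e : V} (y : ((ℝ ∙ e)ᗮ : Submodule ℝ V)) : inner ℝ e (y : V) = 0 :=
  Submodule.mem_orthogonal_singleton_iff_inner_right.1 y.2

omit [FiniteDimensional ℝ V] [MeasurableSpace V] [BorelSpace V] in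
lemma norm_sq_lineMap {e : V} (he : ‖e‖ = 1) (t : ℝ) (y : ((ℝ ∙ e)ᗮ : Submodule ℝ V)) :
    ‖lineMap e (t, y)‖ ^ 2 = t ^ 2 + ‖y‖ ^ 2 := by
  have h : inner ℝ (t • e) (y : V) = 0 := by
    rw [real_inner_smul_left, inner_orthogonal_right, mul_zero]
  have := norm_add_sq_eq_norm_sq_add_norm_sq_real h
  simp only [lineMap, pow_two, this, norm_smul, he, mul_one, Real.norm_eq_abs, abs_mul_abs_self,
    Submodule.coe_norm]

lemma lintegral_lineMap {e : V} (he : ‖e‖ = 1) {f : V → ℝ≥0∞} (hf : Measurable f) :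
    ∫⁻ x, f x = ∫⁻ y : ((ℝ ∙ e)ᗮ : Submodule ℝ V), ∫⁻ t : ℝ, f (lineMap e (t, y)) := by
  rw [← (measurePreserving_lineMap he).lintegral_comp hf, lintegral_prod_symm]
  exact (hf.comp (measurePreserving_lineMap he).measurable).aemeasurable

end LineSplit

/-! ### Local integrability of the singular factors -/

section LocalIntegrability

/-- Only points within distance one of `c` see the singularity, and by translation their
contribution does not depend on `c`; elsewhere the integrand is at most one. Uniformity in `c` is
what allows slicing. -/
lemma lintegral_Icc_abs_rpow_le (s : ℝ) (hs0 : 0 ≤ s) (hs : s < 1) :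
    ∃ C : ℝ≥0∞, C ≠ ⊤ ∧ ∀ R : ℝ, 0 ≤ R → ∀ c : ℝ,
      ∫⁻ t in Icc (-R) R, ENNReal.ofReal (|t - c| ^ (-s)) ≤ C + ENNReal.ofReal (2 * R) := by
  refine ⟨∫⁻ t in Icc (-1 : ℝ) 1, ENNReal.ofReal (|t| ^ (-s)), ?_, fun R hR c => ?_⟩
  · have h1 : IntervalIntegrable (fun t : ℝ => |t| ^ (-s)) volume (-1) 1 := by
      have h : ∀ b : ℝ, IntervalIntegrable (fun t : ℝ => |t| ^ (-s)) volume 0 b := by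
        have : ∀ b : ℝ, 0 ≤ b → IntervalIntegrable (fun t : ℝ => |t| ^ (-s)) volume 0 b := by
          intro b hb
          refine (intervalIntegral.intervalIntegrable_rpow' (r := -s) (by linarith)).congr ?_
          intro x hx
          rw [uIoc_of_le hb] at hx
          simp [abs_of_pos hx.1]
        intro b
        rcases le_total 0 b with hb | hb
        · exact this b hb
        · have := (this (-b) (by linarith)).comp_mul_left (c := -1)
          simpa using this
      exact (h (-1)).symm.trans (h 1)
    rw [intervalIntegrable_iff_integrableOn_Icc_of_le (by norm_num)] at h1
    have := h1.2
    rw [hasFiniteIntegral_iff_ofReal (ae_of_all _ fun t => by positivity)] at this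
    exact this.ne
  · have hpt : ∀ t : ℝ, (Icc (-R) R).indicator (fun t => ENNReal.ofReal (|t - c| ^ (-s))) t ≤
        (Icc (-1 : ℝ) 1).indicator (fun t => ENNReal.ofReal (|t| ^ (-s))) (t - c) +
          (Icc (-R) R).indicator (fun _ => 1) t := by
      intro t
      by_cases ht : t ∈ Icc (-R) R
      · by_cases h1 : t - c ∈ Icc (-1 : ℝ) 1
        · simp only [indicator_of_mem ht, indicator_of_mem h1]
          exact le_add_of_nonneg_right zero_le
        · simp only [indicator_of_mem ht, indicator_of_notMem h1, zero_add]
          rw [← ENNReal.ofReal_one]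
          refine ENNReal.ofReal_le_ofReal ?_
          refine Real.rpow_le_one_of_one_le_of_nonpos ?_ (by linarith)
          by_contra h
          exact h1 (abs_le.1 (not_le.1 h).le)
      · simp [indicator_of_notMem ht]
    rw [← lintegral_indicator measurableSet_Icc, ← lintegral_indicator measurableSet_Icc]
    refine (lintegral_mono hpt).trans ?_
    rw [lintegral_add_right _ (measurable_const.indicator measurableSet_Icc),
      lintegral_sub_right_eq_self (fun t => (Icc (-1 : ℝ) 1).indicator
        (fun t => ENNReal.ofReal (|t| ^ (-s))) t) c, lintegral_indicator measurableSet_Icc (fun _ => 1)]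
    refine add_le_add le_rfl (le_of_eq ?_)
    rw [setLIntegral_const, one_mul, Real.volume_Icc]
    congr 1
    ring

/-- The factor of `(t - √a)(t + √a)` belonging to the root on the other side of `0` from `t` is the
larger one, so `|t² - a|` dominates the square of the other factor. For `a ≤ 0` the convention `√a =
0` reduces this to `t² - a ≥ t²`. -/
lemma abs_sq_sub_rpow_le (a : ℝ) {t : ℝ} (ht0 : t ≠ 0) : ENNReal.ofReal (|t ^ 2 - a| ^ (-(1 / 4) : ℝ)) ≤
    ENNReal.ofReal (|t - √a| ^ (-(1 / 2) : ℝ)) + ENNReal.ofReal (|t - -√a| ^ (-(1 / 2) : ℝ)) := by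
  rw [← ENNReal.ofReal_add (by positivity) (by positivity)]
  refine ENNReal.ofReal_le_ofReal ?_
  -- Real powers give `0 ^ (-1/2) = 0`, so at a root the left side has to vanish as well; this is
  -- the last hypothesis.
  have key : ∀ x y : ℝ, x ^ 2 ≤ |y| → (x = 0 → |y| ^ (-(1 / 4) : ℝ) = 0) →
      |y| ^ (-(1 / 4) : ℝ) ≤ |x| ^ (-(1 / 2) : ℝ) := by
    intro x y h h0
    rcases eq_or_ne x 0 with hx | hx
    · rw [h0 hx]; positivity
    · have e : |x| ^ (-(1 / 2) : ℝ) = (x ^ 2) ^ (-(1 / 4) : ℝ) := by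
        rw [← sq_abs, ← Real.rpow_natCast, ← Real.rpow_mul (abs_nonneg x)]
        norm_num
      rw [e]
      exact Real.rpow_le_rpow_of_nonpos (by positivity) h (by norm_num)
  rcases le_total a 0 with ha | ha
  · rw [Real.sqrt_eq_zero_of_nonpos ha]
    refine (key t _ ?_ fun h => absurd h ht0).trans ?_
    · rw [abs_of_nonneg (by nlinarith [sq_nonneg t])]; linarith
    · simp only [sub_zero]; exact le_add_of_nonneg_right (by positivity)
  · have hs := Real.sq_sqrt ha
    have hf : t ^ 2 - a = (t - √a) * (t - -√a) := by rw [← hs]; simp; ring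
    have hn := Real.sqrt_nonneg a
    rcases le_total 0 t with ht | ht
    · refine (key (t - √a) _ ?_ ?_).trans (le_add_of_nonneg_right (by positivity))
      · rw [hf, abs_mul, ← sq_abs, pow_two]
        refine mul_le_mul_of_nonneg_left ?_ (abs_nonneg _)
        rw [abs_of_nonneg (by linarith : 0 ≤ t - -√a), abs_le]
        constructor <;> linarith
      · intro h; rw [hf, h]; simp
    · refine (key (t - -√a) _ ?_ ?_).trans (le_add_of_nonneg_left (by positivity))
      · rw [hf, abs_mul, ← sq_abs, pow_two]
        rw [mul_comm |t - √a|]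
        refine mul_le_mul_of_nonneg_left ?_ (abs_nonneg _)
        rw [abs_of_nonpos (by linarith : t - √a ≤ 0), abs_le]
        constructor <;> linarith
      · intro h; rw [hf, h]; simp

lemma lintegral_Icc_sq_sub_rpow_le : ∃ C : ℝ≥0∞, C ≠ ⊤ ∧ ∀ R : ℝ, 0 ≤ R → ∀ a : ℝ,
    ∫⁻ t in Icc (-R) R, ENNReal.ofReal (|t ^ 2 - a| ^ (-(1 / 4) : ℝ)) ≤
      2 * (C + ENNReal.ofReal (2 * R)) := by
  obtain ⟨C, hC, h⟩ := lintegral_Icc_abs_rpow_le (1 / 2) (by norm_num) (by norm_num)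
  refine ⟨C, hC, fun R hR a => ?_⟩
  have h0 : ∀ᵐ t : ℝ ∂(volume.restrict (Icc (-R) R)), t ≠ 0 :=
    ae_restrict_of_ae (by simp [ae_iff])
  refine (lintegral_mono_ae (h0.mono fun t ht => abs_sq_sub_rpow_le a ht)).trans ?_
  rw [lintegral_add_left (by fun_prop), two_mul]
  exact add_le_add (h R hR _) (h R hR _)

variable {V : Type*} [NormedAddCommGroup V] [InnerProductSpace ℝ V] [FiniteDimensional ℝ V]
  [MeasurableSpace V] [BorelSpace V]

/-- In coordinates along `γ / ‖γ‖` this is a one-dimensional singularity of order `3/4 < 1`, times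
the finite volume of a ball in the orthogonal variables. -/
lemma lintegral_closedBall_inner_rpow_lt_top {γ : V} (hγ : γ ≠ 0) (τ R : ℝ) (hR : 0 ≤ R) :
    ∫⁻ ξ in Metric.closedBall (0 : V) R,
      ENNReal.ofReal (|2 * inner ℝ γ ξ - τ| ^ (-(3 / 4) : ℝ)) < ⊤ := by
  obtain ⟨C, hC, h⟩ := lintegral_Icc_abs_rpow_le (3 / 4) (by norm_num) (by norm_num)
  have hn : 0 < ‖γ‖ := norm_pos_iff.2 hγ
  set e : V := ‖γ‖⁻¹ • γ with he_def
  have he : ‖e‖ = 1 := by rw [he_def, norm_smul, norm_inv, norm_norm, inv_mul_cancel₀ hn.ne']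
  have hγe : γ = ‖γ‖ • e := by rw [he_def, smul_smul, mul_inv_cancel₀ hn.ne', one_smul]
  rw [← lintegral_indicator Metric.isClosed_closedBall.measurableSet, lintegral_lineMap he]
  swap
  · exact Measurable.indicator (by fun_prop) Metric.isClosed_closedBall.measurableSet
  set K : ℝ≥0∞ := ENNReal.ofReal ((2 * ‖γ‖) ^ (-(3 / 4) : ℝ)) with hK
  have hb : ∀ (y : ((ℝ ∙ e)ᗮ : Submodule ℝ V)) (t : ℝ),
      (Metric.closedBall (0 : V) R).indicator (fun ξ =>
        ENNReal.ofReal (|2 * inner ℝ γ ξ - τ| ^ (-(3 / 4) : ℝ))) (lineMap e (t, y)) ≤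
      (Metric.closedBall (0 : ((ℝ ∙ e)ᗮ : Submodule ℝ V)) R).indicator 1 y *
        (K * (Icc (-R) R).indicator (fun t =>
          ENNReal.ofReal (|t - τ / (2 * ‖γ‖)| ^ (-(3 / 4) : ℝ))) t) := by
    intro y t
    by_cases hm : lineMap e (t, y) ∈ Metric.closedBall (0 : V) R
    · have hns := norm_sq_lineMap he t y
      rw [mem_closedBall_zero_iff] at hm
      have hle : t ^ 2 + ‖y‖ ^ 2 ≤ R ^ 2 := by
        rw [← hns]; gcongr
      have ht : t ∈ Icc (-R) R := abs_le.1 (abs_le_of_sq_le_sq (by nlinarith [sq_nonneg ‖y‖]) hR)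
      have hy : y ∈ Metric.closedBall (0 : ((ℝ ∙ e)ᗮ : Submodule ℝ V)) R := by
        rw [mem_closedBall_zero_iff]
        exact le_of_sq_le_sq (by nlinarith [sq_nonneg t]) hR
      rw [indicator_of_mem (mem_closedBall_zero_iff.2 hm), indicator_of_mem ht,
        indicator_of_mem hy, Pi.one_apply, one_mul, hK, ← ENNReal.ofReal_mul (by positivity),
        ← Real.mul_rpow (by positivity) (by positivity)]
      have e2 : inner ℝ γ (lineMap e (t, y)) = ‖γ‖ * t := by
        conv_lhs => rw [hγe]
        rw [lineMap, inner_smul_left, inner_add_right, inner_orthogonal_right, inner_smul_right,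
          real_inner_self_eq_norm_sq, he]
        simp
      rw [e2]
      refine le_of_eq ?_
      congr 2
      rw [← abs_of_pos (by positivity : (0 : ℝ) < 2 * ‖γ‖), ← abs_mul]
      congr 1
      rw [abs_of_pos (by positivity : (0 : ℝ) < 2 * ‖γ‖)]
      field_simp
    · simp [indicator_of_notMem hm]
  refine (lintegral_mono fun y => lintegral_mono fun t => hb y t).trans_lt ?_
  have hmeas : Measurable (fun t : ℝ => (Icc (-R) R).indicator (fun t =>
          ENNReal.ofReal (|t - τ / (2 * ‖γ‖)| ^ (-(3 / 4) : ℝ))) t) :=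
    Measurable.indicator (by fun_prop) measurableSet_Icc
  have hi : ∫⁻ t : ℝ, K * (Icc (-R) R).indicator (fun t =>
      ENNReal.ofReal (|t - τ / (2 * ‖γ‖)| ^ (-(3 / 4) : ℝ))) t < ⊤ := by
    rw [lintegral_const_mul _ hmeas, lintegral_indicator measurableSet_Icc]
    exact ENNReal.mul_lt_top ENNReal.ofReal_lt_top ((h R hR _).trans_lt
      (ENNReal.add_lt_top.2 ⟨hC.lt_top, ENNReal.ofReal_lt_top⟩))
  simp_rw [lintegral_const_mul _ (hmeas.const_mul K)]
  rw [lintegral_mul_const _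
    (measurable_one.indicator Metric.isClosed_closedBall.measurableSet)]
  refine ENNReal.mul_lt_top ?_ hi
  rw [lintegral_indicator_one Metric.isClosed_closedBall.measurableSet]
  exact (isCompact_closedBall _ _).measure_lt_top

/-- As `e ⟂ γ`, the second factor does not depend on the coordinate along `e`. Integrating that
coordinate first removes the first factor, with a bound uniform in `y`, and leaves the preceding
lemma on the hyperplane `e^⟂`, which contains `γ`. -/
lemma lintegral_closedBall_inner_mul_rpow_lt_top {γ e : V} (hγ : γ ≠ 0) (he : ‖e‖ = 1)
    (hγe : inner ℝ e γ = 0) (τ ρ R : ℝ) (hR : 0 ≤ R) :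
    ∫⁻ ξ in Metric.closedBall (0 : V) R,
      ENNReal.ofReal (|‖ξ‖ ^ 2 - ρ| ^ (-(1 / 4) : ℝ) *
        |2 * inner ℝ γ ξ - τ| ^ (-(3 / 4) : ℝ)) < ⊤ := by
  obtain ⟨C, hC, h⟩ := lintegral_Icc_sq_sub_rpow_le
  set g : ((ℝ ∙ e)ᗮ : Submodule ℝ V) :=
    ⟨γ, Submodule.mem_orthogonal_singleton_iff_inner_right.2 hγe⟩ with hg_def
  have hg : g ≠ 0 := fun h => hγ (congrArg Subtype.val h)
  have h2 := lintegral_closedBall_inner_rpow_lt_top hg τ R hR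
  rw [← lintegral_indicator Metric.isClosed_closedBall.measurableSet, lintegral_lineMap he]
  swap
  · exact Measurable.indicator (by fun_prop) Metric.isClosed_closedBall.measurableSet
  set L := fun y : ((ℝ ∙ e)ᗮ : Submodule ℝ V) =>
    (Metric.closedBall (0 : ((ℝ ∙ e)ᗮ : Submodule ℝ V)) R).indicator (fun y =>
      ENNReal.ofReal (|2 * inner ℝ g y - τ| ^ (-(3 / 4) : ℝ))) y with hL
  have hb : ∀ (y : ((ℝ ∙ e)ᗮ : Submodule ℝ V)) (t : ℝ),
      (Metric.closedBall (0 : V) R).indicator (fun ξ =>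
        ENNReal.ofReal (|‖ξ‖ ^ 2 - ρ| ^ (-(1 / 4) : ℝ) *
          |2 * inner ℝ γ ξ - τ| ^ (-(3 / 4) : ℝ))) (lineMap e (t, y)) ≤
      (Icc (-R) R).indicator (fun t =>
          ENNReal.ofReal (|t ^ 2 - (ρ - ‖y‖ ^ 2)| ^ (-(1 / 4) : ℝ))) t * L y := by
    intro y t
    by_cases hm : lineMap e (t, y) ∈ Metric.closedBall (0 : V) R
    · have hns := norm_sq_lineMap he t y
      rw [mem_closedBall_zero_iff] at hm
      have hle : t ^ 2 + ‖y‖ ^ 2 ≤ R ^ 2 := by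
        rw [← hns]; gcongr
      have ht : t ∈ Icc (-R) R := abs_le.1 (abs_le_of_sq_le_sq (by nlinarith [sq_nonneg ‖y‖]) hR)
      have hy : y ∈ Metric.closedBall (0 : ((ℝ ∙ e)ᗮ : Submodule ℝ V)) R := by
        rw [mem_closedBall_zero_iff]
        exact le_of_sq_le_sq (by nlinarith [sq_nonneg t]) hR
      rw [indicator_of_mem (mem_closedBall_zero_iff.2 hm), indicator_of_mem ht, hL]
      simp only
      rw [indicator_of_mem hy, ← ENNReal.ofReal_mul (by positivity), hns]
      have e2 : inner ℝ γ (lineMap e (t, y)) = inner ℝ g y := by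
        rw [lineMap, inner_add_right, inner_smul_right, real_inner_comm, hγe, mul_zero, zero_add,
          Submodule.coe_inner]
      rw [e2]
      refine le_of_eq ?_
      congr 4
      ring
    · simp [indicator_of_notMem hm]
  refine (lintegral_mono fun y => lintegral_mono fun t => hb y t).trans_lt ?_
  have hmeas : ∀ a : ℝ, Measurable (fun t : ℝ => (Icc (-R) R).indicator (fun t =>
          ENNReal.ofReal (|t ^ 2 - a| ^ (-(1 / 4) : ℝ))) t) := fun a =>
    Measurable.indicator (by fun_prop) measurableSet_Icc
  have hi : ∀ y, ∫⁻ t : ℝ, (Icc (-R) R).indicator (fun t =>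
      ENNReal.ofReal (|t ^ 2 - (ρ - ‖y‖ ^ 2)| ^ (-(1 / 4) : ℝ))) t * L y ≤
      2 * (C + ENNReal.ofReal (2 * R)) * L y := by
    intro y
    rw [lintegral_mul_const _ (hmeas _), lintegral_indicator measurableSet_Icc]
    gcongr
    exact h R hR _
  refine (lintegral_mono hi).trans_lt ?_
  have hLm : Measurable L :=
    Measurable.indicator (by fun_prop) Metric.isClosed_closedBall.measurableSet
  rw [lintegral_const_mul _ hLm]
  refine ENNReal.mul_lt_top (ENNReal.mul_lt_top (by simp)
    (ENNReal.add_lt_top.2 ⟨hC.lt_top, ENNReal.ofReal_lt_top⟩)) ?_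
  rw [hL, lintegral_indicator Metric.isClosed_closedBall.measurableSet]
  exact h2

end LocalIntegrability

/-! ### The symbol and the integrability of its inverse -/

section Symbol

variable {d : ℕ} (k : ℝ) (γ : Space d) (τ : ℝ)

lemma continuous_symb : Continuous (symb k γ τ) := by
  unfold symb
  fun_prop

lemma symb_re (ξ : Space d) : (symb k γ τ ξ).re = ‖ξ‖ ^ 2 - radius k γ ^ 2 := by
  rw [radius, Real.sq_sqrt (by positivity)]
  simp [symb, -Complex.ofReal_sub, -Complex.ofReal_pow]
  ring

lemma symb_im (ξ : Space d) : (symb k γ τ ξ).im = 2 * inner ℝ γ ξ - τ := by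
  simp [symb, -Complex.ofReal_sub, -Complex.ofReal_pow]

lemma norm_sq_sub_le_norm_symb (ξ : Space d) :
    |‖ξ‖ ^ 2 - radius k γ ^ 2| ≤ ‖symb k γ τ ξ‖ := by
  rw [← symb_re k γ τ]; exact Complex.abs_re_le_norm _

lemma abs_inner_sub_le_norm_symb (ξ : Space d) :
    |2 * inner ℝ γ ξ - τ| ≤ ‖symb k γ τ ξ‖ := by
  rw [← symb_im k γ τ]; exact Complex.abs_im_le_norm _

/-- Both the real and the imaginary part bound `|m|` from below, and the exponents add up to one.
The real part may have a double root along a line, so its exponent must be below `1/2`; the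
imaginary part is affine, so any exponent below `1` will do. -/
lemma norm_inv_symb_le {ξ : Space d} (hA : ‖ξ‖ ^ 2 - radius k γ ^ 2 ≠ 0)
    (hB : 2 * inner ℝ γ ξ - τ ≠ 0) : ‖(symb k γ τ ξ)⁻¹‖ ≤
    |‖ξ‖ ^ 2 - radius k γ ^ 2| ^ (-(1 / 4) : ℝ) * |2 * inner ℝ γ ξ - τ| ^ (-(3 / 4) : ℝ) := by
  have hA' := abs_pos.2 hA
  have hB' := abs_pos.2 hB
  have hm : 0 < ‖symb k γ τ ξ‖ := hA'.trans_le (norm_sq_sub_le_norm_symb k γ τ ξ)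
  have e : ‖(symb k γ τ ξ)⁻¹‖ =
      ‖symb k γ τ ξ‖ ^ (-(1 / 4) : ℝ) * ‖symb k γ τ ξ‖ ^ (-(3 / 4) : ℝ) := by
    rw [← Real.rpow_add hm, norm_inv, ← Real.rpow_neg_one]
    norm_num
  rw [e]
  refine mul_le_mul ?_ ?_ (by positivity) (by positivity)
  · exact Real.rpow_le_rpow_of_nonpos hA' (norm_sq_sub_le_norm_symb k γ τ ξ) (by norm_num)
  · exact Real.rpow_le_rpow_of_nonpos hB' (abs_inner_sub_le_norm_symb k γ τ ξ) (by norm_num)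

lemma ae_norm_sq_sub_ne_zero {r : ℝ} (hr : 0 < r) :
    ∀ᵐ ξ : Space d, ‖ξ‖ ^ 2 - r ^ 2 ≠ 0 := by
  have h := Measure.addHaar_sphere_of_ne_zero (volume : Measure (Space d)) 0 hr.ne'
  rw [ae_iff]
  refine measure_mono_null (fun ξ hξ => ?_) h
  simp only [ne_eq, not_not, mem_ofPred_eq] at hξ
  rw [mem_sphere_zero_iff_norm]
  exact (sq_eq_sq₀ (norm_nonneg _) hr.le).1 (by linarith)

lemma ae_inner_sub_ne_zero {γ : Space d} (hγ : γ ≠ 0) :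
    ∀ᵐ ξ : Space d, 2 * inner ℝ γ ξ - τ ≠ 0 := by
  set p : Space d := (τ / (2 * ‖γ‖ ^ 2)) • γ with hp
  have hn : ‖γ‖ ≠ 0 := norm_ne_zero_iff.2 hγ
  have hpi : 2 * inner ℝ γ p = τ := by
    rw [hp, inner_smul_right, real_inner_self_eq_norm_sq]; field_simp
  have h := Measure.addHaar_affineSubspace (volume : Measure (Space d))
    (AffineSubspace.mk' p (ℝ ∙ γ)ᗮ) (fun ht => by
      have h1 : p + γ ∈ AffineSubspace.mk' p (ℝ ∙ γ : Submodule ℝ (Space d))ᗮ := by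
        rw [ht]; exact AffineSubspace.mem_top _ _ _
      rw [AffineSubspace.mem_mk', Submodule.mem_orthogonal_singleton_iff_inner_right] at h1
      simp [hγ] at h1)
  rw [ae_iff]
  refine measure_mono_null (fun ξ hξ => ?_) h
  simp only [ne_eq, not_not, mem_ofPred_eq] at hξ
  rw [SetLike.mem_coe, AffineSubspace.mem_mk',
    Submodule.mem_orthogonal_singleton_iff_inner_right, vsub_eq_sub, inner_sub_right]
  linarith

/-- For `γ = 0` the imaginary part is `-τ` and the inverse is bounded. For `γ ≠ 0` the assumption `d
≥ 2` provides a unit vector orthogonal to `γ`. -/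
lemma lintegral_closedBall_inv_symb_lt_top (hd : 2 ≤ d) (hk : 0 < k) (hτ : τ ≠ 0) (R : ℝ) (hR : 0 ≤ R) :
    ∫⁻ ξ in Metric.closedBall (0 : Space d) R, ‖(symb k γ τ ξ)⁻¹‖ₑ < ⊤ := by
  rcases eq_or_ne γ 0 with rfl | hγ
  · refine (lintegral_mono (g := fun _ => ENNReal.ofReal |τ|⁻¹) fun ξ => ?_).trans_lt ?_
    · rw [← ofReal_norm, norm_inv]
      refine ENNReal.ofReal_le_ofReal (inv_anti₀ (abs_pos.2 hτ) ?_)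
      simpa using abs_inner_sub_le_norm_symb k (0 : Space d) τ ξ
    · rw [setLIntegral_const]
      exact ENNReal.mul_lt_top ENNReal.ofReal_lt_top (isCompact_closedBall _ _).measure_lt_top
  · have : Nontrivial ((ℝ ∙ γ)ᗮ : Submodule ℝ (Space d)) := by
      rw [← Module.finrank_pos_iff (R := ℝ)]
      have h1 := Submodule.finrank_add_finrank_orthogonal (ℝ ∙ γ : Submodule ℝ (Space d))
      rw [finrank_span_singleton hγ, finrank_euclideanSpace_fin] at h1
      omega
    obtain ⟨e, he⟩ := exists_norm_eq ((ℝ ∙ γ)ᗮ : Submodule ℝ (Space d)) zero_le_one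
    have hr : 0 < radius k γ := Real.sqrt_pos.2 (by positivity)
    refine (lintegral_mono_ae ?_).trans_lt (lintegral_closedBall_inner_mul_rpow_lt_top hγ
      (e := (e : Space d)) (by simpa using he)
      (by rw [real_inner_comm]; exact inner_orthogonal_right e) τ (radius k γ ^ 2) R hR)
    filter_upwards [ae_restrict_of_ae (ae_norm_sq_sub_ne_zero hr),
      ae_restrict_of_ae (ae_inner_sub_ne_zero τ hγ)] with ξ hA hB
    rw [← ofReal_norm]
    exact ENNReal.ofReal_le_ofReal (norm_inv_symb_le k γ τ hA hB)


/-- On the ball of radius `2 * radius k γ` the bound on `h` and local integrability suffice; outside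
it `|m| ≥ radius k γ ^ 2`, and integrability of `h` suffices. -/
lemma integrable_mul_inv_symb (hd : 2 ≤ d) (hk : 0 < k) (hτ : τ ≠ 0) {h : Space d → ℂ}
    (hi : Integrable h) {B : ℝ} (hB : ∀ ξ, ‖h ξ‖ ≤ B) :
    Integrable fun ξ => h ξ * (symb k γ τ ξ)⁻¹ := by
  have hr : 0 < radius k γ := Real.sqrt_pos.2 (by positivity)
  have hB0 : 0 ≤ B := (norm_nonneg _).trans (hB 0)
  have hm : Measurable fun ξ => (symb k γ τ ξ)⁻¹ := (continuous_symb k γ τ).measurable.inv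
  refine ⟨hi.1.mul hm.aestronglyMeasurable, ?_⟩
  set R : ℝ := 2 * radius k γ with hR
  have hball : MeasurableSet (Metric.closedBall (0 : Space d) R) :=
    Metric.isClosed_closedBall.measurableSet
  have hb : ∀ ξ, ‖h ξ * (symb k γ τ ξ)⁻¹‖ₑ ≤ ENNReal.ofReal B *
      (Metric.closedBall (0 : Space d) R).indicator (fun ξ => ‖(symb k γ τ ξ)⁻¹‖ₑ) ξ +
        ‖h ξ‖ₑ * ENNReal.ofReal (radius k γ ^ 2)⁻¹ := by
    intro ξ
    rw [enorm_mul]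
    by_cases hξ : ξ ∈ Metric.closedBall (0 : Space d) R
    · rw [indicator_of_mem hξ]
      refine le_add_of_le_of_nonneg ?_ zero_le
      gcongr
      rw [← ofReal_norm]
      exact ENNReal.ofReal_le_ofReal (hB ξ)
    · rw [indicator_of_notMem hξ, mul_zero, zero_add]
      gcongr
      rw [← ofReal_norm, norm_inv]
      refine ENNReal.ofReal_le_ofReal (inv_anti₀ (by positivity)
        (le_trans ?_ (norm_sq_sub_le_norm_symb k γ τ ξ)))
      rw [mem_closedBall_zero_iff, not_le] at hξ
      refine le_trans ?_ (le_abs_self _)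
      nlinarith
  refine (lintegral_mono hb).trans_lt ?_
  rw [lintegral_add_left (((hm.enorm.indicator hball)).const_mul _), lintegral_const_mul _
    (hm.enorm.indicator hball), lintegral_indicator hball, lintegral_mul_const'' _ hi.1.enorm]
  exact ENNReal.add_lt_top.2 ⟨ENNReal.mul_lt_top ENNReal.ofReal_lt_top
    (lintegral_closedBall_inv_symb_lt_top k γ τ hd hk hτ R (by positivity)),
    ENNReal.mul_lt_top hi.2 ENNReal.ofReal_lt_top⟩

end Symbol
-- One-dimensional resolvents and pairs of roots
section Resolvent

/-- The kernel of the resolvent `(2πi (D - z))⁻¹` on the line. -/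
def resolventKernel (z : ℂ) (x : ℝ) : ℂ :=
  if 0 ≤ x then (if 0 < z.im then Complex.exp (2 * Real.pi * Complex.I * z * x) else 0)
  else (if 0 < z.im then 0 else -Complex.exp (2 * Real.pi * Complex.I * z * x))

lemma norm_exp_two_pi_mul (z : ℂ) (x : ℝ) :
    ‖Complex.exp (2 * Real.pi * Complex.I * z * x)‖ = Real.exp (-(2 * Real.pi * z.im * x)) := by
  rw [Complex.norm_exp]
  simp

lemma norm_resolventKernel_le (z : ℂ) (x : ℝ) : ‖resolventKernel z x‖ ≤ 1 := by
  unfold resolventKernel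
  split_ifs with h1 h2 h2
  · rw [norm_exp_two_pi_mul, Real.exp_le_one_iff]
    have : 0 ≤ 2 * Real.pi * z.im * x := by positivity
    linarith
  · simp
  · simp
  · rw [norm_neg, norm_exp_two_pi_mul, Real.exp_le_one_iff]
    have : 0 ≤ z.im * x := mul_nonneg_of_nonpos_of_nonpos (not_lt.1 h2) (not_le.1 h1).le
    have : 0 ≤ 2 * Real.pi * (z.im * x) := by positivity
    linarith

/-- Every resolvent kernel jumps by exactly one at the origin, on either side of the real axis. In
the difference the jumps cancel, and Fourier inversion then holds at every point. -/
lemma continuous_resolventKernel_sub (z w : ℂ) :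
    Continuous fun x => resolventKernel z x - resolventKernel w x := by
  have e : (fun x => resolventKernel z x - resolventKernel w x) = fun x : ℝ => if 0 ≤ x then
      ((if 0 < z.im then Complex.exp (2 * Real.pi * Complex.I * z * x) else 0) -
        (if 0 < w.im then Complex.exp (2 * Real.pi * Complex.I * w * x) else 0)) else
      ((if 0 < z.im then 0 else -Complex.exp (2 * Real.pi * Complex.I * z * x)) -
        (if 0 < w.im then 0 else -Complex.exp (2 * Real.pi * Complex.I * w * x))) := by
    funext x
    unfold resolventKernel
    split_ifs <;> rfl
  rw [e]
  refine Continuous.if_le ?_ ?_ continuous_const continuous_id ?_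
  · split_ifs <;> fun_prop
  · split_ifs <;> fun_prop
  · rintro x rfl
    split_ifs <;> simp

lemma integrable_fourier_resolventKernel {z : ℂ} (hz : z.im ≠ 0) :
    Integrable (resolventKernel z) ∧ ∀ t : ℝ, 𝓕 (resolventKernel z) t =
      (2 * Real.pi * Complex.I * (t - z))⁻¹ := by
  have key : ∀ t : ℝ, ∀ x : ℝ, Real.fourierChar (-(x * t)) •
      Complex.exp (2 * Real.pi * Complex.I * z * x) =
      Complex.exp (-(2 * Real.pi * Complex.I * (t - z)) * x) := by
    intro t x
    rw [Circle.smul_def, Real.fourierChar_apply, smul_eq_mul, ← Complex.exp_add]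
    congr 1
    push_cast
    ring
  have hre : ∀ t : ℝ, (-(2 * Real.pi * Complex.I * (t - z))).re = -(2 * Real.pi * z.im) := by
    intro t; simp
  have hne : ∀ t : ℝ, (2 * Real.pi * Complex.I * (t - z)) ≠ 0 := by
    intro t h
    have := hre t
    rw [h] at this
    simp at this
    exact hz this
  rcases lt_or_gt_of_ne hz with h | h
  · have e : resolventKernel z = (Iio (0 : ℝ)).indicator
        fun x => -Complex.exp (2 * Real.pi * Complex.I * z * x) := by
      funext x
      by_cases hx : 0 ≤ x <;> simp [resolventKernel, indicator, hx, not_lt.2 h.le]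
    have hre' : ∀ t : ℝ, 0 < (-(2 * Real.pi * Complex.I * (t - z))).re := fun t => by
      rw [hre]; nlinarith [Real.pi_pos]
    rw [e]
    constructor
    · rw [integrable_indicator_iff measurableSet_Iio]
      have h0 := hre' 0
      have := (integrableOn_exp_mul_complex_Iic h0 0).neg.mono_set Iio_subset_Iic_self
      simpa using this
    · intro t
      rw [Real.fourier_real_eq]
      have e2 : (fun x : ℝ => Real.fourierChar (-(x * t)) • (Iio (0 : ℝ)).indicator
          (fun x : ℝ => -Complex.exp (2 * Real.pi * Complex.I * z * x)) x) =
          (Iio (0 : ℝ)).indicator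
            fun x : ℝ => -Complex.exp (-(2 * Real.pi * Complex.I * (t - z)) * x) := by
        funext x
        by_cases hx : x ∈ Iio (0 : ℝ)
        · rw [indicator_of_mem hx, indicator_of_mem hx, smul_neg, key]
        · rw [indicator_of_notMem hx, indicator_of_notMem hx, smul_zero]
      rw [e2, integral_indicator measurableSet_Iio, integral_neg, ← integral_Iic_eq_integral_Iio,
        integral_exp_mul_complex_Iic (hre' t)]
      simp
  · have e : resolventKernel z = (Ici (0 : ℝ)).indicator
        fun x => Complex.exp (2 * Real.pi * Complex.I * z * x) := by
      funext x
      by_cases hx : 0 ≤ x <;> simp [resolventKernel, indicator, hx, h]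
    have hre' : ∀ t : ℝ, (-(2 * Real.pi * Complex.I * (t - z))).re < 0 := fun t => by
      rw [hre]; nlinarith [Real.pi_pos]
    rw [e]
    constructor
    · rw [integrable_indicator_iff measurableSet_Ici, integrableOn_Ici_iff_integrableOn_Ioi]
      have h0 := hre' 0
      have := integrableOn_exp_mul_complex_Ioi h0 0
      simpa using this
    · intro t
      rw [Real.fourier_real_eq]
      have e2 : (fun x : ℝ => Real.fourierChar (-(x * t)) • (Ici (0 : ℝ)).indicator
          (fun x : ℝ => Complex.exp (2 * Real.pi * Complex.I * z * x)) x) =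
          (Ici (0 : ℝ)).indicator
            fun x : ℝ => Complex.exp (-(2 * Real.pi * Complex.I * (t - z)) * x) := by
        funext x
        by_cases hx : x ∈ Ici (0 : ℝ)
        · rw [indicator_of_mem hx, indicator_of_mem hx, key]
        · rw [indicator_of_notMem hx, indicator_of_notMem hx, smul_zero]
      rw [e2, integral_indicator measurableSet_Ici, integral_Ici_eq_integral_Ioi,
        integral_exp_mul_complex_Ioi (hre' t)]
      simp [neg_div_neg_eq]

lemma integrable_inv_sub_mul_inv_sub {z w : ℂ} (hz : z.im ≠ 0) (hw : w.im ≠ 0) :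
    Integrable fun t : ℝ => (((t : ℂ) - z) * (t - w))⁻¹ := by
  have key : ∀ z : ℂ, z.im ≠ 0 → Integrable fun t : ℝ => (‖(t : ℂ) - z‖ ^ 2)⁻¹ := by
    intro z hz
    have h := (integrable_inv_one_add_sq.comp_sub_right z.re).const_mul (max 1 (z.im ^ 2)⁻¹)
    refine h.mono' (by fun_prop) (ae_of_all _ fun t => ?_)
    have hb : 0 < z.im ^ 2 := by positivity
    have e : ‖(t : ℂ) - z‖ ^ 2 = (t - z.re) ^ 2 + z.im ^ 2 := by
      rw [← Complex.normSq_eq_norm_sq, Complex.normSq_apply]; simp; ring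
    rw [e, Real.norm_of_nonneg (by positivity), ← div_eq_mul_inv, inv_eq_one_div,
      div_le_div_iff₀ (by positivity) (by positivity)]
    have h1 : 1 ≤ max 1 (z.im ^ 2)⁻¹ := le_max_left _ _
    have h2 : (z.im ^ 2)⁻¹ * z.im ^ 2 ≤ max 1 (z.im ^ 2)⁻¹ * z.im ^ 2 := by
      gcongr; exact le_max_right _ _
    rw [inv_mul_cancel₀ hb.ne'] at h2
    nlinarith [sq_nonneg (t - z.re)]
  refine ((key z hz).add (key w hw)).mono' (by fun_prop) (ae_of_all _ fun t => ?_)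
  rw [norm_inv, norm_mul, mul_inv, Pi.add_apply, ← inv_pow, ← inv_pow]
  nlinarith [sq_nonneg (‖(t : ℂ) - z‖⁻¹ - ‖(t : ℂ) - w‖⁻¹), sq_nonneg ‖(t : ℂ) - z‖⁻¹,
    sq_nonneg ‖(t : ℂ) - w‖⁻¹]

/-- By partial fractions, `(z - w) / (2πi (t - z)(t - w))` is the Fourier transform of the
difference of two resolvent kernels, each bounded by one. Inverting gives `2 * 2π / |z - w|`, with
no loss as the roots approach the real axis. -/
lemma norm_fourier_inv_mul_inv_le {z w : ℂ} (hz : z.im ≠ 0) (hw : w.im ≠ 0) (hzw : z ≠ w) (x : ℝ) :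
    ‖𝓕 (fun t : ℝ => (((t : ℂ) - z) * (t - w))⁻¹) x‖ ≤ 4 * Real.pi / ‖z - w‖ := by
  obtain ⟨iz, fz⟩ := integrable_fourier_resolventKernel hz
  obtain ⟨iw, fw⟩ := integrable_fourier_resolventKernel hw
  have hne : ∀ v : ℂ, v.im ≠ 0 → ∀ t : ℝ, (t : ℂ) - v ≠ 0 := by
    intro v hv t h
    apply hv
    have := congrArg Complex.im h
    simpa using this
  set G := fun x => resolventKernel z x - resolventKernel w x with hG
  have hFG : 𝓕 G = fun t : ℝ => ((z - w) / (2 * Real.pi * Complex.I)) •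
      (((t : ℂ) - z) * (t - w))⁻¹ := by
    funext t
    have : 𝓕 G t = 𝓕 (resolventKernel z) t - 𝓕 (resolventKernel w) t := by
      rw [Real.fourier_eq, Real.fourier_eq, Real.fourier_eq, ← integral_sub]
      · simp [hG, smul_sub]
      · exact (Real.fourierIntegral_convergent_iff t).2 iz
      · exact (Real.fourierIntegral_convergent_iff t).2 iw
    rw [this, fz, fw, smul_eq_mul]
    have h1 := hne z hz t
    have h2 := hne w hw t
    have h3 : (Real.pi : ℂ) ≠ 0 := by exact_mod_cast Real.pi_ne_zero
    have h4 := Complex.I_ne_zero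
    field_simp
    ring
  have hQ := integrable_inv_sub_mul_inv_sub hz hw
  have hinv := (continuous_resolventKernel_sub z w).fourierInv_fourier_eq (iz.sub iw)
    (by
      show Integrable (𝓕 G)
      rw [hFG]; exact hQ.const_mul ((z - w) / (2 * Real.pi * Complex.I)))
  have h1 : G (-x) = ((z - w) / (2 * Real.pi * Complex.I)) *
      𝓕 (fun t : ℝ => (((t : ℂ) - z) * (t - w))⁻¹) x := by
    have := congrFun hinv (-x)
    rw [← hG] at this
    change 𝓕⁻ (𝓕 G) (-x) = G (-x) at this
    rw [← this, hFG, Real.fourierInv_eq_fourier_neg, neg_neg, Real.fourier_real_eq,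
      Real.fourier_real_eq, ← integral_const_mul]
    congr 1
    funext t
    simp only [Circle.smul_def, smul_eq_mul]
    ring
  have h2 : ‖G (-x)‖ ≤ 2 := (norm_sub_le _ _).trans
    (by linarith [norm_resolventKernel_le z (-x), norm_resolventKernel_le w (-x)])
  rw [h1, norm_mul, norm_div] at h2
  have hpos : 0 < ‖z - w‖ := norm_pos_iff.2 (sub_ne_zero.2 hzw)
  rw [le_div_iff₀ hpos]
  have h5 : ‖(2 * Real.pi * Complex.I : ℂ)‖ = 2 * Real.pi := by
    simp [abs_of_pos Real.pi_pos]
  rw [h5, div_mul_eq_mul_div, div_le_iff₀ (by positivity)] at h2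
  linarith

variable {X : Type*} [MeasurableSpace X] {μ : Measure X} [SFinite μ]

/-- By Fubini, integrating a superposition of characters against the kernel averages the kernel's
bounded Fourier transform over the points `θ x`. -/
lemma norm_integral_char_mul_inv_le_of_im_ne {h : X → ℂ} (hh : Integrable h μ) {θ : X → ℝ}
    (hθ : Measurable θ) {z w : ℂ} (hz : z.im ≠ 0) (hw : w.im ≠ 0) (hzw : z ≠ w) :
    ‖∫ t : ℝ, (∫ x, Real.fourierChar (-(t * θ x)) • h x ∂μ) * (((t : ℂ) - z) * (t - w))⁻¹‖ ≤
      4 * Real.pi / ‖z - w‖ * ∫ x, ‖h x‖ ∂μ := by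
  have hQ := integrable_inv_sub_mul_inv_sub hz hw
  have hprod : Integrable (Function.uncurry fun (t : ℝ) (x : X) =>
      Real.fourierChar (-(t * θ x)) • h x * (((t : ℂ) - z) * (t - w))⁻¹) (volume.prod μ) := by
    have h1 := hQ.mul_prod hh
    refine h1.mono ?_ (ae_of_all _ fun p => ?_)
    · have h2 : Measurable fun p : ℝ × X => ((Real.fourierChar (-(p.1 * θ p.2)) : Circle) : ℂ) := by
        refine Continuous.measurable (f := fun s : ℝ => ((Real.fourierChar s : Circle) : ℂ))
          (by fun_prop) |>.comp ?_
        fun_prop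
      refine (h2.aestronglyMeasurable.mul h1.1).congr (ae_of_all _ fun p => ?_)
      simp only [Function.uncurry, Circle.smul_def, smul_eq_mul, Pi.mul_apply]
      ring
    · simp only [Function.uncurry, norm_mul, Circle.norm_smul]
      rw [mul_comm]
  simp_rw [← integral_mul_const]
  rw [integral_integral_swap hprod, ← integral_const_mul]
  refine (norm_integral_le_integral_norm _).trans ?_
  refine integral_mono_of_nonneg (ae_of_all _ fun _ => norm_nonneg _)
    (hh.norm.const_mul _) (ae_of_all _ fun x => ?_)
  have e : (∫ t : ℝ, Real.fourierChar (-(t * θ x)) • h x * (((t : ℂ) - z) * (t - w))⁻¹) =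
      h x * 𝓕 (fun t : ℝ => (((t : ℂ) - z) * (t - w))⁻¹) (θ x) := by
    rw [Real.fourier_real_eq, ← integral_const_mul]
    congr 1
    funext t
    simp only [Circle.smul_def, smul_eq_mul]
    ring
  simp only
  rw [e, norm_mul, mul_comm]
  gcongr
  exact norm_fourier_inv_mul_inv_le hz hw hzw _

/-- Real roots are reached as a limit. Moving each root vertically away from the real axis only
increases its distance to every real `t`, so the integrand, assumed integrable, dominates the
perturbed ones, and the bound does not involve the imaginary parts. -/
lemma norm_integral_char_mul_inv_le {h : X → ℂ} (hh : Integrable h μ) {θ : X → ℝ}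
    (hθ : Measurable θ) {z w : ℂ} (hzw : z ≠ w) {P : ℝ → ℂ}
    (hP : ∀ t, P t = ∫ x, Real.fourierChar (-(t * θ x)) • h x ∂μ)
    (hi : Integrable fun t : ℝ => P t * (((t : ℂ) - z) * (t - w))⁻¹) :
    ‖∫ t : ℝ, P t * (((t : ℂ) - z) * (t - w))⁻¹‖ ≤ 4 * Real.pi / ‖z - w‖ * ∫ x, ‖h x‖ ∂μ := by
  -- The vertical direction that leads away from the real axis; a real root is moved upwards.
  set σ : ℂ → ℂ := fun v => if 0 ≤ v.im then Complex.I else -Complex.I with hσ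
  set sh : ℂ → ℝ → ℂ := fun v ε => v + ε * σ v with hsh
  have him : ∀ v : ℂ, ∀ ε : ℝ, 0 < ε → |v.im| ≤ |(sh v ε).im| ∧ (sh v ε).im ≠ 0 := by
    intro v ε hε
    simp only [hsh, hσ]
    split_ifs with h0
    · simp only [Complex.add_im, Complex.mul_im, Complex.ofReal_re, Complex.I_im, mul_one,
        Complex.ofReal_im, Complex.I_re, mul_zero, add_zero]
      rw [abs_of_nonneg h0, abs_of_nonneg (by linarith)]
      exact ⟨by linarith, by linarith⟩
    · simp only [Complex.add_im, Complex.mul_im, Complex.ofReal_re, Complex.I_im, mul_one,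
        Complex.ofReal_im, Complex.I_re, mul_zero, add_zero, Complex.neg_im, mul_neg]
      rw [abs_of_neg (not_le.1 h0), abs_of_neg (by linarith)]
      exact ⟨by linarith, by linarith⟩
  have hre : ∀ v : ℂ, ∀ ε : ℝ, (sh v ε).re = v.re := by
    intro v ε
    simp only [hsh, hσ]
    split_ifs <;> simp
  have hle : ∀ v : ℂ, ∀ ε : ℝ, 0 < ε → ∀ t : ℝ, ‖(t : ℂ) - v‖ ≤ ‖(t : ℂ) - sh v ε‖ := by
    intro v ε hε t
    rw [← sq_le_sq₀ (norm_nonneg _) (norm_nonneg _), ← Complex.normSq_eq_norm_sq,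
      ← Complex.normSq_eq_norm_sq, Complex.normSq_apply, Complex.normSq_apply]
    simp only [Complex.sub_re, Complex.ofReal_re, hre, Complex.sub_im, Complex.ofReal_im, zero_sub,
      neg_mul_neg]
    have := sq_le_sq.2 (him v ε hε).1
    nlinarith
  have htend : ∀ v : ℂ, Filter.Tendsto (sh v) (nhdsWithin 0 (Ioi 0)) (nhds v) := by
    intro v
    have : Continuous (sh v) := by simp only [hsh]; fun_prop
    have h2 := this.tendsto 0
    simp only [hsh, Complex.ofReal_zero, zero_mul, add_zero] at h2
    exact h2.mono_left nhdsWithin_le_nhds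
  have hpos : ∀ᶠ ε : ℝ in nhdsWithin 0 (Ioi 0), 0 < ε := self_mem_nhdsWithin
  have hlim1 : Filter.Tendsto (fun ε : ℝ => ∫ t : ℝ, P t * (((t : ℂ) - sh z ε) * (t - sh w ε))⁻¹)
      (nhdsWithin 0 (Ioi 0)) (nhds (∫ t : ℝ, P t * (((t : ℂ) - z) * (t - w))⁻¹)) := by
    have hae : ∀ᵐ t : ℝ, (t : ℂ) ≠ z ∧ (t : ℂ) ≠ w := by
      have h1 : ∀ v : ℂ, ∀ᵐ t : ℝ, (t : ℂ) ≠ v := fun v => by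
        have : ∀ᵐ t : ℝ, t ≠ v.re := by simp [ae_iff]
        filter_upwards [this] with t ht h
        exact ht (by rw [← h]; simp)
      exact (h1 z).and (h1 w)
    have hPm : AEStronglyMeasurable P volume := by
      have : P =ᵐ[volume] fun t : ℝ => (P t * (((t : ℂ) - z) * (t - w))⁻¹) *
          (((t : ℂ) - z) * (t - w)) := by
        filter_upwards [hae] with t ht
        have h1 := sub_ne_zero.2 ht.1
        have h2 := sub_ne_zero.2 ht.2
        field_simp
      exact (hi.1.mul (by fun_prop)).congr this.symm
    refine tendsto_integral_filter_of_dominated_convergence _ ?_ ?_ hi.norm ?_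
    · exact Filter.Eventually.of_forall fun ε => hPm.mul (by fun_prop)
    · filter_upwards [hpos] with ε hε
      filter_upwards [hae] with t ht
      rw [norm_mul, norm_mul, norm_inv, norm_inv, norm_mul, norm_mul]
      have h1 := norm_pos_iff.2 (sub_ne_zero.2 ht.1)
      have h2 := norm_pos_iff.2 (sub_ne_zero.2 ht.2)
      gcongr
      · exact hle z ε hε t
      · exact hle w ε hε t
    · filter_upwards [hae] with t ht
      have h1 := sub_ne_zero.2 ht.1
      have h2 := sub_ne_zero.2 ht.2
      refine Filter.Tendsto.const_mul _ (Filter.Tendsto.inv₀ ?_ (mul_ne_zero h1 h2))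
      exact ((htend z).const_sub _).mul ((htend w).const_sub _)
  have hlim2 : Filter.Tendsto (fun ε : ℝ => 4 * Real.pi / ‖sh z ε - sh w ε‖ * ∫ x, ‖h x‖ ∂μ)
      (nhdsWithin 0 (Ioi 0)) (nhds (4 * Real.pi / ‖z - w‖ * ∫ x, ‖h x‖ ∂μ)) := by
    refine Filter.Tendsto.mul_const _ (Filter.Tendsto.div tendsto_const_nhds ?_
      (norm_ne_zero_iff.2 (sub_ne_zero.2 hzw)))
    exact ((htend z).sub (htend w)).norm
  have hne : ∀ᶠ ε : ℝ in nhdsWithin 0 (Ioi 0), sh z ε ≠ sh w ε := by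
    have h1 := ((htend z).sub (htend w)).eventually_ne (sub_ne_zero.2 hzw)
    filter_upwards [h1] with ε hε using sub_ne_zero.1 hε
  refine le_of_tendsto_of_tendsto hlim1.norm hlim2 ?_
  filter_upwards [hpos, hne] with ε hε hn
  simp_rw [hP]
  exact norm_integral_char_mul_inv_le_of_im_ne hh hθ (him z ε hε).2 (him w ε hε).2 hn

end Resolvent
-- Fourier transform in the variables orthogonal to a direction
section PartialFourier

variable {V : Type*} [NormedAddCommGroup V] [InnerProductSpace ℝ V] [FiniteDimensional ℝ V]
  [MeasurableSpace V] [BorelSpace V]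

omit [FiniteDimensional ℝ V] [MeasurableSpace V] [BorelSpace V] in
lemma hasTemperateGrowth_lineMap (e : V) (s : ℝ) :
    Function.HasTemperateGrowth fun y : ((ℝ ∙ e)ᗮ : Submodule ℝ V) => lineMap e (s, y) := by
  have h := ((ℝ ∙ e)ᗮ : Submodule ℝ V).subtypeL.hasTemperateGrowth
  exact (Function.HasTemperateGrowth.const (s • e)).add h

omit [FiniteDimensional ℝ V] [MeasurableSpace V] [BorelSpace V] in
lemma isometry_lineMap (e : V) (s : ℝ) :
    Isometry fun y : ((ℝ ∙ e)ᗮ : Submodule ℝ V) => lineMap e (s, y) := by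
  refine Isometry.of_dist_eq fun x y => ?_
  simp only [lineMap, dist_add_left]
  rfl

/-- The restriction of a Schwartz function to the hyperplane `s e + e^⟂`. -/
def slice (e : V) (f : 𝓢(V, ℂ)) (s : ℝ) : 𝓢(((ℝ ∙ e)ᗮ : Submodule ℝ V), ℂ) :=
  SchwartzMap.compCLMOfAntilipschitz ℂ (hasTemperateGrowth_lineMap e s)
    (isometry_lineMap e s).antilipschitz f

omit [FiniteDimensional ℝ V] [MeasurableSpace V] [BorelSpace V] in
lemma slice_apply (e : V) (f : 𝓢(V, ℂ)) (s : ℝ) (y : ((ℝ ∙ e)ᗮ : Submodule ℝ V)) :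
    slice e f s y = f (lineMap e (s, y)) := rfl

/-- The Fourier transform in the variables orthogonal to `e`. -/
def partialFourier (e : V) (f : 𝓢(V, ℂ)) (p : ℝ × ((ℝ ∙ e)ᗮ : Submodule ℝ V)) : ℂ :=
  𝓕 (slice e f p.1) p.2

lemma stronglyMeasurable_partialFourier (e : V) (f : 𝓢(V, ℂ)) :
    StronglyMeasurable (partialFourier e f) := by
  have e1 : partialFourier e f = fun p : ℝ × ((ℝ ∙ e)ᗮ : Submodule ℝ V) =>
      ∫ x : ((ℝ ∙ e)ᗮ : Submodule ℝ V),
        (fun q : (ℝ × ((ℝ ∙ e)ᗮ : Submodule ℝ V)) × ((ℝ ∙ e)ᗮ : Submodule ℝ V) =>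
          Real.fourierChar (-inner ℝ q.2 q.1.2) • f (lineMap e (q.1.1, q.2))) (p, x) := by
    funext p
    rw [partialFourier, SchwartzMap.fourier_coe, Real.fourier_eq]
    rfl
  rw [e1]
  have hc : StronglyMeasurable
      fun q : (ℝ × ((ℝ ∙ e)ᗮ : Submodule ℝ V)) × ((ℝ ∙ e)ᗮ : Submodule ℝ V) =>
        Real.fourierChar (-inner ℝ q.2 q.1.2) • f (lineMap e (q.1.1, q.2)) := by
    refine Continuous.stronglyMeasurable ?_
    have h1 := continuous_lineMap e
    have h2 := f.continuous
    fun_prop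
  exact hc.integral_prod_right'

lemma integrable_comp_lineMap {e : V} (he : ‖e‖ = 1) {f : V → ℂ} (hf : Integrable f) :
    Integrable (fun p => f (lineMap e p)) (volume.prod volume) :=
  (measurePreserving_lineMap he).integrable_comp_of_integrable hf

lemma integral_lineMap {e : V} (he : ‖e‖ = 1) {f : V → ℂ} (hf : Integrable f) :
    ∫ x, f x = ∫ p, f (lineMap e p) ∂(volume.prod volume) := by
  have h := measurePreserving_lineMap he
  rw [← h.map_eq, integral_map h.measurable.aemeasurable]
  rw [h.map_eq]
  exact hf.1

omit [FiniteDimensional ℝ V] [MeasurableSpace V] [BorelSpace V] in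
lemma inner_lineMap {e : V} (he : ‖e‖ = 1) (s t : ℝ) (x y : ((ℝ ∙ e)ᗮ : Submodule ℝ V)) :
    inner ℝ (lineMap e (s, x)) (lineMap e (t, y)) = s * t + inner ℝ x y := by
  have h1 := inner_orthogonal_right x
  have h2 := inner_orthogonal_right y
  have h3 := real_inner_self_eq_norm_sq e
  rw [real_inner_comm] at h1
  rw [he] at h3
  simp only [lineMap, inner_add_left, inner_add_right, real_inner_smul_left, real_inner_smul_right,
    h1, h2, h3, Submodule.coe_inner]
  ring

/-- Fubini: on a line the full transform is a superposition of characters with density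
`partialFourier e f (·, y)`, which is the form required by the one-dimensional estimate. -/
lemma fourier_lineMap {e : V} (he : ‖e‖ = 1) (f : 𝓢(V, ℂ)) (t : ℝ)
    (y : ((ℝ ∙ e)ᗮ : Submodule ℝ V)) :
    𝓕 f (lineMap e (t, y)) = ∫ s : ℝ, Real.fourierChar (-(t * s)) • partialFourier e f (s, y) := by
  have hi : Integrable fun v => Real.fourierChar (-inner ℝ v (lineMap e (t, y))) • f v :=
    (Real.fourierIntegral_convergent_iff _).2 f.integrable
  rw [SchwartzMap.fourier_coe, Real.fourier_eq, integral_lineMap he hi,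
    integral_prod _ (integrable_comp_lineMap he hi)]
  congr 1
  funext s
  rw [partialFourier, SchwartzMap.fourier_coe, Real.fourier_eq, Circle.smul_def,
    smul_eq_mul, ← integral_const_mul]
  congr 1
  funext x
  simp only [inner_lineMap he, slice_apply, Circle.smul_def, smul_eq_mul, ← mul_assoc,
    ← Circle.coe_mul, ← AddChar.map_add_eq_mul]
  congr 4
  ring

lemma lintegral_enorm_sq_fourier (f : 𝓢(V, ℂ)) :
    ∫⁻ y, ‖𝓕 f y‖ₑ ^ 2 = ∫⁻ y, ‖f y‖ₑ ^ 2 := by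
  have key : ∀ φ : 𝓢(V, ℂ), ∫⁻ y, ‖φ y‖ₑ ^ 2 = ENNReal.ofReal (∫ y, ‖φ y‖ ^ 2) := by
    intro φ
    have hi : Integrable (fun y => ‖φ y‖ ^ 2) volume := (φ.memLp 2).integrable_norm_pow (by norm_num)
    rw [ofReal_integral_eq_lintegral_ofReal hi (ae_of_all _ fun _ => by positivity)]
    congr 1
    funext y
    rw [ENNReal.ofReal_pow (norm_nonneg _), ofReal_norm]
  rw [key, key, SchwartzMap.integral_norm_sq_fourier]

lemma lintegral_partialFourier (e : V) (f : 𝓢(V, ℂ)) (s : ℝ) :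
    ∫⁻ y, ‖partialFourier e f (s, y)‖ₑ ^ 2 =
      ∫⁻ y : ((ℝ ∙ e)ᗮ : Submodule ℝ V), ‖f (lineMap e (s, y))‖ₑ ^ 2 :=
  lintegral_enorm_sq_fourier (slice e f s)

end PartialFourier

/-! ### Mixed norms and the bilinear estimate on lines -/

section MixedNorm

variable {d : ℕ}

/-- `∫ (1 + s²)^{-η} ds`. -/
def bracketMass (η : ℝ) : ℝ≥0∞ := ∫⁻ s : ℝ, ENNReal.ofReal ((1 + s ^ 2) ^ (-η))

lemma bracketMass_lt_top {η : ℝ} (hη : 1 / 2 < η) : bracketMass η < ⊤ := by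
  have h := integrable_rpow_neg_one_add_norm_sq (E := ℝ) (μ := volume) (r := 2 * η) (by simp; linarith)
  have h2 := h.2
  rw [hasFiniteIntegral_iff_ofReal (ae_of_all _ fun _ => by positivity)] at h2
  have e : -(2 * η) / 2 = -η := by ring
  simpa [bracketMass, e] using h2

/-- The mixed norm in `e`: `L¹` along `e`. -/
def lineMass (e : Space d) (f : 𝓢(Space d, ℂ)) (y : ((ℝ ∙ e)ᗮ : Submodule ℝ (Space d))) : ℝ≥0∞ :=
  ∫⁻ s : ℝ, ‖partialFourier e f (s, y)‖ₑ

lemma measurable_lineMass (e : Space d) (f : 𝓢(Space d, ℂ)) : Measurable (lineMass e f) :=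
  Measurable.lintegral_prod_left' (stronglyMeasurable_partialFourier e f).measurable.enorm

/-- The norm of `L²(⟨x⟩^η)`. -/
def weightedNorm (η : ℝ) (f : 𝓢(Space d, ℂ)) : ℝ≥0∞ :=
  eLpNorm (fun x => (bracket η x : ℂ) * f x) 2 volume

lemma hasTemperateGrowth_bracket (η : ℝ) :
    Function.HasTemperateGrowth fun x : Space d => (bracket η x : ℂ) := by
  have h := Function.hasTemperateGrowth_one_add_norm_sq_rpow (Space d) (η / 2)
  exact Function.Complex.hasTemperateGrowth_ofReal.comp h

/-- Multiplication by `⟨x⟩^η`. -/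
def weight (η : ℝ) : 𝓢(Space d, ℂ) →L[ℂ] 𝓢(Space d, ℂ) :=
  SchwartzMap.smulLeftCLM ℂ fun x => (bracket η x : ℂ)

lemma weight_apply (η : ℝ) (f : 𝓢(Space d, ℂ)) (x : Space d) :
    weight η f x = (bracket η x : ℂ) * f x :=
  SchwartzMap.smulLeftCLM_apply_apply (hasTemperateGrowth_bracket η) f x

lemma weightedNorm_eq (η : ℝ) (f : 𝓢(Space d, ℂ)) :
    weightedNorm η f = eLpNorm (weight η f) 2 volume := by
  rw [weightedNorm]
  congr 1
  funext x
  exact (weight_apply η f x).symm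

lemma weightedNorm_lt_top (η : ℝ) (f : 𝓢(Space d, ℂ)) : weightedNorm η f < ⊤ := by
  have h : ∀ g : 𝓢(Space d, ℂ), eLpNorm g 2 volume < ⊤ := fun g => g.eLpNorm_lt_top 2 volume
  rw [weightedNorm_eq]
  exact h _

lemma le_of_sq_le_sq_ennreal {a b : ℝ≥0∞} (h : a ^ 2 ≤ b ^ 2) : a ≤ b := by
  rw [← ENNReal.rpow_ofNat, ← ENNReal.rpow_ofNat] at h
  exact (ENNReal.rpow_le_rpow_iff (by norm_num)).1 h

lemma sq_eLpNorm_two {X : Type*} [MeasurableSpace X] {μ : Measure X} (F : X → ℂ) :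
    eLpNorm F 2 μ ^ 2 = ∫⁻ x, ‖F x‖ₑ ^ 2 ∂μ := by
  rw [eLpNorm_eq_lintegral_rpow_enorm_toReal (by norm_num) (by norm_num)]
  simp only [ENNReal.toReal_ofNat, ENNReal.rpow_ofNat]
  rw [← ENNReal.rpow_natCast, ← ENNReal.rpow_mul]
  norm_num

lemma sq_lintegral_mul_le {X : Type*} [MeasurableSpace X] {μ : Measure X} {f g : X → ℝ≥0∞}
    (hf : AEMeasurable f μ) (hg : AEMeasurable g μ) :
    (∫⁻ x, f x * g x ∂μ) ^ 2 ≤ (∫⁻ x, f x ^ 2 ∂μ) * ∫⁻ x, g x ^ 2 ∂μ := by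
  have h := ENNReal.lintegral_mul_le_Lp_mul_Lq μ Real.HolderConjugate.two_two hf hg
  have h2 := pow_le_pow_left' h 2
  refine h2.trans (le_of_eq ?_)
  simp only [ENNReal.rpow_ofNat, mul_pow]
  rw [← ENNReal.rpow_natCast, ← ENNReal.rpow_mul, ← ENNReal.rpow_natCast, ← ENNReal.rpow_mul]
  norm_num

lemma bracket_pos (η : ℝ) (x : Space d) : 0 < bracket η x := by
  unfold bracket; positivity

lemma bracket_sq (η : ℝ) (x : Space d) : bracket η x ^ 2 = (1 + ‖x‖ ^ 2) ^ η := by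
  rw [bracket, ← Real.rpow_natCast, ← Real.rpow_mul (by positivity)]
  norm_num

/-- Cauchy–Schwarz in `s` against `(1 + s²)^(-η/2)`, then Plancherel on each hyperplane `s e + e^⟂`,
where `1 + s² ≤ 1 + |x|²` restores the full weight. -/
lemma lintegral_sq_lineMass_le {e : Space d} (he : ‖e‖ = 1) (f : 𝓢(Space d, ℂ)) {η : ℝ}
    (hη : 0 ≤ η) :
    ∫⁻ y, lineMass e f y ^ 2 ≤ bracketMass η * weightedNorm η f ^ 2 := by
  have hm := (stronglyMeasurable_partialFourier e f).measurable.enorm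
  have h1 : ∀ y, lineMass e f y ^ 2 ≤ bracketMass η *
      ∫⁻ s : ℝ, ENNReal.ofReal ((1 + s ^ 2) ^ η) * ‖partialFourier e f (s, y)‖ₑ ^ 2 := by
    intro y
    have hmy : Measurable fun s : ℝ => ‖partialFourier e f (s, y)‖ₑ :=
      hm.comp (measurable_id.prodMk measurable_const)
    have h2 := sq_lintegral_mul_le (μ := (volume : Measure ℝ))
      (f := fun s => ENNReal.ofReal ((1 + s ^ 2) ^ (-(η / 2))))
      (g := fun s => ENNReal.ofReal ((1 + s ^ 2) ^ (η / 2)) * ‖partialFourier e f (s, y)‖ₑ)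
      (by fun_prop) (by fun_prop)
    refine le_trans (le_of_eq ?_) (h2.trans (le_of_eq ?_))
    · congr 1
      refine lintegral_congr fun s => ?_
      rw [← mul_assoc, ← ENNReal.ofReal_mul (by positivity), ← Real.rpow_add (by positivity)]
      simp
    · have hp : ∀ (s a : ℝ), ENNReal.ofReal ((1 + s ^ 2) ^ (a / 2)) ^ 2 =
          ENNReal.ofReal ((1 + s ^ 2) ^ a) := by
        intro s a
        rw [← ENNReal.ofReal_pow (by positivity), ← Real.rpow_natCast,
          ← Real.rpow_mul (by positivity)]
        norm_num
      simp only [mul_pow, bracketMass]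
      simp_rw [← neg_div, hp]
  refine (lintegral_mono h1).trans ?_
  have hm2 : Measurable fun p : ℝ × ((ℝ ∙ e)ᗮ : Submodule ℝ (Space d)) =>
      ENNReal.ofReal ((1 + p.1 ^ 2) ^ η) * ‖partialFourier e f p‖ₑ ^ 2 := by fun_prop
  rw [lintegral_const_mul _ (Measurable.lintegral_prod_left' hm2)]
  gcongr
  rw [weightedNorm, sq_eLpNorm_two, lintegral_lintegral_swap]
  swap
  · exact (hm2.comp measurable_swap).aemeasurable
  have hcont : Measurable fun x : Space d => ‖(bracket η x : ℂ) * f x‖ₑ ^ 2 := by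
    have := continuous_bracket (d := d) η
    have := f.continuous
    refine Continuous.measurable ?_
    fun_prop
  have hcont' : AEMeasurable (fun p => ‖(bracket η (lineMap e p) : ℂ) * f (lineMap e p)‖ₑ ^ 2)
      ((volume : Measure ℝ).prod (volume : Measure ((ℝ ∙ e)ᗮ : Submodule ℝ (Space d)))) :=
    (hcont.comp (measurePreserving_lineMap he).measurable).aemeasurable
  rw [← (measurePreserving_lineMap he).lintegral_comp hcont, lintegral_prod _ hcont']
  refine lintegral_mono fun s => ?_
  simp only
  rw [lintegral_const_mul' _ _ ENNReal.ofReal_ne_top, lintegral_partialFourier,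
    ← lintegral_const_mul' _ _ ENNReal.ofReal_ne_top]
  refine lintegral_mono fun y => ?_
  rw [enorm_mul, mul_pow]
  gcongr
  rw [← ofReal_norm, ← ENNReal.ofReal_pow (norm_nonneg _)]
  refine ENNReal.ofReal_le_ofReal ?_
  rw [Complex.norm_real, Real.norm_of_nonneg (bracket_pos _ _).le, bracket_sq,
    norm_sq_lineMap he]
  refine Real.rpow_le_rpow (by positivity) ?_ hη
  nlinarith [sq_nonneg ‖y‖]

/-- On each line the product of the three transforms is one superposition of characters, of mass
`lineMass e f y * lineMass e g y * ‖q‖₁`, so roots at distance at least `δ` cost `4π / δ`.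
Cauchy–Schwarz in `y` then gives the weighted norms. The factor `q` allows a smooth cutoff in `t`,
and `b` any factor constant on the line. -/
lemma enorm_integral_le_of_lines {e : Space d} (he : ‖e‖ = 1) (f g : 𝓢(Space d, ℂ)) {η : ℝ}
    (hη : 1 / 2 < η) {ν : Measure ℝ} [SFinite ν] {q : ℝ → ℂ} (hq : Integrable q ν) {δ : ℝ}
    (hδ : 0 < δ) (a : ℝ) {G : Space d → ℂ} (hG : Integrable G)
    (hline : ∀ y, ∃ b z w : ℂ, ‖b‖ ≤ 1 ∧ δ ≤ ‖z - w‖ ∧ ∀ t : ℝ, G (lineMap e (t, y)) =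
      b * (𝓕 f (lineMap e (t, y)) * 𝓕 g (lineMap e (t, y)) *
        (∫ c, Real.fourierChar (-(t * (a * c))) • q c ∂ν) * (((t : ℂ) - z) * (t - w))⁻¹)) :
    ‖∫ x, G x‖ₑ ≤ ENNReal.ofReal (4 * Real.pi / δ * ∫ c, ‖q c‖ ∂ν) * bracketMass η *
      (weightedNorm η f * weightedNorm η g) := by
  have hLf := lintegral_sq_lineMass_le he f (by linarith : (0 : ℝ) ≤ η)
  have hLg := lintegral_sq_lineMass_le he g (by linarith : (0 : ℝ) ≤ η)
  have hW : ∀ f : 𝓢(Space d, ℂ), bracketMass η * weightedNorm η f ^ 2 < ⊤ := by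
    intro f
    exact ENNReal.mul_lt_top (bracketMass_lt_top hη) (ENNReal.pow_lt_top (weightedNorm_lt_top η f))
  have hfin : ∀ f : 𝓢(Space d, ℂ), ∀ᵐ y, lineMass e f y < ⊤ := by
    intro f
    have h1 := (lintegral_sq_lineMass_le he f (by linarith : (0 : ℝ) ≤ η)).trans_lt (hW f)
    have h2 := ae_lt_top ((measurable_lineMass e f).pow_const 2) h1.ne
    filter_upwards [h2] with y hy
    by_contra h
    rw [not_lt, top_le_iff] at h
    simp [h] at hy
  set Λ : ℝ≥0∞ := ENNReal.ofReal (4 * Real.pi / δ * ∫ c, ‖q c‖ ∂ν) with hΛ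
  have hprod := integrable_comp_lineMap he hG
  have hinner : ∀ᵐ y, ‖∫ t : ℝ, G (lineMap e (t, y))‖ₑ ≤ Λ * (lineMass e f y * lineMass e g y) := by
    filter_upwards [hfin f, hfin g, hprod.prod_left_ae] with y hfy hgy hGy
    have hmeas : ∀ f : 𝓢(Space d, ℂ), AEStronglyMeasurable (fun s : ℝ => partialFourier e f (s, y))
        volume := fun f =>
      ((stronglyMeasurable_partialFourier e f).comp_measurable
        (measurable_id.prodMk measurable_const)).aestronglyMeasurable
    have hif : Integrable fun s : ℝ => partialFourier e f (s, y) := ⟨hmeas f, hfy⟩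
    have hig : Integrable fun s : ℝ => partialFourier e g (s, y) := ⟨hmeas g, hgy⟩
    obtain ⟨b, z, w, hb, hzw, hGl⟩ := hline y
    simp_rw [hGl]
    rw [integral_const_mul, enorm_mul]
    have hb' : ‖b‖ₑ ≤ 1 := by
      rw [← ofReal_norm, ← ENNReal.ofReal_one]; exact ENNReal.ofReal_le_ofReal hb
    rcases eq_or_ne b 0 with rfl | hb0
    · simp
    refine (mul_le_of_le_one_left' hb').trans ?_
    set h : ℝ × ℝ × ℝ → ℂ := fun p => partialFourier e f (p.1, y) *
      (partialFourier e g (p.2.1, y) * q p.2.2) with hh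
    have hint : Integrable h (volume.prod (volume.prod ν)) := hif.mul_prod (hig.mul_prod hq)
    -- The phases of the three characters add up to `s + s' + a c`.
    have hbound := norm_integral_char_mul_inv_le hint (θ := fun p => p.1 + (p.2.1 + a * p.2.2))
      (by fun_prop) (z := z) (w := w) (by
        rintro rfl; simp at hzw; linarith)
      (P := fun t => 𝓕 f (lineMap e (t, y)) * 𝓕 g (lineMap e (t, y)) *
        (∫ c, Real.fourierChar (-(t * (a * c))) • q c ∂ν)) (fun t => by
        rw [fourier_lineMap he, fourier_lineMap he, mul_assoc, ← integral_prod_mul,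
          ← integral_prod_mul]
        congr 1
        funext p
        simp only [hh, mul_add, neg_add, AddChar.map_add_eq_mul, Circle.smul_def, Circle.coe_mul,
          smul_eq_mul]
        ring)
      (by
        have h1 := hGy.const_mul b⁻¹
        refine h1.congr (ae_of_all _ fun t => ?_)
        simp only
        rw [hGl, ← mul_assoc, inv_mul_cancel₀ hb0, one_mul])
    have hnorm : ∫ p, ‖h p‖ ∂(volume.prod (volume.prod ν)) = (∫ s, ‖partialFourier e f (s, y)‖) *
        ((∫ s, ‖partialFourier e g (s, y)‖) * ∫ c, ‖q c‖ ∂ν) := by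
      rw [← integral_prod_mul, ← integral_prod_mul]
      simp only [hh, norm_mul]
    rw [hnorm] at hbound
    rw [← ofReal_norm]
    refine (ENNReal.ofReal_le_ofReal hbound).trans ?_
    have hq0 : 0 ≤ ∫ c, ‖q c‖ ∂ν := integral_nonneg fun _ => norm_nonneg _
    have e1 : lineMass e f y = ENNReal.ofReal (∫ s, ‖partialFourier e f (s, y)‖) :=
      (ofReal_integral_norm_eq_lintegral_enorm hif).symm
    have e2 : lineMass e g y = ENNReal.ofReal (∫ s, ‖partialFourier e g (s, y)‖) :=
      (ofReal_integral_norm_eq_lintegral_enorm hig).symm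
    rw [e1, e2, hΛ, ← ENNReal.ofReal_mul (by positivity), ← ENNReal.ofReal_mul (by positivity)]
    refine ENNReal.ofReal_le_ofReal ?_
    have h3 : 4 * Real.pi / ‖z - w‖ ≤ 4 * Real.pi / δ := by gcongr
    calc _ ≤ 4 * Real.pi / δ * ((∫ s, ‖partialFourier e f (s, y)‖) *
        ((∫ s, ‖partialFourier e g (s, y)‖) * ∫ c, ‖q c‖ ∂ν)) := by gcongr
      _ = _ := by ring
  rw [integral_lineMap he hG, integral_prod_symm _ hprod]
  refine (enorm_integral_le_lintegral_enorm _).trans ((lintegral_mono_ae hinner).trans ?_)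
  have hmf := measurable_lineMass e f
  have hmg := measurable_lineMass e g
  rw [hΛ, lintegral_const_mul' _ _ ENNReal.ofReal_ne_top, mul_assoc]
  gcongr
  have hcs := sq_lintegral_mul_le (μ := volume) hmf.aemeasurable hmg.aemeasurable
  refine le_of_sq_le_sq_ennreal ?_
  refine hcs.trans ((mul_le_mul' hLf hLg).trans (le_of_eq ?_))
  ring

end MixedNorm
-- The uniform estimate for the resolvent form
section Resolvent

variable {d : ℕ} (k : ℝ) (γ : Space d) (τ : ℝ)

/-- `1 / m(2πξ)`, the symbol of the operator in the normalisation of Mathlib. -/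
def invSymb (ξ : Space d) : ℂ := (symb k γ τ ((2 * Real.pi) • ξ))⁻¹

lemma radius_pos {k : ℝ} (hk : 0 < k) (γ : Space d) : 0 < radius k γ :=
  Real.sqrt_pos.2 (by positivity)

lemma integrable_mul_invSymb (hd : 2 ≤ d) (hk : 0 < k) (hτ : τ ≠ 0) {h : Space d → ℂ}
    (hi : Integrable h) {B : ℝ} (hB : ∀ ξ, ‖h ξ‖ ≤ B) :
    Integrable fun ξ => h ξ * invSymb k γ τ ξ := by
  have h1 := integrable_mul_inv_symb k γ τ hd hk hτ
    (hi.comp_smul (inv_ne_zero (by positivity : (2 * Real.pi : ℝ) ≠ 0)))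
    (fun ξ => hB _)
  have h2 := h1.comp_smul (by positivity : (2 * Real.pi : ℝ) ≠ 0)
  refine h2.congr (ae_of_all _ fun ξ => ?_)
  simp only [invSymb, smul_smul]
  rw [inv_mul_cancel₀ (by positivity), one_smul]

/-- Completing the square in `t`; the linear term `4πi t (γ·e)` accounts for the imaginary shift. -/
lemma symb_lineMap {e : Space d} (he : ‖e‖ = 1) (t : ℝ)
    (y : ((ℝ ∙ e)ᗮ : Submodule ℝ (Space d))) :
    symb k γ τ ((2 * Real.pi) • lineMap e (t, y)) =
      (2 * Real.pi * t + Complex.I * (inner ℝ γ e : ℝ)) ^ 2 -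
        (-(inner ℝ γ e : ℝ) ^ 2 - symb k γ τ ((2 * Real.pi) • (y : Space d))) := by
  have h1 := norm_sq_lineMap he t y
  have h2 : inner ℝ γ (lineMap e (t, y)) = t * inner ℝ γ e + inner ℝ γ (y : Space d) := by
    rw [lineMap, inner_add_right, inner_smul_right]
  simp only [symb, norm_smul, mul_pow, h1, inner_smul_right, h2, Submodule.coe_norm]
  rw [Real.norm_of_nonneg (by positivity)]
  push_cast
  linear_combination (-(inner ℝ γ e : ℂ) ^ 2) * Complex.I_sq

lemma eLpNorm_le_weightedNorm {η : ℝ} (hη : 0 ≤ η) (f : 𝓢(Space d, ℂ)) :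
    eLpNorm f 2 volume ≤ weightedNorm η f := by
  refine eLpNorm_mono fun x => ?_
  rw [norm_mul, Complex.norm_real, Real.norm_of_nonneg (bracket_pos _ _).le]
  refine le_mul_of_one_le_left (norm_nonneg _) ?_
  exact Real.one_le_rpow (by nlinarith [sq_nonneg ‖x‖]) (by linarith)

lemma eLpNorm_fourier (f : 𝓢(Space d, ℂ)) :
    eLpNorm (fun ξ => 𝓕 f ξ) 2 volume = eLpNorm f 2 volume := by
  apply le_antisymm <;> apply le_of_sq_le_sq_ennreal <;>
    rw [sq_eLpNorm_two, sq_eLpNorm_two, lintegral_enorm_sq_fourier]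

lemma exists_bound_schwartz (f : 𝓢(Space d, ℂ)) : ∃ B : ℝ, 0 ≤ B ∧ ∀ ξ, ‖f ξ‖ ≤ B :=
  ⟨SchwartzMap.seminorm ℝ 0 0 f, apply_nonneg _ _, fun ξ => f.norm_le_seminorm ℝ ξ⟩

lemma integrable_fourier_mul (f g : 𝓢(Space d, ℂ)) : Integrable fun ξ => 𝓕 f ξ * 𝓕 g ξ := by
  obtain ⟨B, -, hB⟩ := exists_bound_schwartz (𝓕 f)
  exact (𝓕 g).integrable.bdd_mul (c := B) (𝓕 f).continuous.aestronglyMeasurable (ae_of_all _ hB)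

lemma exists_bound_fourier_mul (f g : 𝓢(Space d, ℂ)) : ∃ B : ℝ, ∀ ξ, ‖𝓕 f ξ * 𝓕 g ξ‖ ≤ B := by
  obtain ⟨B, hB, h⟩ := exists_bound_schwartz (𝓕 f)
  obtain ⟨B', -, h'⟩ := exists_bound_schwartz (𝓕 g)
  refine ⟨B * B', fun ξ => ?_⟩
  rw [norm_mul]
  exact mul_le_mul (h ξ) (h' ξ) (norm_nonneg _) hB

lemma enorm_integral_le_of_elliptic (f g : 𝓢(Space d, ℂ)) {a : Space d → ℂ} {B : ℝ}
    (ha : ∀ ξ, ‖a ξ‖ ≤ B) :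
    ‖∫ ξ, 𝓕 f ξ * 𝓕 g ξ * a ξ‖ₑ ≤ ENNReal.ofReal B * (eLpNorm f 2 volume * eLpNorm g 2 volume) := by
  refine (enorm_integral_le_lintegral_enorm _).trans ?_
  have h1 : ∀ ξ, ‖𝓕 f ξ * 𝓕 g ξ * a ξ‖ₑ ≤ ENNReal.ofReal B * (‖𝓕 f ξ‖ₑ * ‖𝓕 g ξ‖ₑ) := by
    intro ξ
    rw [enorm_mul, enorm_mul, mul_comm]
    gcongr
    rw [← ofReal_norm]
    exact ENNReal.ofReal_le_ofReal (ha ξ)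
  refine (lintegral_mono h1).trans ?_
  rw [lintegral_const_mul' _ _ ENNReal.ofReal_ne_top]
  gcongr
  have hcs := sq_lintegral_mul_le (μ := volume) (𝓕 f).continuous.measurable.enorm.aemeasurable
    (𝓕 g).continuous.measurable.enorm.aemeasurable
  rw [lintegral_enorm_sq_fourier, lintegral_enorm_sq_fourier, ← sq_eLpNorm_two, ← sq_eLpNorm_two,
    ← mul_pow] at hcs
  exact le_of_sq_le_sq_ennreal hcs

/-- Up to the factor `4π²`, the quarter of the discriminant of the quadratic polynomial
`t ↦ m(2π(te + y))`. -/
def disc (e ξ : Space d) : ℂ :=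
  (2 * Real.pi * (inner ℝ e ξ : ℝ) + Complex.I * (inner ℝ γ e : ℝ)) ^ 2 -
    symb k γ τ ((2 * Real.pi) • ξ)

lemma continuous_disc (e : Space d) : Continuous (disc k γ τ e) := by
  have := continuous_symb k γ τ
  unfold disc
  fun_prop

lemma inner_left_lineMap {e : Space d} (he : ‖e‖ = 1) (t : ℝ)
    (y : ((ℝ ∙ e)ᗮ : Submodule ℝ (Space d))) : inner ℝ e (lineMap e (t, y)) = t := by
  rw [lineMap, inner_add_right, inner_orthogonal_right, inner_smul_right,
    real_inner_self_eq_norm_sq, he]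
  simp

/-- Being constant along lines, the discriminant can be cut off sharply without affecting the
analysis in `t`. -/
lemma disc_lineMap {e : Space d} (he : ‖e‖ = 1) (t : ℝ)
    (y : ((ℝ ∙ e)ᗮ : Submodule ℝ (Space d))) :
    disc k γ τ e (lineMap e (t, y)) = disc k γ τ e y := by
  rw [disc, disc, symb_lineMap k γ τ he, inner_left_lineMap he, inner_orthogonal_right]
  push_cast
  linear_combination (-(inner ℝ γ e : ℂ) ^ 2) * Complex.I_sq

/-- With `v² = disc`, the roots are `(-i γ·e ± v) / 2π`. -/
lemma symb_lineMap_eq_mul {e : Space d} (he : ‖e‖ = 1)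
    (y : ((ℝ ∙ e)ᗮ : Submodule ℝ (Space d))) :
    ∃ z w : ℂ, ‖z - w‖ = √‖disc k γ τ e y‖ / Real.pi ∧ ∀ t : ℝ,
      symb k γ τ ((2 * Real.pi) • lineMap e (t, y)) = (4 * Real.pi ^ 2) * ((t - z) * (t - w)) := by
  obtain ⟨v, hv⟩ := IsAlgClosed.exists_pow_nat_eq (disc k γ τ e y) (n := 2) (by norm_num)
  have hpi : (Real.pi : ℂ) ≠ 0 := by exact_mod_cast Real.pi_ne_zero
  refine ⟨(-Complex.I * (inner ℝ γ e : ℝ) + v) / (2 * Real.pi),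
    (-Complex.I * (inner ℝ γ e : ℝ) - v) / (2 * Real.pi), ?_, fun t => ?_⟩
  · have e1 : (-Complex.I * (inner ℝ γ e : ℝ) + v) / (2 * Real.pi) -
        (-Complex.I * (inner ℝ γ e : ℝ) - v) / (2 * Real.pi) = v / Real.pi := by
      field_simp
      ring
    rw [e1, norm_div, Complex.norm_real, Real.norm_of_nonneg Real.pi_pos.le, ← hv, norm_pow,
      Real.sqrt_sq (norm_nonneg _)]
  · have h1 := disc_lineMap k γ τ he t y
    rw [disc, inner_left_lineMap he, ← hv] at h1
    have h2 : symb k γ τ ((2 * Real.pi) • lineMap e (t, y)) =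
        (2 * Real.pi * t + Complex.I * (inner ℝ γ e : ℝ)) ^ 2 - v ^ 2 := by
      linear_combination -h1
    rw [h2]
    field_simp
    ring

/-- Since `m + disc = (2π e·ξ + i γ·e)²` and a square `(a + i b)²` has modulus `a² + b² ≥ a²`, the
symbol is elliptic wherever `e·ξ` is large compared with the discriminant. -/
lemma norm_symb_ge (e ξ : Space d) :
    (2 * Real.pi * inner ℝ e ξ) ^ 2 - ‖disc k γ τ e ξ‖ ≤ ‖symb k γ τ ((2 * Real.pi) • ξ)‖ := by
  have e1 : symb k γ τ ((2 * Real.pi) • ξ) =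
      (2 * Real.pi * (inner ℝ e ξ : ℝ) + Complex.I * (inner ℝ γ e : ℝ)) ^ 2 -
        disc k γ τ e ξ := by rw [disc]; ring
  rw [e1]
  refine le_trans ?_ (norm_sub_norm_le _ _)
  gcongr
  rw [norm_pow, ← Complex.normSq_eq_norm_sq, Complex.normSq_apply]
  simp
  nlinarith [sq_nonneg (inner ℝ γ e : ℝ)]

lemma enorm_integral_le_of_disc_ge {e : Space d} (he : ‖e‖ = 1) (f g : 𝓢(Space d, ℂ)) {η : ℝ}
    (hη : 1 / 2 < η) {ν : Measure ℝ} [SFinite ν] {q : ℝ → ℂ} (hq : Integrable q ν) (a : ℝ)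
    {c : ℝ} (hc : 0 < c) {b : Space d → ℝ} (hb : ∀ ξ, |b ξ| ≤ 1)
    (hbline : ∀ t y, b (lineMap e (t, y)) = b y) {G : Space d → ℂ} (hGi : Integrable G)
    (hG : ∀ ξ, G ξ = 𝓕 f ξ * 𝓕 g ξ * invSymb k γ τ ξ * ((b ξ *
      {ξ | c ≤ ‖disc k γ τ e ξ‖}.indicator 1 ξ : ℝ) *
        ∫ x, Real.fourierChar (-(inner ℝ e ξ * (a * x))) • q x ∂ν)) :
    ‖∫ ξ, G ξ‖ₑ ≤ ENNReal.ofReal (4 * Real.pi ^ 2 / √c * ∫ x, ‖q x‖ ∂ν) * bracketMass η *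
      (weightedNorm η f * weightedNorm η g) := by
  have hδ : 0 < √c / Real.pi := div_pos (Real.sqrt_pos.2 hc) Real.pi_pos
  have h := enorm_integral_le_of_lines he f g hη hq hδ a hGi (fun y => ?_)
  · refine h.trans (le_of_eq ?_)
    congr 4
    field_simp
  by_cases hy : c ≤ ‖disc k γ τ e y‖
  · obtain ⟨z, w, hzw, hs⟩ := symb_lineMap_eq_mul k γ τ he y
    -- The constant `1 / 4π² ≤ 1` from the factorisation is absorbed into the factor that is
    -- constant on the line.
    refine ⟨b y * (4 * Real.pi ^ 2 : ℝ)⁻¹, z, w, ?_, ?_, fun t => ?_⟩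
    · rw [norm_mul, Complex.norm_real, Real.norm_eq_abs, Complex.norm_real,
        Real.norm_of_nonneg (by positivity)]
      refine mul_le_one₀ (hb _) (by positivity) (inv_le_one_of_one_le₀ ?_)
      nlinarith [Real.pi_gt_three]
    · rw [hzw]
      gcongr
    · rw [hG, hbline, indicator_of_mem (by simpa [disc_lineMap k γ τ he] using hy), invSymb, hs,
        inner_left_lineMap he, mul_inv]
      push_cast
      simp only [Pi.one_apply]
      push_cast
      ring
  · refine ⟨0, 0, (√c / Real.pi : ℝ), by simp, ?_, fun t => ?_⟩
    · rw [zero_sub, norm_neg, Complex.norm_real, Real.norm_of_nonneg hδ.le]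
    · rw [hG, indicator_of_notMem (by simpa [disc_lineMap k γ τ he] using hy)]
      simp


/-- Where `κ ≠ 1` the component `2π e·ξ` exceeds `√(2c) R`. If the discriminant is below `c R²`,
then `|m| ≥ c R²` and Plancherel suffices; otherwise the roots are at least `√c R / π` apart and the
bound on lines applies. -/
lemma enorm_integral_high_frequency_le (hd : 2 ≤ d) {k τ : ℝ} (hk : 0 < k) (hτ : τ ≠ 0)
    {e : Space d} (he : ‖e‖ = 1)
    (f g : 𝓢(Space d, ℂ)) {η : ℝ} (hη : 1 / 2 < η) {q : ℝ → ℂ} (hq : Integrable q) {κ : ℝ → ℝ}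
    (hκc : Continuous κ) (hκq : ∀ t, ∫ x, Real.fourierChar (-(x * t)) • q x = κ t)
    (hκ : ∀ t, κ t ∈ Icc (0 : ℝ) 1) {c : ℝ} (hc : 0 < c) (hκc1 : ∀ t, t ^ 2 ≤ 2 * c → κ t = 1)
    {b : Space d → ℝ} (hbc : Continuous b) (hb : ∀ ξ, |b ξ| ≤ 1)
    (hbline : ∀ t y, b (lineMap e (t, y)) = b y) :
    ‖∫ ξ, 𝓕 f ξ * 𝓕 g ξ * invSymb k γ τ ξ *
        (b ξ * (1 - κ (2 * Real.pi * inner ℝ e ξ / radius k γ)) : ℝ)‖ₑ ≤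
      (ENNReal.ofReal (1 / (c * radius k γ ^ 2)) +
        ENNReal.ofReal (4 * Real.pi ^ 2 / (√c * radius k γ) * (1 + ∫ x, ‖q x‖)) * bracketMass η) *
      (weightedNorm η f * weightedNorm η g) := by
  set R := radius k γ with hR
  have hRpos : 0 < R := radius_pos hk γ
  set S := {ξ : Space d | c * R ^ 2 ≤ ‖disc k γ τ e ξ‖} with hS
  have hSm : MeasurableSet S :=
    (isClosed_le continuous_const (continuous_disc k γ τ e).norm).measurableSet
  set u : Space d → ℝ := fun ξ => κ (2 * Real.pi * inner ℝ e ξ / R) with hu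
  have huc : Continuous u := by fun_prop
  have hu1 : ∀ ξ, |u ξ| ≤ 1 := fun ξ => abs_le.2 ⟨by linarith [(hκ (2 * Real.pi * inner ℝ e ξ / R)).1], (hκ _).2⟩
  have hu2 : ∀ ξ, |1 - u ξ| ≤ 1 := fun ξ => abs_le.2
    ⟨by linarith [(hκ (2 * Real.pi * inner ℝ e ξ / R)).2], by linarith [(hκ (2 * Real.pi * inner ℝ e ξ / R)).1]⟩
  have hfg : Integrable fun ξ => 𝓕 f ξ * 𝓕 g ξ := integrable_fourier_mul f g
  obtain ⟨B, hB⟩ := exists_bound_fourier_mul f g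
  have hint : ∀ w : Space d → ℝ, Measurable w → (∀ ξ, |w ξ| ≤ 1) →
      Integrable fun ξ => 𝓕 f ξ * 𝓕 g ξ * invSymb k γ τ ξ * (w ξ : ℂ) := by
    intro w hw hw1
    have h := (integrable_mul_invSymb k γ τ hd hk hτ hfg hB)
    refine (h.bdd_mul (c := 1) (f := fun ξ => (w ξ : ℂ))
      (Complex.measurable_ofReal.comp hw).aestronglyMeasurable
      (ae_of_all _ fun ξ => ?_)).congr (ae_of_all _ fun ξ => ?_)
    · simpa using hw1 ξ
    · simp only
      ring
  have hind : ∀ ξ, |S.indicator (1 : Space d → ℝ) ξ| ≤ 1 := fun ξ => by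
    by_cases h : ξ ∈ S <;> simp [h]
  have hindm : Measurable (S.indicator (1 : Space d → ℝ)) := measurable_one.indicator hSm
  have hmul : ∀ x y : ℝ, |x| ≤ 1 → |y| ≤ 1 → |x * y| ≤ 1 := fun x y hx hy => by
    rw [abs_mul]
    exact mul_le_one₀ hx (abs_nonneg _) hy
  have hcind : ∀ ξ, |1 - S.indicator (1 : Space d → ℝ) ξ| ≤ 1 := fun ξ => by
    by_cases h : ξ ∈ S <;> simp [h]
  have i1 := hint (fun ξ => b ξ * (1 - u ξ) * (1 - S.indicator 1 ξ))
    ((hbc.measurable.mul (measurable_const.sub huc.measurable)).mul (measurable_const.sub hindm))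
    (fun ξ => hmul _ _ (hmul _ _ (hb ξ) (hu2 ξ)) (hcind ξ))
  have i2 := hint (fun ξ => b ξ * S.indicator 1 ξ) (hbc.measurable.mul hindm)
    (fun ξ => hmul _ _ (hb ξ) (hind ξ))
  have i3 := hint (fun ξ => b ξ * S.indicator 1 ξ * u ξ)
    ((hbc.measurable.mul hindm).mul huc.measurable)
    (fun ξ => hmul _ _ (hmul _ _ (hb ξ) (hind ξ)) (hu1 ξ))
  -- On the large-discriminant set `1 - κ` is separated into `1` and `κ`, because each of them is a
  -- superposition of characters in `t`.
  have hsplit : (∫ ξ, 𝓕 f ξ * 𝓕 g ξ * invSymb k γ τ ξ * (b ξ * (1 - u ξ) : ℝ)) =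
      (∫ ξ, 𝓕 f ξ * 𝓕 g ξ * invSymb k γ τ ξ * (b ξ * (1 - u ξ) * (1 - S.indicator 1 ξ) : ℝ)) +
      ((∫ ξ, 𝓕 f ξ * 𝓕 g ξ * invSymb k γ τ ξ * (b ξ * S.indicator 1 ξ : ℝ)) -
      ∫ ξ, 𝓕 f ξ * 𝓕 g ξ * invSymb k γ τ ξ * (b ξ * S.indicator 1 ξ * u ξ : ℝ)) := by
    rw [← integral_sub i2 i3]
    refine Eq.trans ?_ (integral_add i1 (i2.sub i3))
    refine integral_congr_ae (ae_of_all _ fun ξ => ?_)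
    push_cast
    ring
  rw [hsplit]
  have hη0 : 0 ≤ η := by linarith
  have b1 : ‖∫ ξ, 𝓕 f ξ * 𝓕 g ξ * invSymb k γ τ ξ *
      (b ξ * (1 - u ξ) * (1 - S.indicator 1 ξ) : ℝ)‖ₑ ≤
      ENNReal.ofReal (1 / (c * R ^ 2)) * (weightedNorm η f * weightedNorm η g) := by
    simp only [mul_assoc (𝓕 f _ * 𝓕 g _)]
    refine (enorm_integral_le_of_elliptic f g (B := 1 / (c * R ^ 2)) fun ξ => ?_).trans ?_
    · by_cases hξ : ξ ∈ S
      · simp only [indicator_of_mem hξ, Pi.one_apply, sub_self, mul_zero, Complex.ofReal_zero,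
          norm_zero]
        positivity
      by_cases hv : (2 * Real.pi * inner ℝ e ξ / R) ^ 2 ≤ 2 * c
      · simp only [hu, hκc1 _ hv, sub_self, mul_zero, zero_mul, Complex.ofReal_zero, norm_zero]
        positivity
      have h3 := norm_symb_ge k γ τ e ξ
      have h4 : ‖disc k γ τ e ξ‖ < c * R ^ 2 := not_le.1 hξ
      rw [not_le, div_pow, lt_div_iff₀ (by positivity)] at hv
      rw [norm_mul, invSymb, norm_inv, Complex.norm_real, Real.norm_eq_abs]
      calc _ ≤ ‖symb k γ τ ((2 * Real.pi) • ξ)‖⁻¹ * 1 := by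
            gcongr
            exact hmul _ _ (hmul _ _ (hb ξ) (hu2 ξ)) (hcind ξ)
        _ ≤ _ := by
            rw [mul_one, one_div]
            gcongr
            linarith
    · gcongr <;> exact eLpNorm_le_weightedNorm hη0 _
  have hsq : √(c * R ^ 2) = √c * R := by
    rw [Real.sqrt_mul hc.le, Real.sqrt_sq hRpos.le]
  -- The constant `1` is the transform of a unit mass at the origin.
  have b2 := enorm_integral_le_of_disc_ge k γ τ he f g hη (ν := Measure.dirac (0 : ℝ))
    (q := fun _ => 1) (integrable_const _) 0 (c := c * R ^ 2) (by positivity) hb hbline i2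
    (fun ξ => by simp [hS])
  have b3 := enorm_integral_le_of_disc_ge k γ τ he f g hη hq (2 * Real.pi / R) (c := c * R ^ 2)
    (by positivity) hb hbline i3 (fun ξ => by
      have h := hκq (2 * Real.pi * inner ℝ e ξ / R)
      have h2 : ∀ x : ℝ, -(inner ℝ e ξ * (2 * Real.pi / R * x)) =
        -(x * (2 * Real.pi * inner ℝ e ξ / R)) := fun x => by ring
      simp only [h2, h, hS, hu]
      push_cast
      ring)
  rw [hsq] at b2 b3
  refine (enorm_add_le _ _).trans ?_
  rw [add_mul]
  refine add_le_add b1 ((enorm_sub_le).trans ((add_le_add b2 b3).trans (le_of_eq ?_)))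
  rw [← add_mul, ← add_mul, ← ENNReal.ofReal_add (by positivity)
    (mul_nonneg (by positivity) (integral_nonneg fun _ => norm_nonneg _))]
  congr 4
  simp
  ring

/-- A bump function is the Fourier transform of a Schwartz function, so it is a superposition of
characters of finite mass, as the estimate on lines requires. -/
lemma exists_cutoff_eq_integral {c : ℝ} (hc : 0 < c) : ∃ (φ : ℝ → ℝ) (q : ℝ → ℂ), Continuous φ ∧
    Integrable q ∧ (∀ t, ∫ x, Real.fourierChar (-(x * t)) • q x = (φ t : ℂ)) ∧
    (∀ t, φ t ∈ Icc (0 : ℝ) 1) ∧ (∀ t : ℝ, t ^ 2 ≤ c ^ 2 / 4 → φ t = 1) ∧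
    ∀ t, φ t ≠ 0 → |t| < c := by
  let φ : ContDiffBump (0 : ℝ) := ⟨c / 2, c, by positivity, by linarith⟩
  have hφs : HasCompactSupport (fun x => (φ x : ℂ)) := 
    φ.hasCompactSupport.comp_left (g := Complex.ofReal) Complex.ofReal_zero
  obtain ⟨Φ, hΦ⟩ : ∃ Φ : 𝓢(ℝ, ℂ), ∀ t, Φ t = φ t :=
    ⟨hφs.toSchwartzMap (Complex.ofRealCLM.contDiff.comp (φ.contDiff (n := ⊤))), fun t => rfl⟩
  obtain ⟨q, hq⟩ : ∃ q : 𝓢(ℝ, ℂ), 𝓕 q = Φ := ⟨𝓕⁻ Φ, FourierTransform.fourier_fourierInv_eq Φ⟩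
  refine ⟨φ, q, φ.continuous, q.integrable, fun t => ?_, fun t => ⟨φ.nonneg, φ.le_one⟩,
    fun t ht => φ.one_of_mem_closedBall ?_, fun t ht => ?_⟩
  · rw [← hΦ, ← hq, SchwartzMap.fourier_coe, Real.fourier_real_eq]
  · rw [mem_closedBall_zero_iff, Real.norm_eq_abs]
    exact abs_le_of_sq_le_sq (show t ^ 2 ≤ (c / 2) ^ 2 by linarith) (show 0 ≤ c / 2 by positivity)
  · have h : t ∈ Function.support φ := ht
    rw [φ.support_eq, mem_ball_zero_iff, Real.norm_eq_abs] at h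
    exact h

set_option maxHeartbeats 1000000 in
/-- The limiting absorption bound for the bilinear form of the resolvent on Schwartz functions. -/
theorem exists_enorm_integral_invSymb_le (hd : 2 ≤ d) {η : ℝ} (hη : 1 / 2 < η) :
    ∃ C : ℝ, 0 < C ∧ ∀ (k : ℝ) (γ : Space d) (τ : ℝ), 0 < k → τ ≠ 0 → ∀ f g : 𝓢(Space d, ℂ),
      ‖∫ ξ, 𝓕 f ξ * 𝓕 g ξ * invSymb k γ τ ξ‖ₑ ≤
        ENNReal.ofReal (C * (1 / radius k γ + 1 / radius k γ ^ 2)) *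
          (weightedNorm η f * weightedNorm η g) := by
  have hd0 : (0 : ℝ) < d := by
    have : 0 < d := by omega
    exact_mod_cast this
  -- If all `|2πξ_j|` are below `c₂ R`, then `|2πξ|² ≤ R²/2`, which keeps `ξ` away from the
  -- characteristic sphere.
  set c₂ : ℝ := 1 / √(2 * d) with hc₂
  have hc₂pos : 0 < c₂ := by positivity
  have hc₂sq : c₂ ^ 2 = 1 / (2 * d) := by
    rw [hc₂, div_pow, one_pow, Real.sq_sqrt (by positivity)]
  -- Chosen so that `2c = c₂²/4`, the range on which the bump equals one.
  set c : ℝ := c₂ ^ 2 / 8 with hc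
  have hcpos : 0 < c := by positivity
  obtain ⟨φ, q, hφc, hq, hκq, hφI, hκ1, hφsupp⟩ := exists_cutoff_eq_integral hc₂pos
  set A : ℝ := 4 * Real.pi ^ 2 / √c * (1 + ∫ x, ‖q x‖) * (bracketMass η).toReal with hA
  have hA0 : 0 ≤ A := mul_nonneg (mul_nonneg (by positivity)
    (add_nonneg zero_le_one (integral_nonneg fun _ => norm_nonneg _))) ENNReal.toReal_nonneg
  refine ⟨2 + d * (1 / c + A), by positivity, fun k γ τ hk hτ f g => ?_⟩
  set R := radius k γ with hR
  have hRpos : 0 < R := radius_pos hk γ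
  obtain ⟨e, he, hei, hee⟩ : ∃ e : Fin d → Space d, (∀ j, ‖e j‖ = 1) ∧
      (∀ j ξ, inner ℝ (e j) ξ = ξ j) ∧ ∀ i j, i ≠ j → inner ℝ (e i) (e j) = (0 : ℝ) :=
    ⟨fun j => EuclideanSpace.single j 1, fun j => by simp,
      fun j ξ => by simp [EuclideanSpace.inner_single_left],
      fun i j h => by simp [EuclideanSpace.inner_single_left, h]⟩
  let κ : Fin d → Space d → ℝ := fun j ξ => φ (2 * Real.pi * inner ℝ (e j) ξ / R)
  have hκc : ∀ j, Continuous (κ j) := fun j => hφc.comp (by fun_prop)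
  have hκI : ∀ j ξ, κ j ξ ∈ Icc (0 : ℝ) 1 := fun j ξ => hφI _
  have hprod : ∀ (s : Finset (Fin d)) ξ, |∏ i ∈ s, κ i ξ| ≤ 1 := fun s ξ => by
    rw [abs_of_nonneg (Finset.prod_nonneg fun i _ => (hκI i ξ).1)]
    exact Finset.prod_le_one (fun i _ => (hκI i ξ).1) fun i _ => (hκI i ξ).2
  -- The pieces are ordered so that the prefactor of `1 - κ j` involves only the coordinates `i <
  -- j`. It is therefore constant along the lines in the direction `e j`.
  have hpart : ∀ ξ, (∏ i, κ i ξ) +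
      ∑ j, (∏ i with i < j, κ i ξ) * (1 - κ j ξ) = 1 := by
    intro ξ
    have h := Finset.prod_one_sub_ordered Finset.univ (fun i => 1 - κ i ξ)
    simp only [sub_sub_cancel] at h
    rw [h]
    simp only [mul_comm]
    ring
  have hfg : Integrable fun ξ => 𝓕 f ξ * 𝓕 g ξ := integrable_fourier_mul f g
  obtain ⟨B, hB⟩ := exists_bound_fourier_mul f g
  have hint : ∀ w : Space d → ℝ, Continuous w → (∀ ξ, |w ξ| ≤ 1) →
      Integrable fun ξ => 𝓕 f ξ * 𝓕 g ξ * invSymb k γ τ ξ * (w ξ : ℂ) := by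
    intro w hw hw1
    have h := (integrable_mul_invSymb k γ τ hd hk hτ hfg hB)
    refine (h.bdd_mul (c := 1) (f := fun ξ => (w ξ : ℂ))
      (Complex.continuous_ofReal.comp hw).aestronglyMeasurable
      (ae_of_all _ fun ξ => ?_)).congr (ae_of_all _ fun ξ => ?_)
    · simpa using hw1 ξ
    · simp only
      ring
  have hsplit : ∫ ξ, 𝓕 f ξ * 𝓕 g ξ * invSymb k γ τ ξ =
      (∫ ξ, 𝓕 f ξ * 𝓕 g ξ * invSymb k γ τ ξ * (∏ i, κ i ξ : ℝ)) +
      ∑ j, ∫ ξ, 𝓕 f ξ * 𝓕 g ξ * invSymb k γ τ ξ *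
        ((∏ i with i < j, κ i ξ) * (1 - κ j ξ) : ℝ) := by
    have i1 := hint (fun ξ => ∏ i, κ i ξ) (continuous_finsetProd _ fun i _ => hκc i) (hprod _)
    have i2 : ∀ j, Integrable fun ξ => 𝓕 f ξ * 𝓕 g ξ * invSymb k γ τ ξ *
        ((((∏ i with i < j, κ i ξ) * (1 - κ j ξ) : ℝ)) : ℂ) := fun j =>
      hint (fun ξ => (∏ i with i < j, κ i ξ) * (1 - κ j ξ))
        ((continuous_finsetProd _ fun i _ => hκc i).mul (continuous_const.sub (hκc j)))
        fun ξ => by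
          rw [abs_mul]
          refine mul_le_one₀ (hprod _ _) (abs_nonneg _) (abs_le.2 ⟨?_, ?_⟩) <;>
            linarith [(hκI j ξ).1, (hκI j ξ).2]
    rw [← integral_finsetSum _ fun j _ => i2 j, ← integral_add i1
      (integrable_finsetSum _ fun j _ => i2 j)]
    refine integral_congr_ae (ae_of_all _ fun ξ => ?_)
    simp only
    rw [← Finset.mul_sum, ← mul_add, ← Complex.ofReal_sum, ← Complex.ofReal_add, hpart,
      Complex.ofReal_one, mul_one]
  have hbm : bracketMass η = ENNReal.ofReal (bracketMass η).toReal :=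
    (ENNReal.ofReal_toReal (bracketMass_lt_top hη).ne).symm
  have b1 : ‖∫ ξ, 𝓕 f ξ * 𝓕 g ξ * invSymb k γ τ ξ * (∏ i, κ i ξ : ℝ)‖ₑ ≤
      ENNReal.ofReal (2 / R ^ 2) * (weightedNorm η f * weightedNorm η g) := by
    simp only [mul_assoc (𝓕 f _ * 𝓕 g _)]
    refine (enorm_integral_le_of_elliptic f g (B := 2 / R ^ 2) fun ξ => ?_).trans ?_
    · by_cases h0 : ∏ i, κ i ξ = 0
      · simp only [h0, Complex.ofReal_zero, mul_zero, norm_zero]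
        positivity
      replace h0 := Finset.prod_ne_zero_iff.1 h0
      have h1 : ∀ i, (2 * Real.pi * ξ i) ^ 2 ≤ R ^ 2 / (2 * d) := by
        intro i
        have h2 := hφsupp _ (h0 i (Finset.mem_univ i))
        rw [hei] at h2
        have h3 := sq_le_sq' (by linarith [abs_lt.1 h2]) (abs_lt.1 h2).2.le
        rw [div_pow, hc₂sq, div_le_iff₀ (by positivity)] at h3
        calc _ ≤ _ := h3
          _ = _ := by ring
      have h4 : ‖(2 * Real.pi) • ξ‖ ^ 2 ≤ R ^ 2 / 2 := by
        rw [EuclideanSpace.norm_sq_eq]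
        calc ∑ i, ‖((2 * Real.pi) • ξ) i‖ ^ 2 ≤ ∑ i : Fin d, R ^ 2 / (2 * d) := by
              refine Finset.sum_le_sum fun i _ => ?_
              rw [Real.norm_eq_abs, sq_abs]
              exact h1 i
          _ = _ := by
              rw [Finset.sum_const, Finset.card_univ, Fintype.card_fin, nsmul_eq_mul]
              field_simp
      have h5 := norm_sq_sub_le_norm_symb k γ τ ((2 * Real.pi) • ξ)
      have h6 := neg_le_abs (‖(2 * Real.pi) • ξ‖ ^ 2 - radius k γ ^ 2)
      rw [norm_mul, invSymb, norm_inv, Complex.norm_real, Real.norm_eq_abs]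
      calc _ ≤ ‖symb k γ τ ((2 * Real.pi) • ξ)‖⁻¹ * 1 := by
            gcongr
            exact hprod _ ξ
        _ ≤ (R ^ 2 / 2)⁻¹ := by
            rw [mul_one]
            gcongr
            linarith
        _ = _ := by rw [inv_div]
    · have hη0 : 0 ≤ η := by linarith
      gcongr <;> exact eLpNorm_le_weightedNorm hη0 _
  have b2 : ∀ j, ‖∫ ξ, 𝓕 f ξ * 𝓕 g ξ * invSymb k γ τ ξ *
        ((∏ i with i < j, κ i ξ) * (1 - κ j ξ) : ℝ)‖ₑ ≤
      ENNReal.ofReal (1 / c * (1 / R ^ 2) + A * (1 / R)) *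
        (weightedNorm η f * weightedNorm η g) := by
    intro j
    have h := enorm_integral_high_frequency_le γ hd hk hτ (he j) f g hη hq hφc hκq hφI hcpos
      (fun t ht => hκ1 t (by rw [hc] at ht; linarith)) (b := fun ξ => ∏ i with i < j, κ i ξ)
      (continuous_finsetProd _ fun i _ => hκc i) (hprod _) (fun t y => ?_)
    · refine h.trans (le_of_eq ?_)
      congr 1
      rw [hbm, ← ENNReal.ofReal_mul (mul_nonneg (by positivity)
        (add_nonneg zero_le_one (integral_nonneg fun _ => norm_nonneg _))),
        ← ENNReal.ofReal_add (by positivity) (mul_nonneg (mul_nonneg (by positivity)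
        (add_nonneg zero_le_one (integral_nonneg fun _ => norm_nonneg _)))
          ENNReal.toReal_nonneg), ← hR]
      congr 1
      rw [hA]
      field_simp
    · refine Finset.prod_congr rfl fun i hi => ?_
      have hij : i ≠ j := (Finset.mem_filter.1 hi).2.ne
      simp only [κ, lineMap, inner_add_right, inner_smul_right, hee i j hij, mul_zero, zero_add]
  rw [hsplit]
  refine (enorm_add_le _ _).trans ((add_le_add b1 ((enorm_sum_le _ _).trans
    (Finset.sum_le_sum fun j _ => b2 j))).trans ?_)
  rw [Finset.sum_const, Finset.card_univ, Fintype.card_fin, nsmul_eq_mul, ← mul_assoc (d : ℝ≥0∞), ← add_mul]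
  gcongr
  rw [← ENNReal.ofReal_natCast, ← ENNReal.ofReal_mul (by positivity), ← ENNReal.ofReal_add
    (by positivity) (by positivity)]
  refine ENNReal.ofReal_le_ofReal ?_
  have h1 : 0 < 1 / R := by positivity
  have h2 : 0 < 1 / R ^ 2 := by positivity
  have h3 : 0 < 1 / c := by positivity
  have e1 : 2 / R ^ 2 = 2 * (1 / R ^ 2) := by ring
  rw [e1]
  have h4 : 0 ≤ d * (1 / c) * (1 / R) := by positivity
  have h5 : 0 ≤ d * A * (1 / R ^ 2) := by positivity
  nlinarith

end Resolvent
-- Weighted `L²` spaces, duality and density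
section WeightedL2

variable {d : ℕ}

/-- The norm of `L²(⟨x⟩^η)` for functions. -/
def weightedLp (η : ℝ) (F : Space d → ℂ) : ℝ≥0∞ :=
  eLpNorm (fun x => (bracket η x : ℂ) * F x) 2 volume

lemma weightedLp_coe (η : ℝ) (f : 𝓢(Space d, ℂ)) : weightedLp η f = weightedNorm η f := rfl

lemma weightedLp_congr {η : ℝ} {F G : Space d → ℂ} (h : F =ᵐ[volume] G) :
    weightedLp η F = weightedLp η G :=
  eLpNorm_congr_ae (by filter_upwards [h] with x hx; rw [hx])

lemma bracket_neg_mul_bracket (η : ℝ) (x : Space d) : bracket (-η) x * bracket η x = 1 := by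
  have h : (0 : ℝ) < 1 + ‖x‖ ^ 2 := by positivity
  rw [bracket, bracket, ← Real.rpow_add h, neg_div, neg_add_cancel, Real.rpow_zero]

lemma aestronglyMeasurable_bracket_mul (η : ℝ) {F : Space d → ℂ}
    (hF : AEStronglyMeasurable F volume) :
    AEStronglyMeasurable (fun x => (bracket η x : ℂ) * F x) volume :=
  (Complex.continuous_ofReal.comp (continuous_bracket η)).aestronglyMeasurable.mul hF

lemma lintegral_enorm_mul_le (η : ℝ) {F G : Space d → ℂ} (hF : AEStronglyMeasurable F volume)
    (hG : AEStronglyMeasurable G volume) :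
    ∫⁻ x, ‖F x * G x‖ₑ ≤ weightedLp η F * weightedLp (-η) G := by
  have h := sq_lintegral_mul_le (μ := volume) (aestronglyMeasurable_bracket_mul η hF).enorm
    (aestronglyMeasurable_bracket_mul (-η) hG).enorm
  rw [← sq_eLpNorm_two, ← sq_eLpNorm_two, ← mul_pow] at h
  refine (le_of_eq (lintegral_congr fun x => ?_)).trans (le_of_sq_le_sq_ennreal h)
  rw [← enorm_mul]
  congr 1
  have h2 : (bracket (-η) x : ℂ) * bracket η x = 1 := by
    exact_mod_cast bracket_neg_mul_bracket η x
  linear_combination (-(F x * G x)) * h2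

lemma integrable_mul_of_weightedLp {η : ℝ} {F G : Space d → ℂ}
    (hF : AEStronglyMeasurable F volume) (hF' : weightedLp η F < ⊤)
    (hG : AEStronglyMeasurable G volume) (hG' : weightedLp (-η) G < ⊤) :
    Integrable fun x => F x * G x :=
  ⟨hF.mul hG, (lintegral_enorm_mul_le η hF hG).trans_lt (ENNReal.mul_lt_top hF' hG')⟩

lemma enorm_integral_mul_le (η : ℝ) {F G : Space d → ℂ} (hF : AEStronglyMeasurable F volume)
    (hG : AEStronglyMeasurable G volume) :
    ‖∫ x, F x * G x‖ₑ ≤ weightedLp η F * weightedLp (-η) G :=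
  (enorm_integral_le_lintegral_enorm _).trans (lintegral_enorm_mul_le η hF hG)

lemma weightedLp_coe_lt_top (η : ℝ) (f : 𝓢(Space d, ℂ)) : weightedLp η f < ⊤ :=
  weightedNorm_lt_top η f

lemma weightedLp_mono {η η' : ℝ} (h : η ≤ η') (F : Space d → ℂ) :
    weightedLp η F ≤ weightedLp η' F := by
  refine eLpNorm_mono fun x => ?_
  rw [norm_mul, norm_mul, Complex.norm_real, Complex.norm_real,
    Real.norm_of_nonneg (bracket_pos _ _).le, Real.norm_of_nonneg (bracket_pos _ _).le]
  gcongr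
  exact Real.rpow_le_rpow_of_exponent_le (by nlinarith [sq_nonneg ‖x‖]) (by linarith)

lemma weightedLp_add_le (η : ℝ) {F G : Space d → ℂ} (hF : AEStronglyMeasurable F volume)
    (hG : AEStronglyMeasurable G volume) :
    weightedLp η (F + G) ≤ weightedLp η F + weightedLp η G := by
  have e : (fun x => (bracket η x : ℂ) * (F + G) x) =
      (fun x => (bracket η x : ℂ) * F x) + fun x => (bracket η x : ℂ) * G x := by
    funext x
    simp [mul_add]
  rw [weightedLp, e]
  exact eLpNorm_add_le (aestronglyMeasurable_bracket_mul η hF)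
    (aestronglyMeasurable_bracket_mul η hG) (by norm_num)

lemma weight_neg_weight (η : ℝ) (f : 𝓢(Space d, ℂ)) : weight (-η) (weight η f) = f := by
  ext x
  rw [weight_apply, weight_apply, ← mul_assoc]
  have h2 : (bracket (-η) x : ℂ) * bracket η x = 1 := by
    exact_mod_cast bracket_neg_mul_bracket η x
  rw [h2, one_mul]

/-- Functions that define the same tempered distribution agree almost everywhere. -/
lemma ae_eq_of_integral_schwartz_mul_eq {F G : Space d → ℂ}
    (hF : ∀ φ : 𝓢(Space d, ℂ), Integrable fun x => φ x * F x)
    (hG : ∀ φ : 𝓢(Space d, ℂ), Integrable fun x => φ x * G x)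
    (h : ∀ φ : 𝓢(Space d, ℂ), ∫ x, φ x * F x = ∫ x, φ x * G x) : F =ᵐ[volume] G := by
  have key : ∀ φ : 𝓢(Space d, ℂ), (Integrable fun x => φ x * (F x - G x)) ∧
      ∫ x, φ x * (F x - G x) = 0 := by
    intro φ
    simp only [mul_sub]
    exact ⟨(hF φ).sub (hG φ), by rw [integral_sub (hF φ) (hG φ), h, sub_self]⟩
  have hS : ∀ g : Space d → ℝ, ContDiff ℝ ∞ g → HasCompactSupport g →
      ∃ Φ : 𝓢(Space d, ℂ), ∀ x, Φ x = g x := by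
    intro g hg hgs
    have hs : HasCompactSupport (fun x => (g x : ℂ)) :=
      hgs.comp_left (g := Complex.ofReal) Complex.ofReal_zero
    exact ⟨hs.toSchwartzMap (Complex.ofRealCLM.contDiff.comp hg), fun t => rfl⟩
  have h0 : ∀ᵐ x ∂(volume : Measure (Space d)), F x - G x = 0 := by
    refine ae_eq_zero_of_integral_contDiff_smul_eq_zero (fun x => ?_) fun g hg hgs => ?_
    · let b : ContDiffBump x := ⟨1, 2, one_pos, one_lt_two⟩
      obtain ⟨Φ, hΦ⟩ := hS b b.contDiff b.hasCompactSupport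
      refine ⟨Metric.closedBall x 1, Metric.closedBall_mem_nhds x one_pos, ?_⟩
      refine (key Φ).1.integrableOn.congr_fun (fun y hy => ?_) measurableSet_closedBall
      simp only [hΦ, b.one_of_mem_closedBall hy, Complex.ofReal_one, one_mul]
    · obtain ⟨Φ, hΦ⟩ := hS g hg hgs
      rw [← (key Φ).2]
      simp [hΦ]
  filter_upwards [h0] with x hx using sub_eq_zero.1 hx

lemma Represents.ae_eq {v : 𝓢'(Space d, ℂ)} {F G : Space d → ℂ} (hF : Represents v F)
    (hG : Represents v G) : F =ᵐ[volume] G :=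
  ae_eq_of_integral_schwartz_mul_eq (fun φ => (hF.2 φ).1) (fun φ => (hG.2 φ).1) fun φ => by
    rw [← (hF.2 φ).2, ← (hG.2 φ).2]

lemma Represents.weightedL2Norm_eq {v : 𝓢'(Space d, ℂ)} {F : Space d → ℂ} (hF : Represents v F)
    (η : ℝ) : weightedL2Norm (bracket η) v = weightedLp η F :=
  le_antisymm (iInf₂_le F hF) (le_iInf₂ fun _ hG => (weightedLp_congr (hF.ae_eq hG)).le)

lemma exists_represents_of_weightedL2Norm_lt_top {η : ℝ} {v : 𝓢'(Space d, ℂ)}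
    (h : weightedL2Norm (bracket η) v < ⊤) : ∃ F, Represents v F ∧ weightedLp η F < ⊤ := by
  by_contra! hc
  refine h.ne (top_le_iff.1 (le_iInf₂ fun F hF => hc F hF))

/-- Every function in a weighted `L²` space defines a tempered distribution. -/
lemma exists_represents {η : ℝ} {F : Space d → ℂ} (hF : AEStronglyMeasurable F volume)
    (hF' : weightedLp η F < ⊤) : ∃ v : 𝓢'(Space d, ℂ), Represents v F := by
  have hm : MemLp (fun x => (bracket η x : ℂ) * F x) 2 volume :=
    ⟨aestronglyMeasurable_bracket_mul η hF, hF'⟩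
  refine ⟨TemperedDistribution.smulLeftCLM ℂ (fun x => (bracket (-η) x : ℂ))
    (hm.toLp _ : 𝓢'(Space d, ℂ)), hF, fun φ => ⟨?_, ?_⟩⟩
  · refine integrable_mul_of_weightedLp (η := -η) φ.continuous.aestronglyMeasurable
      (weightedLp_coe_lt_top _ φ) hF ?_
    rwa [neg_neg]
  · rw [TemperedDistribution.smulLeftCLM_apply_apply, Lp.toTemperedDistribution_apply]
    refine integral_congr_ae ?_
    filter_upwards [hm.coeFn_toLp] with x hx
    rw [hx, SchwartzMap.smulLeftCLM_apply_apply (hasTemperateGrowth_bracket _)]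
    have h2 : (bracket (-η) x : ℂ) * bracket η x = 1 := by
      exact_mod_cast bracket_neg_mul_bracket η x
    simp only [smul_eq_mul]
    linear_combination (φ x * F x) * h2

/-- The Riesz representation theorem for functionals that are bounded in a weighted `L²` norm. -/
lemma exists_eq_integral_of_le_weightedNorm {η : ℝ} (L : 𝓢(Space d, ℂ) →ₗ[ℂ] ℂ) {C : ℝ}
    (hC : 0 ≤ C)
    (hL : ∀ φ, ‖L φ‖ₑ ≤ ENNReal.ofReal C * weightedNorm η φ) :
    ∃ F : Space d → ℂ, AEStronglyMeasurable F volume ∧ weightedLp (-η) F ≤ ENNReal.ofReal C ∧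
      ∀ φ, L φ = ∫ x, φ x * F x := by
  let e : 𝓢(Space d, ℂ) →ₗ[ℂ] Lp ℂ 2 (volume : Measure (Space d)) :=
    (SchwartzMap.toLpCLM ℂ ℂ 2 volume : 𝓢(Space d, ℂ) →L[ℂ] Lp ℂ 2 volume).toLinearMap
  -- Removing the weight makes the functional bounded in plain `L²`, so it extends from the dense
  -- Schwartz functions and has a Riesz representative.
  let L' : 𝓢(Space d, ℂ) →ₗ[ℂ] ℂ := L ∘ₗ (weight (-η)).toLinearMap
  have hdense : DenseRange e := SchwartzMap.denseRange_toLpCLM (by norm_num)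
  have he : ∀ φ, ENNReal.ofReal ‖e φ‖ = eLpNorm φ 2 volume := by
    intro φ
    have h1 : ‖e φ‖ = (eLpNorm φ 2 volume).toReal := SchwartzMap.norm_toLp
    rw [h1, ENNReal.ofReal_toReal (φ.memLp 2 volume).2.ne]
  have hb : ∀ φ, ‖L' φ‖ ≤ C * ‖e φ‖ := by
    intro φ
    have h := hL (weight (-η) φ)
    rw [weightedNorm_eq] at h
    have h3 : weight η (weight (-η) φ) = φ := by
      simpa using weight_neg_weight (-η) φ
    rw [h3, ← he, ← ENNReal.ofReal_mul hC, ← ofReal_norm,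
      ENNReal.ofReal_le_ofReal_iff (by positivity)] at h
    exact h
  let Λ : Lp ℂ 2 (volume : Measure (Space d)) →L[ℂ] ℂ := L'.extendOfNorm e
  have hΛ : ∀ φ, Λ (e φ) = L' φ := LinearMap.extendOfNorm_eq hdense ⟨C, hb⟩
  have hΛC : ‖Λ‖ ≤ C := ContinuousLinearMap.opNorm_le_bound _ hC
    (LinearMap.norm_extendOfNorm_apply_le hdense C hb)
  let h := (InnerProductSpace.toDual ℂ (Lp ℂ 2 (volume : Measure (Space d)))).symm Λ
  have hh : ‖h‖ ≤ C := by rwa [LinearIsometryEquiv.norm_map]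
  have hm : AEStronglyMeasurable (fun x => (starRingEnd ℂ) (h x)) volume :=
    Complex.continuous_conj.comp_aestronglyMeasurable (Lp.aestronglyMeasurable h)
  refine ⟨fun x => (bracket η x : ℂ) * (starRingEnd ℂ) (h x),
    aestronglyMeasurable_bracket_mul η hm, ?_, fun φ => ?_⟩
  · have e1 : weightedLp (-η) (fun x => (bracket η x : ℂ) * (starRingEnd ℂ) (h x)) =
        eLpNorm h 2 volume := by
      refine eLpNorm_congr_norm_ae (ae_of_all _ fun x => ?_)
      have h2 : (bracket (-η) x : ℂ) * bracket η x = 1 := by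
        exact_mod_cast bracket_neg_mul_bracket η x
      rw [← mul_assoc, h2, one_mul, RCLike.norm_conj]
    rw [e1, ← ENNReal.ofReal_toReal (Lp.memLp h).2.ne]
    exact ENNReal.ofReal_le_ofReal hh
  · have h1 : L φ = Λ (e (weight η φ)) := by
      rw [hΛ]
      exact congrArg L (weight_neg_weight η φ).symm
    have h2 : Λ (e (weight η φ)) = inner ℂ h (e (weight η φ)) := by
      rw [InnerProductSpace.toDual_symm_apply]
    rw [h1, h2, L2.inner_def]
    refine integral_congr_ae ?_
    have h4 : (e (weight η φ) : Space d → ℂ) =ᵐ[volume] weight η φ :=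
      SchwartzMap.coeFn_toLp (weight η φ) 2 volume
    filter_upwards [h4] with x hx
    rw [hx, weight_apply]
    simp only [RCLike.inner_apply]
    ring

/-- Density of Schwartz functions in weighted `L²` spaces. -/
lemma exists_schwartz_weightedLp_sub_le {η : ℝ} {F : Space d → ℂ}
    (hF : AEStronglyMeasurable F volume) (hF' : weightedLp η F < ⊤) {ε : ℝ} (hε : 0 < ε) :
    ∃ f : 𝓢(Space d, ℂ), weightedLp η (fun x => F x - f x) ≤ ENNReal.ofReal ε := by
  have hm : MemLp (fun x => (bracket η x : ℂ) * F x) 2 volume :=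
    ⟨aestronglyMeasurable_bracket_mul η hF, hF'⟩
  have hdense : DenseRange (SchwartzMap.toLpCLM ℂ ℂ 2 (volume : Measure (Space d)) :
      𝓢(Space d, ℂ) → Lp ℂ 2 (volume : Measure (Space d))) :=
    SchwartzMap.denseRange_toLpCLM (by norm_num)
  obtain ⟨g, hg⟩ := Metric.denseRange_iff.1 hdense (hm.toLp _) ε hε
  refine ⟨weight (-η) g, ?_⟩
  rw [dist_eq_norm, Lp.norm_def] at hg
  have h1 : weightedLp η (fun x => F x - weight (-η) g x) =
      eLpNorm (hm.toLp _ - SchwartzMap.toLpCLM ℂ ℂ 2 volume g : Lp ℂ 2 (volume : Measure (Space d)))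
        2 volume := by
    refine eLpNorm_congr_ae ?_
    have h4 : (SchwartzMap.toLpCLM ℂ ℂ 2 volume g : Space d → ℂ) =ᵐ[volume] g :=
      SchwartzMap.coeFn_toLp g 2 volume
    filter_upwards [hm.coeFn_toLp, h4, Lp.coeFn_sub (hm.toLp _)
      (SchwartzMap.toLpCLM ℂ ℂ 2 volume g)] with x hx h4 h5
    rw [h5, Pi.sub_apply, hx, h4, weight_apply]
    have h2 : (bracket (-η) x : ℂ) * bracket η x = 1 := by
      exact_mod_cast bracket_neg_mul_bracket η x
    linear_combination (-g x) * h2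
  rw [h1, ← ENNReal.ofReal_toReal (Lp.memLp _).2.ne]
  exact ENNReal.ofReal_le_ofReal hg.le

end WeightedL2
-- Reflection, to pass between `𝓕` and `𝓕⁻`
section Reflection

variable {d : ℕ}

/-- The reflection `f ↦ f(-·)` of Schwartz functions. -/
def reflect : 𝓢(Space d, ℂ) →L[ℂ] 𝓢(Space d, ℂ) :=
  SchwartzMap.compCLMOfContinuousLinearEquiv ℂ (ContinuousLinearEquiv.neg ℝ)

lemma reflect_apply (f : 𝓢(Space d, ℂ)) (x : Space d) : reflect f x = f (-x) := rfl

lemma fourierInv_eq_fourier_reflect (f : 𝓢(Space d, ℂ)) : 𝓕⁻ f = 𝓕 (reflect f) := by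
  ext x
  rw [SchwartzMap.fourierInv_coe, SchwartzMap.fourier_coe, Real.fourierInv_eq_fourier_comp_neg]
  rfl

lemma fourier_apply_eq_fourierInv_neg (f : 𝓢(Space d, ℂ)) (x : Space d) :
    𝓕 f x = 𝓕⁻ f (-x) := by
  rw [SchwartzMap.fourierInv_coe, SchwartzMap.fourier_coe, Real.fourierInv_eq_fourier_neg, neg_neg]

lemma bracket_neg_arg (η : ℝ) (x : Space d) : bracket η (-x) = bracket η x := by
  rw [bracket, bracket, norm_neg]

lemma weightedNorm_reflect (η : ℝ) (f : 𝓢(Space d, ℂ)) :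
    weightedNorm η (reflect f) = weightedNorm η f := by
  apply le_antisymm <;> apply le_of_sq_le_sq_ennreal <;>
    rw [weightedNorm, weightedNorm, sq_eLpNorm_two, sq_eLpNorm_two]
  · rw [← lintegral_neg_eq_self]
    simp [reflect_apply, bracket_neg_arg]
  · rw [← lintegral_neg_eq_self]
    simp [reflect_apply, bracket_neg_arg]

end Reflection

/-! ### Multipliers with Schwartz symbols on weighted spaces -/

section TransposedMultiplier

variable {d : ℕ}

/-- The transpose of the Fourier multiplier with symbol `a`, acting on Schwartz functions. -/
def dualMult (a : Space d → ℂ) : 𝓢(Space d, ℂ) →L[ℂ] 𝓢(Space d, ℂ) :=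
  FourierTransform.fourierCLM ℂ 𝓢(Space d, ℂ) ∘L SchwartzMap.smulLeftCLM ℂ a ∘L
    FourierTransform.fourierInvCLM ℂ 𝓢(Space d, ℂ)

lemma dualMult_apply (a : Space d → ℂ) (φ : 𝓢(Space d, ℂ)) :
    dualMult a φ = 𝓕 (SchwartzMap.smulLeftCLM ℂ a (𝓕⁻ φ)) := rfl

lemma fourierMultiplierCLM_apply_eq (a : Space d → ℂ) (v : 𝓢'(Space d, ℂ)) (φ : 𝓢(Space d, ℂ)) :
    TemperedDistribution.fourierMultiplierCLM ℂ a v φ = v (dualMult a φ) := rfl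

lemma fourierInv_dualMult {a : Space d → ℂ} (ha : a.HasTemperateGrowth) (φ : 𝓢(Space d, ℂ))
    (ξ : Space d) : 𝓕⁻ (dualMult a φ) ξ = a ξ * 𝓕⁻ φ ξ := by
  rw [dualMult_apply, FourierTransform.fourierInv_fourier_eq,
    SchwartzMap.smulLeftCLM_apply_apply ha, smul_eq_mul]

lemma fourier_fourierMultiplierCLM {a : Space d → ℂ} (ha : a.HasTemperateGrowth)
    (f : 𝓢(Space d, ℂ)) (ξ : Space d) :
    𝓕 (SchwartzMap.fourierMultiplierCLM ℂ a f) ξ = a ξ * 𝓕 f ξ := by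
  rw [SchwartzMap.fourierMultiplierCLM_apply, FourierTransform.fourier_fourierInv_eq,
    SchwartzMap.smulLeftCLM_apply_apply ha, smul_eq_mul]

-- The Fourier transform turns the product with `A` into a correlation with the Schwartz kernel `𝓕⁻
-- A`; weights can be estimated on this explicit formula.
open Convolution in
lemma dualMult_schwartz_apply (A φ : 𝓢(Space d, ℂ)) (x : Space d) :
    dualMult A φ x = ∫ t, 𝓕⁻ A t * φ (x + t) := by
  have h1 : dualMult A φ x =
      SchwartzMap.convolution (ContinuousLinearMap.mul ℂ ℂ) (𝓕⁻ A) (reflect φ) (-x) := by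
    rw [dualMult_apply, fourier_apply_eq_fourierInv_neg]
    congr 1
    change _ = 𝓕⁻ (SchwartzMap.pairing (ContinuousLinearMap.mul ℂ ℂ) (𝓕 (𝓕⁻ A)) (𝓕 (reflect φ)))
    congr 1
    ext ξ
    rw [SchwartzMap.smulLeftCLM_apply_apply A.hasTemperateGrowth, SchwartzMap.pairing_apply_apply,
      FourierTransform.fourier_fourierInv_eq, fourierInv_eq_fourier_reflect]
    rfl
  rw [h1, SchwartzMap.convolution_apply, convolution_def]
  refine integral_congr_ae (ae_of_all _ fun t => ?_)
  simp only [ContinuousLinearMap.mul_apply', reflect_apply]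
  congr 2
  abel

/-- Peetre's inequality. -/
lemma bracket_le_mul_bracket_add (η : ℝ) (x t : Space d) :
    bracket η x ≤ 2 ^ (|η| / 2) * (bracket |η| t * bracket η (x + t)) := by
  have key : ∀ u v : Space d, 1 + ‖u‖ ^ 2 ≤ 2 * ((1 + ‖v‖ ^ 2) * (1 + ‖u + v‖ ^ 2)) := by
    intro u v
    have h1 : ‖u‖ ≤ ‖u + v‖ + ‖v‖ := by
      have := norm_sub_le (u + v) v
      rwa [add_sub_cancel_right] at this
    have h2 : ‖u‖ ^ 2 ≤ (‖u + v‖ + ‖v‖) ^ 2 := by gcongr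
    nlinarith [sq_nonneg (‖u + v‖ - ‖v‖), mul_nonneg (sq_nonneg ‖v‖) (sq_nonneg ‖u + v‖)]
  have key2 : ∀ (u v : Space d) (ζ : ℝ), 0 ≤ ζ →
      bracket ζ u ≤ 2 ^ (ζ / 2) * (bracket ζ v * bracket ζ (u + v)) := by
    intro u v ζ hζ
    rw [bracket, bracket, bracket, ← Real.mul_rpow (by positivity) (by positivity),
      ← Real.mul_rpow (by positivity) (by positivity)]
    exact Real.rpow_le_rpow (by positivity) (key u v) (by linarith)
  rcases le_total 0 η with hη | hη
  · rw [abs_of_nonneg hη]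
    exact key2 x t η hη
  · rw [abs_of_nonpos hη]
    -- For a negative exponent, the positive case is applied with the roles of `x` and `x + t`
    -- exchanged, and the brackets are moved across.
    have h := key2 (x + t) (-t) (-η) (by linarith)
    rw [add_neg_cancel_right, bracket_neg_arg] at h
    have h1 := bracket_neg_mul_bracket η x
    have h2 := bracket_neg_mul_bracket η (x + t)
    have p1 := bracket_pos η x
    have p2 := bracket_pos η (x + t)
    have h3 := mul_le_mul_of_nonneg_right h (mul_pos p1 p2).le
    have e1 : bracket (-η) (x + t) * (bracket η x * bracket η (x + t)) = bracket η x := by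
      linear_combination (bracket η x) * h2
    have e2 : 2 ^ (-η / 2) * (bracket (-η) t * bracket (-η) x) *
        (bracket η x * bracket η (x + t)) = 2 ^ (-η / 2) * (bracket (-η) t * bracket η (x + t)) := by
      linear_combination (2 ^ (-η / 2) * (bracket (-η) t * bracket η (x + t))) * h1
    rwa [e1, e2] at h3

/-- A special case of Young's inequality. -/
lemma lintegral_sq_lintegral_mul_le {k u : Space d → ℝ≥0∞} (hk : Measurable k)
    (hu : Measurable u) :
    ∫⁻ x, (∫⁻ t, k t * u (x + t)) ^ 2 ≤ (∫⁻ t, k t) ^ 2 * ∫⁻ x, u x ^ 2 := by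
  have h1 : ∀ x, (∫⁻ t, k t * u (x + t)) ^ 2 ≤ (∫⁻ t, k t) * ∫⁻ t, k t * u (x + t) ^ 2 := by
    intro x
    have h := sq_lintegral_mul_le (μ := volume) (f := fun t => k t ^ (1 / 2 : ℝ))
      (g := fun t => k t ^ (1 / 2 : ℝ) * u (x + t)) (by fun_prop) (by fun_prop)
    have h2 : ∀ t, k t ^ (1 / 2 : ℝ) * k t ^ (1 / 2 : ℝ) = k t := fun t => by
      rw [← ENNReal.rpow_add_of_nonneg _ _ (by norm_num) (by norm_num)]
      norm_num
    simpa only [mul_pow, ← mul_assoc, sq (k _ ^ (1 / 2 : ℝ)), h2] using h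
  calc _ ≤ ∫⁻ x, (∫⁻ t, k t) * ∫⁻ t, k t * u (x + t) ^ 2 := lintegral_mono h1
    _ = (∫⁻ t, k t) * ∫⁻ x, ∫⁻ t, k t * u (x + t) ^ 2 := by
        refine lintegral_const_mul _ (Measurable.lintegral_prod_right' (f := fun p : Space d × Space d
          => k p.2 * u (p.1 + p.2) ^ 2) (by fun_prop))
    _ = (∫⁻ t, k t) * ∫⁻ t, ∫⁻ x, k t * u (x + t) ^ 2 := by
        rw [lintegral_lintegral_swap]
        exact Measurable.aemeasurable (by fun_prop)
    _ = (∫⁻ t, k t) * ∫⁻ t, k t * ∫⁻ x, u x ^ 2 := by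
        congr 1
        refine lintegral_congr fun t => ?_
        rw [lintegral_const_mul _ (by fun_prop), lintegral_add_right_eq_self (fun x => u x ^ 2) t]
    _ = _ := by
        rw [lintegral_mul_const _ hk]
        ring

/-- Multipliers with Schwartz symbols are bounded on weighted `L²` spaces. -/
lemma exists_weightedNorm_dualMult_le (A : 𝓢(Space d, ℂ)) (η : ℝ) :
    ∃ C : ℝ, 0 ≤ C ∧ ∀ φ, weightedNorm η (dualMult A φ) ≤ ENNReal.ofReal C * weightedNorm η φ := by
  obtain ⟨K, hK⟩ : ∃ K : 𝓢(Space d, ℂ), K = 𝓕⁻ A := ⟨_, rfl⟩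
  let k : Space d → ℝ≥0∞ := fun t => ‖weight |η| K t‖ₑ
  have hk : Measurable k := (weight |η| K).continuous.measurable.enorm
  have hkfin : ∫⁻ t, k t < ⊤ := (weight |η| K).integrable.2
  refine ⟨(ENNReal.ofReal (2 ^ (|η| / 2)) * ∫⁻ t, k t).toReal, ENNReal.toReal_nonneg,
    fun φ => ?_⟩
  rw [ENNReal.ofReal_toReal (ENNReal.mul_lt_top ENNReal.ofReal_lt_top hkfin).ne]
  let u : Space d → ℝ≥0∞ := fun x => ‖weight η φ x‖ₑ
  have hu : Measurable u := (weight η φ).continuous.measurable.enorm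
  apply le_of_sq_le_sq_ennreal
  rw [mul_pow, mul_pow, weightedNorm, weightedNorm, sq_eLpNorm_two, sq_eLpNorm_two, mul_assoc]
  have h2 : ∫⁻ x, ‖(bracket η x : ℂ) * φ x‖ₑ ^ 2 = ∫⁻ x, u x ^ 2 := by
    simp only [u, weight_apply]
  rw [h2]
  -- Peetre's inequality transfers the weight from `x` to `x + t`; the loss `⟨t⟩^|η|` is absorbed by
  -- the rapidly decaying kernel.
  have h3 : ∀ x, ‖(bracket η x : ℂ) * dualMult A φ x‖ₑ ^ 2 ≤
      ENNReal.ofReal (2 ^ (|η| / 2)) ^ 2 * (∫⁻ t, k t * u (x + t)) ^ 2 := by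
    intro x
    rw [← mul_pow]
    gcongr
    rw [dualMult_schwartz_apply, ← hK, ← integral_const_mul]
    refine (enorm_integral_le_lintegral_enorm _).trans ?_
    rw [← lintegral_const_mul' _ _ ENNReal.ofReal_ne_top]
    refine lintegral_mono fun t => ?_
    simp only [k, u, weight_apply, enorm_mul]
    have hb : ∀ (ζ : ℝ) (y : Space d), ‖(bracket ζ y : ℂ)‖ₑ = ENNReal.ofReal (bracket ζ y) := by
      intro ζ y
      rw [← ofReal_norm, Complex.norm_real, Real.norm_of_nonneg (bracket_pos _ _).le]
    rw [hb, hb, hb]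
    calc _ ≤ ENNReal.ofReal (2 ^ (|η| / 2) * (bracket |η| t * bracket η (x + t))) *
          (‖K t‖ₑ * ‖φ (x + t)‖ₑ) := by
          gcongr
          exact bracket_le_mul_bracket_add η x t
      _ = _ := by
          rw [ENNReal.ofReal_mul (by positivity), ENNReal.ofReal_mul (bracket_pos _ _).le]
          ring
  calc _ ≤ ∫⁻ x, ENNReal.ofReal (2 ^ (|η| / 2)) ^ 2 * (∫⁻ t, k t * u (x + t)) ^ 2 :=
        lintegral_mono h3
    _ = ENNReal.ofReal (2 ^ (|η| / 2)) ^ 2 * ∫⁻ x, (∫⁻ t, k t * u (x + t)) ^ 2 :=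
        lintegral_const_mul' _ _ (ENNReal.pow_ne_top ENNReal.ofReal_ne_top)
    _ ≤ _ := by
        gcongr
        exact lintegral_sq_lintegral_mul_le hk hu

/-- Multipliers with Schwartz symbols preserve the distributions given by weighted `L²` functions. -/
lemma exists_represents_fourierMultiplierCLM (A : 𝓢(Space d, ℂ)) (η : ℝ) :
    ∃ C : ℝ, 0 ≤ C ∧ ∀ (v : 𝓢'(Space d, ℂ)) (F : Space d → ℂ), Represents v F →
      weightedLp η F < ⊤ →
      ∃ G, Represents (TemperedDistribution.fourierMultiplierCLM ℂ A v) G ∧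
        weightedLp η G ≤ ENNReal.ofReal C * weightedLp η F := by
  obtain ⟨C, hC, hb⟩ := exists_weightedNorm_dualMult_le A (-η)
  refine ⟨C, hC, fun v F hF hF' => ?_⟩
  have hbd : ∀ φ : 𝓢(Space d, ℂ), ‖TemperedDistribution.fourierMultiplierCLM ℂ A v φ‖ₑ ≤
      ENNReal.ofReal (C * (weightedLp η F).toReal) * weightedNorm (-η) φ := by
    intro φ
    rw [fourierMultiplierCLM_apply_eq, (hF.2 _).2]
    have h := enorm_integral_mul_le (-η) (dualMult A φ).continuous.aestronglyMeasurable hF.1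
    rw [neg_neg] at h
    refine h.trans ?_
    rw [ENNReal.ofReal_mul hC, ENNReal.ofReal_toReal hF'.ne, mul_right_comm]
    gcongr
    exact hb φ
  obtain ⟨G, hG, hG', hGr⟩ := exists_eq_integral_of_le_weightedNorm
    (L := ((TemperedDistribution.fourierMultiplierCLM ℂ A v : 𝓢'(Space d, ℂ)) :
      𝓢(Space d, ℂ) →ₗ[ℂ] ℂ)) (mul_nonneg hC ENNReal.toReal_nonneg) hbd
  rw [neg_neg, ENNReal.ofReal_mul hC, ENNReal.ofReal_toReal hF'.ne] at hG'
  refine ⟨G, ⟨hG, fun φ => ⟨?_, hGr φ⟩⟩, hG'⟩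
  refine integrable_mul_of_weightedLp (η := -η) φ.continuous.aestronglyMeasurable
    (weightedLp_coe_lt_top _ φ) hG ?_
  rw [neg_neg]
  exact hG'.trans_lt (ENNReal.mul_lt_top ENNReal.ofReal_lt_top hF')

end TransposedMultiplier

lemma represents_schwartz {d : ℕ} (f : 𝓢(Space d, ℂ)) : Represents (f : 𝓢'(Space d, ℂ)) f :=
  ⟨f.continuous.aestronglyMeasurable, fun φ => ⟨integrable_mul_of_weightedLp (η := 0)
    φ.continuous.aestronglyMeasurable (weightedLp_coe_lt_top _ φ)
    f.continuous.aestronglyMeasurable (weightedLp_coe_lt_top _ f), rfl⟩⟩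

lemma Represents.sub {d : ℕ} {u v : 𝓢'(Space d, ℂ)} {F G : Space d → ℂ} (hF : Represents u F)
    (hG : Represents v G) : Represents (u - v) fun x => F x - G x := by
  have h := hF.add (hG.smul (-1))
  have e1 : u - v = u + (-1 : ℂ) • v := by
    ext φ
    simp [sub_eq_add_neg]
  have e2 : (fun x => F x - G x) = F + (-1 : ℂ) • G := by
    ext x
    simp [sub_eq_add_neg]
  rwa [e1, e2]

/-! ### The transposed resolvent on weighted `L²` -/

section TransposedResolvent

variable {d : ℕ} (k : ℝ) (γ : Space d) (τ : ℝ)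

/-- The transpose of the resolvent, applied to a Schwartz function. -/
def dualResolvent (φ : 𝓢(Space d, ℂ)) : Space d → ℂ :=
  𝓕 fun ξ => 𝓕⁻ φ ξ * invSymb k γ τ ξ

/-- A bound `K` for the bilinear form of the resolvent in weighted `L²` spaces. -/
def ResolventBound (η K : ℝ) : Prop :=
  0 ≤ K ∧ ∀ f g : 𝓢(Space d, ℂ), ‖∫ ξ, 𝓕 f ξ * 𝓕 g ξ * invSymb k γ τ ξ‖ₑ ≤
    ENNReal.ofReal K * (weightedNorm η f * weightedNorm η g)

variable {k γ τ}

lemma integrable_schwartz_mul_invSymb (hd : 2 ≤ d) (hk : 0 < k) (hτ : τ ≠ 0) (h : 𝓢(Space d, ℂ)) :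
    Integrable fun ξ => h ξ * invSymb k γ τ ξ := by
  obtain ⟨B, -, hB⟩ := exists_bound_schwartz h
  exact integrable_mul_invSymb k γ τ hd hk hτ h.integrable hB

lemma continuous_dualResolvent (hd : 2 ≤ d) (hk : 0 < k) (hτ : τ ≠ 0) (φ : 𝓢(Space d, ℂ)) :
    Continuous (dualResolvent k γ τ φ) :=
  VectorFourier.fourierIntegral_continuous Real.continuous_fourierChar continuous_inner
    (integrable_schwartz_mul_invSymb hd hk hτ (𝓕⁻ φ))

lemma integrable_mul_dualResolvent (hd : 2 ≤ d) (hk : 0 < k) (hτ : τ ≠ 0)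
    (f φ : 𝓢(Space d, ℂ)) : Integrable fun x => f x * dualResolvent k γ τ φ x := by
  refine f.integrable.mul_bdd (c := ∫ ξ, ‖𝓕⁻ φ ξ * invSymb k γ τ ξ‖)
    (continuous_dualResolvent hd hk hτ φ).aestronglyMeasurable (ae_of_all _ fun x => ?_)
  exact VectorFourier.norm_fourierIntegral_le_integral_norm _ _ _ _ _

/-- The multiplication formula `∫ f 𝓕h = ∫ 𝓕f h`, with `h` merely integrable. -/
lemma integral_mul_dualResolvent (hd : 2 ≤ d) (hk : 0 < k) (hτ : τ ≠ 0) (f φ : 𝓢(Space d, ℂ)) :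
    ∫ x, f x * dualResolvent k γ τ φ x = ∫ ξ, 𝓕 f ξ * 𝓕⁻ φ ξ * invSymb k γ τ ξ := by
  have h := VectorFourier.integral_fourierIntegral_smul_eq_flip (μ := volume) (ν := volume)
    (L := innerₗ (Space d)) Real.continuous_fourierChar continuous_inner f.integrable
    (integrable_schwartz_mul_invSymb (γ := γ) hd hk hτ (𝓕⁻ φ))
  rw [flip_innerₗ] at h
  simp only [smul_eq_mul, ← mul_assoc] at h
  exact h.symm

/-- The bilinear bound makes the pairing with `f` a functional bounded in the norm with weight `η`.
Its Riesz representative lies in the space with weight `-η` and agrees almost everywhere with the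
continuous function at hand, so the transposed resolvent can be paired with any weighted `L²`
function. -/
lemma weightedLp_dualResolvent_le (hd : 2 ≤ d) (hk : 0 < k) (hτ : τ ≠ 0) {η K : ℝ}
    (hK : ResolventBound k γ τ η K) (φ : 𝓢(Space d, ℂ)) :
    weightedLp (-η) (dualResolvent k γ τ φ) ≤ ENNReal.ofReal K * weightedNorm η φ := by
  have hbd : ∀ f : 𝓢(Space d, ℂ), ‖∫ x, f x * dualResolvent k γ τ φ x‖ₑ ≤
      ENNReal.ofReal (K * (weightedNorm η φ).toReal) * weightedNorm η f := by
    intro f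
    rw [integral_mul_dualResolvent hd hk hτ, fourierInv_eq_fourier_reflect]
    refine (hK.2 f (reflect φ)).trans (le_of_eq ?_)
    rw [weightedNorm_reflect, ENNReal.ofReal_mul hK.1,
      ENNReal.ofReal_toReal (weightedNorm_lt_top η φ).ne]
    ring
  let L : 𝓢(Space d, ℂ) →ₗ[ℂ] ℂ :=
    { toFun := fun f => ∫ x, f x * dualResolvent k γ τ φ x
      map_add' := fun f g => by
        simp only [add_apply, add_mul]
        exact integral_add (integrable_mul_dualResolvent hd hk hτ f φ)
          (integrable_mul_dualResolvent hd hk hτ g φ)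
      map_smul' := fun c f => by
        simp only [smul_apply, smul_eq_mul, mul_assoc, RingHom.id_apply]
        exact integral_const_mul _ _ }
  obtain ⟨F, hF, hF', hFr⟩ := exists_eq_integral_of_le_weightedNorm L
    (mul_nonneg hK.1 ENNReal.toReal_nonneg) hbd
  have h : dualResolvent k γ τ φ =ᵐ[volume] F :=
    ae_eq_of_integral_schwartz_mul_eq (fun f => integrable_mul_dualResolvent hd hk hτ f φ)
      (fun f => integrable_mul_of_weightedLp (η := η) f.continuous.aestronglyMeasurable
        (weightedLp_coe_lt_top _ f) hF (hF'.trans_lt ENNReal.ofReal_lt_top)) hFr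
  rw [weightedLp_congr h]
  refine hF'.trans (le_of_eq ?_)
  rw [ENNReal.ofReal_mul hK.1, ENNReal.ofReal_toReal (weightedNorm_lt_top η φ).ne]

/-- The resolvent commutes with multipliers. -/
lemma integral_mul_dualResolvent_dualMult (hd : 2 ≤ d) (hk : 0 < k) (hτ : τ ≠ 0) {η K : ℝ}
    (hK : ResolventBound k γ τ η K) (A : 𝓢(Space d, ℂ)) {v : 𝓢'(Space d, ℂ)} {F G : Space d → ℂ}
    (hF : Represents v F) (hF' : weightedLp η F < ⊤)
    (hG : Represents (TemperedDistribution.fourierMultiplierCLM ℂ A v) G) (φ : 𝓢(Space d, ℂ)) :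
    ∫ x, F x * dualResolvent k γ τ (dualMult A φ) x = ∫ x, G x * dualResolvent k γ τ φ x := by
  have hA : Function.HasTemperateGrowth A := A.hasTemperateGrowth
  obtain ⟨C, hC, hb⟩ := exists_represents_fourierMultiplierCLM A η
  have hG' : weightedLp η G < ⊤ := by
    obtain ⟨G₁, hG₁, hG₁'⟩ := hb v F hF hF'
    rw [weightedLp_congr (hG.ae_eq hG₁)]
    exact hG₁'.trans_lt (ENNReal.mul_lt_top ENNReal.ofReal_lt_top hF')
  have hm : ∀ φ : 𝓢(Space d, ℂ), AEStronglyMeasurable (dualResolvent k γ τ φ) volume := fun φ =>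
    (continuous_dualResolvent hd hk hτ φ).aestronglyMeasurable
  have hfin : ∀ φ : 𝓢(Space d, ℂ), weightedLp (-η) (dualResolvent k γ τ φ) < ⊤ := fun φ =>
    (weightedLp_dualResolvent_le hd hk hτ hK φ).trans_lt
      (ENNReal.mul_lt_top ENNReal.ofReal_lt_top (weightedNorm_lt_top _ _))
  -- For Schwartz `f` both sides are the same integral on the Fourier side; the general case follows
  -- by density, with an error linear in `ε`.
  have hschw : ∀ f : 𝓢(Space d, ℂ), ∫ x, f x * dualResolvent k γ τ (dualMult A φ) x =
      ∫ x, SchwartzMap.fourierMultiplierCLM ℂ A f x * dualResolvent k γ τ φ x := by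
    intro f
    rw [integral_mul_dualResolvent hd hk hτ, integral_mul_dualResolvent hd hk hτ]
    refine integral_congr_ae (ae_of_all _ fun ξ => ?_)
    simp only
    rw [fourierInv_dualMult hA, fourier_fourierMultiplierCLM hA]
    ring
  rw [← sub_eq_zero, ← enorm_eq_zero, ← nonpos_iff_eq_zero]
  set W := weightedLp (-η) (dualResolvent k γ τ φ) with hW
  set W' := weightedLp (-η) (dualResolvent k γ τ (dualMult A φ)) with hW'
  have main : ∀ ε : ℝ, 0 < ε → ‖(∫ x, F x * dualResolvent k γ τ (dualMult A φ) x) -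
      ∫ x, G x * dualResolvent k γ τ φ x‖ₑ ≤ ENNReal.ofReal ε * (W' + ENNReal.ofReal C * W) := by
    intro ε hε
    obtain ⟨f, hf⟩ := exists_schwartz_weightedLp_sub_le hF.1 hF' hε
    have h1 : Represents (TemperedDistribution.fourierMultiplierCLM ℂ A (v - f)) fun x =>
        G x - SchwartzMap.fourierMultiplierCLM ℂ A f x := by
      rw [map_sub, TemperedDistribution.fourierMultiplierCLM_toTemperedDistributionCLM_eq hA]
      exact hG.sub (represents_schwartz _)
    obtain ⟨G₁, hG₁, hG₁'⟩ := hb _ _ (hF.sub (represents_schwartz f))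
      (hf.trans_lt ENNReal.ofReal_lt_top)
    rw [← weightedLp_congr (h1.ae_eq hG₁)] at hG₁'
    have hG₂ := hG₁'.trans (mul_le_mul_right hf _)
    have i1 : ∀ {F : Space d → ℂ} (φ : 𝓢(Space d, ℂ)), AEStronglyMeasurable F volume →
        weightedLp η F < ⊤ → Integrable fun x => F x * dualResolvent k γ τ φ x :=
      fun φ hF hF' => integrable_mul_of_weightedLp hF hF' (hm φ) (hfin φ)
    have e1 : (∫ x, F x * dualResolvent k γ τ (dualMult A φ) x) -
        ∫ x, G x * dualResolvent k γ τ φ x =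
        (∫ x, (F x - f x) * dualResolvent k γ τ (dualMult A φ) x) -
          ∫ x, (G x - SchwartzMap.fourierMultiplierCLM ℂ A f x) * dualResolvent k γ τ φ x := by
      simp only [sub_mul]
      rw [integral_sub (i1 _ hF.1 hF') (integrable_mul_dualResolvent hd hk hτ _ _),
        integral_sub (i1 _ hG.1 hG') (integrable_mul_dualResolvent hd hk hτ _ _), hschw]
      ring
    rw [e1]
    refine enorm_sub_le.trans ?_
    rw [mul_add, ← mul_assoc, mul_comm (ENNReal.ofReal ε) (ENNReal.ofReal C)]
    refine add_le_add ((enorm_integral_mul_le η (hF.sub (represents_schwartz f)).1 (hm _)).trans ?_)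
      ((enorm_integral_mul_le η h1.1 (hm _)).trans ?_)
    · gcongr
    · gcongr
  set B := W' + ENNReal.ofReal C * W with hB
  have hBfin : B ≠ ⊤ := (ENNReal.add_lt_top.2 ⟨hfin _,
    ENNReal.mul_lt_top ENNReal.ofReal_lt_top (hfin _)⟩).ne
  refine ENNReal.le_of_forall_pos_le_add fun δ hδ _ => ?_
  have hB0 : 0 ≤ B.toReal := ENNReal.toReal_nonneg
  have hδ' : 0 < (δ : ℝ) := hδ
  refine (main (δ / (B.toReal + 1)) (by positivity)).trans ?_
  rw [zero_add, ← ENNReal.ofReal_toReal hBfin, ← ENNReal.ofReal_mul (by positivity),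
    ENNReal.toReal_ofReal hB0, ← ENNReal.ofReal_coe_nnreal]
  refine ENNReal.ofReal_le_ofReal ?_
  rw [div_mul_eq_mul_div, div_le_iff₀ (by positivity)]
  nlinarith

end TransposedResolvent
-- Inverses of symbols bounded below
section TemperateInverse

/-- Each derivative of `1/x` is bounded on `(c/2, ∞)`, an open set containing the range of `q`, and
temperate growth is stable under such compositions. -/
lemma hasTemperateGrowth_inv {V : Type*} [NormedAddCommGroup V] [NormedSpace ℝ V] {q : V → ℝ}
    (hq : q.HasTemperateGrowth) {c : ℝ} (hc : 0 < c) (hqc : ∀ x, c ≤ q x) :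
    (fun x => (q x)⁻¹).HasTemperateGrowth := by
  have hopen : IsOpen {x : ℝ | c / 2 < x} := isOpen_lt' _
  have h := Function.HasTemperateGrowth.comp' (g := fun x : ℝ => x⁻¹) (f := q)
    (t := {x : ℝ | c / 2 < x}) ?_ hopen.uniqueDiffOn ?_ ?_ hq
  · exact h
  · rintro - ⟨y, rfl⟩
    exact lt_of_lt_of_le (half_lt_self hc) (hqc y)
  · exact contDiffOn_id.inv fun x hx => (lt_trans (half_pos hc) hx).ne'
  · intro N
    refine ⟨0, ∑ n ∈ Finset.range (N + 1), n.factorial * (c / 2)⁻¹ ^ (n + 1), by positivity,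
      fun n hn x hx => ?_⟩
    have hx0 : c / 2 < x := hx
    have hxp : 0 < x := (half_pos hc).trans hx0
    rw [iteratedFDerivWithin_of_isOpen n hopen hx, norm_iteratedFDeriv_eq_norm_iteratedDeriv,
      iteratedDeriv_eq_iterate, iter_deriv_inv', pow_zero, mul_one]
    calc _ = n.factorial * x⁻¹ ^ (n + 1) := by
          rw [norm_mul, norm_mul, norm_pow, norm_neg, norm_one, one_pow, one_mul,
            Real.norm_of_nonneg (by positivity), Real.norm_of_nonneg (by positivity)]
          congr 1
          rw [inv_pow, ← zpow_natCast, ← zpow_neg]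
          congr 1
          push_cast
          ring
      _ ≤ n.factorial * (c / 2)⁻¹ ^ (n + 1) := by gcongr
      _ ≤ _ := Finset.single_le_sum (f := fun n : ℕ => (n.factorial * (c / 2)⁻¹ ^ (n + 1) : ℝ))
        (fun i _ => by positivity) (Finset.mem_range.2 (by omega))

end TemperateInverse

/-! ### Dyadic symbols and low-frequency cutoffs -/

section Dyadic

variable {d : ℕ} (P : DyadicPair d)

/-- A smooth compactly supported symbol, as a Schwartz function, in the normalisation of Mathlib. -/
lemma exists_schwartz_symbol {a : Space d → ℝ} (ha : ContDiff ℝ ∞ a) {R : ℝ}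
    (hR : ∀ ξ, a ξ ≠ 0 → ‖ξ‖ ≤ R) :
    ∃ A : 𝓢(Space d, ℂ), ∀ ξ, A ξ = (a ((2 * Real.pi) • ξ) : ℂ) := by
  have hs : HasCompactSupport (fun ξ : Space d => (a ((2 * Real.pi) • ξ) : ℂ)) := by
    refine HasCompactSupport.of_support_subset_isCompact
      (isCompact_closedBall (0 : Space d) (R / (2 * Real.pi))) fun ξ hξ => ?_
    have h1 := hR _ (Complex.ofReal_ne_zero.1 hξ)
    rw [norm_smul, Real.norm_of_nonneg (by positivity)] at h1
    rw [mem_closedBall_zero_iff, le_div_iff₀ (by positivity)]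
    linarith
  exact ⟨hs.toSchwartzMap (Complex.ofRealCLM.contDiff.comp (ha.comp (contDiff_const_smul _))),
    fun ξ => rfl⟩

/-- The low-frequency cutoff `χ(2^{-n}·)`. -/
def DyadicPair.low (n : ℕ) (ξ : Space d) : ℝ := P.χ (((2 : ℝ) ^ n)⁻¹ • ξ)

lemma DyadicPair.norm_inv_pow_smul (n : ℕ) (ξ : Space d) :
    ‖((2 : ℝ) ^ n)⁻¹ • ξ‖ = ‖ξ‖ / 2 ^ n := by
  rw [norm_smul, Real.norm_of_nonneg (by positivity)]
  ring

lemma DyadicPair.low_supp {n : ℕ} {ξ : Space d} (h : P.low n ξ ≠ 0) : ‖ξ‖ ≤ 4 / 3 * 2 ^ n := by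
  have h1 := P.χ_supp _ h
  rwa [DyadicPair.norm_inv_pow_smul, div_le_iff₀ (by positivity)] at h1

lemma DyadicPair.low_eq_one {n : ℕ} {ξ : Space d} (h : ‖ξ‖ ≤ 3 / 4 * 2 ^ n) : P.low n ξ = 1 := by
  refine P.χ_eq_one _ ?_
  rwa [DyadicPair.norm_inv_pow_smul, div_le_iff₀ (by positivity)]

lemma DyadicPair.contDiff_low (n : ℕ) : ContDiff ℝ ∞ (P.low n) :=
  P.χ_smooth.comp (contDiff_const_smul _)

lemma DyadicPair.contDiff_symbol (n : ℕ) : ContDiff ℝ ∞ (P.symbol n) := by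
  cases n with
  | zero => exact P.χ_smooth
  | succ n => exact P.φ_smooth.comp (contDiff_const_smul _)

lemma DyadicPair.symbol_succ_supp {n : ℕ} {ξ : Space d} (h : P.symbol (n + 1) ξ ≠ 0) :
    3 / 4 * 2 ^ n ≤ ‖ξ‖ ∧ ‖ξ‖ ≤ 8 / 3 * 2 ^ n := by
  have h1 := P.φ_supp _ h
  rwa [DyadicPair.norm_inv_pow_smul, le_div_iff₀ (by positivity), div_le_iff₀ (by positivity)]
    at h1

lemma DyadicPair.symbol_supp {n : ℕ} {ξ : Space d} (h : P.symbol n ξ ≠ 0) :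
    ‖ξ‖ ≤ 8 / 3 * 2 ^ n := by
  cases n with
  | zero =>
    have := P.χ_supp _ h
    norm_num
    linarith
  | succ n =>
    refine (P.symbol_succ_supp h).2.trans ?_
    gcongr <;> simp

lemma DyadicPair.summable (ξ : Space d) :
    Summable fun n : ℕ => P.φ (((2 : ℝ) ^ n)⁻¹ • ξ) := by
  obtain ⟨N, hN⟩ := pow_unbounded_of_one_lt (4 / 3 * ‖ξ‖) (one_lt_two (α := ℝ))
  refine summable_of_ne_finset_zero (s := Finset.range N) fun n hn => ?_
  by_contra h
  have h1 := (P.symbol_succ_supp (n := n) h).1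
  have h2 : (2 : ℝ) ^ N ≤ 2 ^ n :=
    pow_le_pow_right₀ one_le_two (by simpa using hn)
  linarith

/-- The partition identity at `2^(-n) ξ` and at `2^(-n-1) ξ` involves the same sum up to one term;
subtracting leaves that term. -/
lemma DyadicPair.low_succ (n : ℕ) (ξ : Space d) :
    P.low (n + 1) ξ = P.low n ξ + P.symbol (n + 1) ξ := by
  have h1 := P.sum_eq_one (((2 : ℝ) ^ n)⁻¹ • ξ)
  have h2 := P.sum_eq_one (((2 : ℝ) ^ (n + 1))⁻¹ • ξ)
  rw [(P.summable _).tsum_eq_zero_add] at h1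
  have e : ∀ m : ℕ, ((2 : ℝ) ^ (m + 1))⁻¹ • ((2 : ℝ) ^ n)⁻¹ • ξ =
      ((2 : ℝ) ^ m)⁻¹ • ((2 : ℝ) ^ (n + 1))⁻¹ • ξ := by
    intro m
    rw [smul_smul, smul_smul]
    congr 1
    rw [← mul_inv, ← mul_inv, pow_succ, pow_succ]
    ring
  simp only [e, pow_zero, inv_one, one_smul] at h1
  simp only [DyadicPair.low, DyadicPair.symbol]
  linarith

lemma DyadicPair.low_eq_sum (n : ℕ) (ξ : Space d) :
    P.low n ξ = ∑ i ∈ Finset.range (n + 1), P.symbol i ξ := by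
  induction n with
  | zero => simp [DyadicPair.low, DyadicPair.symbol]
  | succ n ih => rw [P.low_succ, ih, Finset.sum_range_succ _ (n + 1)]

/-- The dyadic symbols as Schwartz functions. -/
def DyadicPair.symS (n : ℕ) : 𝓢(Space d, ℂ) :=
  (exists_schwartz_symbol (P.contDiff_symbol n) fun _ h => P.symbol_supp h).choose

lemma DyadicPair.symS_apply (n : ℕ) (ξ : Space d) :
    P.symS n ξ = (P.symbol n ((2 * Real.pi) • ξ) : ℂ) :=
  (exists_schwartz_symbol (P.contDiff_symbol n) fun _ h => P.symbol_supp h).choose_spec ξ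

/-- The low-frequency cutoffs as Schwartz functions. -/
def DyadicPair.lowS (n : ℕ) : 𝓢(Space d, ℂ) :=
  (exists_schwartz_symbol (P.contDiff_low n) fun _ h => P.low_supp h).choose

lemma DyadicPair.lowS_apply (n : ℕ) (ξ : Space d) :
    P.lowS n ξ = (P.low n ((2 * Real.pi) • ξ) : ℂ) :=
  (exists_schwartz_symbol (P.contDiff_low n) fun _ h => P.low_supp h).choose_spec ξ

lemma DyadicPair.block_eq (n : ℕ) :
    P.block n = TemperedDistribution.fourierMultiplierCLM ℂ (P.symS n) := by
  rw [DyadicPair.block, multiplier]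
  congr 1
  funext ξ
  rw [P.symS_apply]

/-- The low-frequency part of a distribution is the sum of its first blocks. -/
lemma DyadicPair.fourierMultiplierCLM_lowS (n : ℕ) (u : 𝓢'(Space d, ℂ)) :
    TemperedDistribution.fourierMultiplierCLM ℂ (P.lowS n) u =
      ∑ i ∈ Finset.range (n + 1), P.block i u := by
  have h := TemperedDistribution.fourierMultiplierCLM_sum ℂ (s := Finset.range (n + 1))
    (g := fun i => (P.symS i : Space d → ℂ)) fun i _ => (P.symS i).hasTemperateGrowth
  have e : (P.lowS n : Space d → ℂ) = fun ξ => ∑ i ∈ Finset.range (n + 1), P.symS i ξ := by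
    funext ξ
    rw [P.lowS_apply, P.low_eq_sum]
    push_cast
    simp only [P.symS_apply]
  rw [e, h, sum_apply]
  simp only [P.block_eq]

lemma fourierMultiplierCLM_comm {a b : Space d → ℂ} (ha : a.HasTemperateGrowth)
    (hb : b.HasTemperateGrowth) (u : 𝓢'(Space d, ℂ)) :
    TemperedDistribution.fourierMultiplierCLM ℂ a
      (TemperedDistribution.fourierMultiplierCLM ℂ b u) =
    TemperedDistribution.fourierMultiplierCLM ℂ b
      (TemperedDistribution.fourierMultiplierCLM ℂ a u) := by
  rw [TemperedDistribution.fourierMultiplierCLM_fourierMultiplierCLM_apply hb ha,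
    TemperedDistribution.fourierMultiplierCLM_fourierMultiplierCLM_apply ha hb, mul_comm]

/-- The supports are disjoint: `|ξ| ≤ (4/3) 2^n` for the cutoff, against `|ξ| ≥ (3/4) 2^(n+1) =
(3/2) 2^n` for the block. -/
lemma DyadicPair.lowS_block_eq_zero {n l : ℕ} (h : n + 2 ≤ l) (u : 𝓢'(Space d, ℂ)) :
    TemperedDistribution.fourierMultiplierCLM ℂ (P.lowS n) (P.block l u) = 0 := by
  rw [P.block_eq, TemperedDistribution.fourierMultiplierCLM_fourierMultiplierCLM_apply
    (P.symS l).hasTemperateGrowth (P.lowS n).hasTemperateGrowth]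
  have e : (P.symS l : Space d → ℂ) * (P.lowS n : Space d → ℂ) = fun _ => 0 := by
    funext ξ
    obtain ⟨m, rfl⟩ : ∃ m, l = m + 1 := ⟨l - 1, by omega⟩
    rw [Pi.mul_apply, P.symS_apply, P.lowS_apply, ← Complex.ofReal_mul, Complex.ofReal_eq_zero,
      mul_eq_zero]
    by_contra! hc
    have h1 := (P.symbol_succ_supp hc.1).1
    have h2 := P.low_supp hc.2
    have h3 : (2 : ℝ) ^ (n + 1) ≤ 2 ^ m := pow_le_pow_right₀ one_le_two (by omega)
    have h4 : (0 : ℝ) < 2 ^ n := by positivity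
    rw [pow_succ] at h3
    linarith
  rw [e, TemperedDistribution.fourierMultiplierCLM_const]
  simp

/-- The function `χ` is not assumed to take values in `[0,1]`, so a bound is taken from compactness
of its support; rescaling preserves it. -/
lemma DyadicPair.exists_bound_one_sub_low :
    ∃ S : ℝ, 0 < S ∧ ∀ n ξ, |1 - P.low n ξ| ≤ S := by
  have hs : HasCompactSupport P.χ :=
    HasCompactSupport.of_support_subset_isCompact (isCompact_closedBall (0 : Space d) (4 / 3))
      fun ξ hξ => by
        rw [mem_closedBall_zero_iff]
        exact P.χ_supp ξ hξ
  obtain ⟨C, hC⟩ := hs.exists_bound_of_continuous P.χ_smooth.continuous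
  have hC0 : 0 ≤ C := (norm_nonneg _).trans (hC 0)
  refine ⟨1 + C, by linarith, fun n ξ => ?_⟩
  have h1 := hC (((2 : ℝ) ^ n)⁻¹ • ξ)
  calc |1 - P.low n ξ| ≤ |1| + |P.low n ξ| := abs_sub _ _
    _ ≤ 1 + C := by rw [abs_one]; exact add_le_add_right h1 _

end Dyadic

/-! ### The elliptic high-frequency part of the resolvent -/

section HighFrequency

variable {d : ℕ} (P : DyadicPair d) (k : ℝ) (γ : Space d) (τ : ℝ)

/-- The high-frequency part of the symbol of the resolvent. -/
def highSymb (n : ℕ) (ξ : Space d) : ℂ := (1 - P.lowS n ξ) * invSymb k γ τ ξ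

lemma hasTemperateGrowth_symb :
    (fun ξ : Space d => symb k γ τ ((2 * Real.pi) • ξ)).HasTemperateGrowth := by
  have e : (fun ξ : Space d => symb k γ τ ((2 * Real.pi) • ξ)) = fun ξ =>
      (4 * Real.pi ^ 2 : ℂ) * ((‖ξ‖ ^ 2 : ℝ) : ℂ) +
        ((4 * Real.pi * Complex.I) * ((inner ℝ γ ξ : ℝ) : ℂ) -
          (k ^ 2 + ‖γ‖ ^ 2 + Complex.I * τ)) := by
    funext ξ
    rw [symb, norm_smul, inner_smul_right, Real.norm_of_nonneg (by positivity)]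
    push_cast
    ring
  rw [e]
  fun_prop

lemma half_sq_le_norm_symb {ξ : Space d} (h : 2 * radius k γ ^ 2 ≤ ‖ξ‖ ^ 2) :
    ‖ξ‖ ^ 2 / 2 ≤ ‖symb k γ τ ξ‖ := by
  have h1 := norm_sq_sub_le_norm_symb k γ τ ξ
  have h2 := le_abs_self (‖ξ‖ ^ 2 - radius k γ ^ 2)
  linarith

/-- In `1/m = conj m / |m|²` the denominator may vanish at low frequency, where `1 - lowS` is zero
anyway. It is replaced by `|m|² + θ²`, which is bounded below and unchanged where `1 - lowS` may be
nonzero. -/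
lemma hasTemperateGrowth_highSymb {k : ℝ} (hk : 0 < k) {n : ℕ} (hn : 4 * radius k γ ≤ 2 ^ n) :
    (highSymb P k γ τ n).HasTemperateGrowth := by
  have hr := radius_pos hk γ
  have hlow := hasTemperateGrowth_symb k γ τ
  obtain ⟨θ, hθg, hθ1, hθ0⟩ : ∃ θ : Space d → ℝ, θ.HasTemperateGrowth ∧
      (∀ ξ, ‖(2 * Real.pi) • ξ‖ ≤ 3 / 8 * 2 ^ n → θ ξ = 1) ∧
      ∀ ξ, 3 / 4 * 2 ^ n < ‖(2 * Real.pi) • ξ‖ → θ ξ = 0 := by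
    have hg : Function.HasTemperateGrowth (P.lowS n) := (P.lowS n).hasTemperateGrowth
    -- The same cutoff at half the scale: it vanishes for `|2πξ| > (2/3) 2^n`, inside the region
    -- where the cutoff at full scale equals one.
    refine ⟨fun ξ => (P.lowS n ((2 : ℝ) • ξ)).re, ?_, fun ξ hξ => ?_, fun ξ hξ => ?_⟩
    · have h2 : Function.HasTemperateGrowth fun ξ : Space d => (2 : ℝ) • ξ := by fun_prop
      exact (Complex.reCLM.hasTemperateGrowth).comp (hg.comp h2)
    · simp only [P.lowS_apply, Complex.ofReal_re, smul_comm _ (2 : ℝ)]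
      refine P.low_eq_one ?_
      rw [norm_smul, Real.norm_of_nonneg zero_le_two]
      linarith
    · simp only [P.lowS_apply, Complex.ofReal_re, smul_comm _ (2 : ℝ)]
      by_contra hc
      have h3 := P.low_supp hc
      rw [norm_smul, Real.norm_of_nonneg zero_le_two] at h3
      have : (0 : ℝ) < 2 ^ n := by positivity
      linarith
  set q : Space d → ℝ := fun ξ => ‖symb k γ τ ((2 * Real.pi) • ξ)‖ ^ 2 + θ ξ ^ 2 with hq
  have hqg : q.HasTemperateGrowth := by
    have h1 : Function.HasTemperateGrowth
        fun ξ : Space d => ‖symb k γ τ ((2 * Real.pi) • ξ)‖ ^ 2 :=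
      (Function.hasTemperateGrowth_norm_sq (H := ℂ)).comp hlow
    exact h1.add (hθg.pow 2)
  have hqc : ∀ ξ, min 1 (radius k γ ^ 4) ≤ q ξ := by
    intro ξ
    by_cases hξ : ‖(2 * Real.pi) • ξ‖ ≤ 3 / 8 * 2 ^ n
    · refine (min_le_left _ _).trans ?_
      simp only [hq, hθ1 ξ hξ]
      nlinarith [sq_nonneg ‖symb k γ τ ((2 * Real.pi) • ξ)‖]
    · refine (min_le_right _ _).trans ?_
      -- Beyond the set where `θ = 1`, `|2πξ| ≥ (3/8) 2^n ≥ (3/2) R`, hence `|m| ≥ |2πξ|²/2 ≥ R²`.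
      have h1 : 3 / 2 * radius k γ ≤ ‖(2 * Real.pi) • ξ‖ := by linarith
      have h2 : 9 / 4 * radius k γ ^ 2 ≤ ‖(2 * Real.pi) • ξ‖ ^ 2 := by nlinarith
      have h3 := half_sq_le_norm_symb k γ τ (ξ := (2 * Real.pi) • ξ) (by nlinarith)
      have h4 : radius k γ ^ 2 ≤ ‖symb k γ τ ((2 * Real.pi) • ξ)‖ := by nlinarith
      have h5 : (radius k γ ^ 2) ^ 2 ≤ ‖symb k γ τ ((2 * Real.pi) • ξ)‖ ^ 2 := by gcongr
      simp only [hq]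
      nlinarith [sq_nonneg (θ ξ)]
  have hinv := hasTemperateGrowth_inv hqg (lt_min one_pos (by positivity)) hqc
  have e : highSymb P k γ τ n = fun ξ => (1 - P.lowS n ξ) *
      ((starRingEnd ℂ) (symb k γ τ ((2 * Real.pi) • ξ)) * ((q ξ)⁻¹ : ℝ)) := by
    funext ξ
    rw [highSymb]
    by_cases hξ : ‖(2 * Real.pi) • ξ‖ ≤ 3 / 4 * 2 ^ n
    · rw [P.lowS_apply, P.low_eq_one hξ]
      simp
    · congr 1
      simp only [hq, hθ0 ξ (not_le.1 hξ)]
      rw [invSymb, Complex.inv_def, Complex.normSq_eq_norm_sq]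
      simp
  rw [e]
  have hA : Function.HasTemperateGrowth (P.lowS n) := (P.lowS n).hasTemperateGrowth
  have hconj : Function.HasTemperateGrowth
      fun ξ : Space d => (starRingEnd ℂ) (symb k γ τ ((2 * Real.pi) • ξ)) :=
    (Complex.conjCLE.hasTemperateGrowth).comp hlow
  have hinv' : Function.HasTemperateGrowth fun ξ => (((q ξ)⁻¹ : ℝ) : ℂ) :=
    Function.Complex.hasTemperateGrowth_ofReal.comp hinv
  exact ((Function.HasTemperateGrowth.const (1 : ℂ)).sub hA).mul (hconj.mul hinv')

/-- Where `1 - low` is nonzero, `|2πξ| > (3/4) 2^n ≥ 3R`, so `|m| ≥ |2πξ|²/2 ≥ (9/32) 4^n ≥ 4^n /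
4`. -/
lemma norm_highSymb_le {S : ℝ} (hS : ∀ n ξ, |1 - P.low n ξ| ≤ S) {n : ℕ}
    (hn : 4 * radius k γ ≤ 2 ^ n) (ξ : Space d) :
    ‖highSymb P k γ τ n ξ‖ ≤ S * (4 / (2 ^ n) ^ 2) := by
  have hS0 : 0 ≤ S := (abs_nonneg _).trans (hS 0 0)
  have h2n : (0 : ℝ) < 2 ^ n := by positivity
  rw [highSymb, norm_mul, P.lowS_apply, ← Complex.ofReal_one, ← Complex.ofReal_sub,
    Complex.norm_real, Real.norm_eq_abs]
  by_cases hξ : ‖(2 * Real.pi) • ξ‖ ≤ 3 / 4 * 2 ^ n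
  · rw [P.low_eq_one hξ, sub_self, abs_zero, zero_mul]
    positivity
  refine mul_le_mul (hS _ _) ?_ (norm_nonneg _) hS0
  have hr : 0 ≤ radius k γ := Real.sqrt_nonneg _
  have h2 : (9 / 16) * (2 ^ n) ^ 2 ≤ ‖(2 * Real.pi) • ξ‖ ^ 2 := by nlinarith
  have h4 : (4 * radius k γ) ^ 2 ≤ (2 ^ n) ^ 2 := by gcongr
  have h3 := half_sq_le_norm_symb k γ τ (ξ := (2 * Real.pi) • ξ) (by nlinarith)
  rw [invSymb, norm_inv, inv_le_comm₀ (by nlinarith [pow_pos h2n 2]) (by positivity), inv_div]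
  linarith [pow_pos h2n 2]

/-- Splitting the transposed resolvent into low and high frequencies. -/
lemma dualResolvent_eq_add {k τ : ℝ} (hd : 2 ≤ d) (hk : 0 < k) (hτ : τ ≠ 0) {n : ℕ}
    (hn : 4 * radius k γ ≤ 2 ^ n) (φ : 𝓢(Space d, ℂ)) (x : Space d) :
    dualResolvent k γ τ φ x = dualResolvent k γ τ (dualMult (P.lowS n) φ) x +
      dualMult (highSymb P k γ τ n) φ x := by
  have hm := hasTemperateGrowth_highSymb P γ τ hk hn
  have hA : Function.HasTemperateGrowth (P.lowS n) := (P.lowS n).hasTemperateGrowth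
  have i1 := integrable_schwartz_mul_invSymb (γ := γ) hd hk hτ (𝓕⁻ (dualMult (P.lowS n) φ))
  have i2 : Integrable (SchwartzMap.smulLeftCLM ℂ (highSymb P k γ τ n) (𝓕⁻ φ) : Space d → ℂ) :=
    SchwartzMap.integrable _
  have h := VectorFourier.fourierIntegral_add (μ := volume) (L := innerₗ (Space d))
    Real.continuous_fourierChar continuous_inner i1 i2
  have e : (fun ξ => 𝓕⁻ φ ξ * invSymb k γ τ ξ) =
      (fun ξ => 𝓕⁻ (dualMult (P.lowS n) φ) ξ * invSymb k γ τ ξ) +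
        (SchwartzMap.smulLeftCLM ℂ (highSymb P k γ τ n) (𝓕⁻ φ) : Space d → ℂ) := by
    funext ξ
    rw [Pi.add_apply, fourierInv_dualMult hA, SchwartzMap.smulLeftCLM_apply_apply hm, highSymb,
      smul_eq_mul]
    ring
  have h2 := congrFun h x
  rw [← e] at h2
  exact h2

lemma eLpNorm_dualMult_le {a : Space d → ℂ} (ha : a.HasTemperateGrowth) {B : ℝ}
    (hB : ∀ ξ, ‖a ξ‖ ≤ B) (φ : 𝓢(Space d, ℂ)) :
    eLpNorm (dualMult a φ) 2 volume ≤ ENNReal.ofReal B * eLpNorm φ 2 volume := by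
  obtain ⟨ψ, hψ⟩ : ∃ ψ : 𝓢(Space d, ℂ), ψ = 𝓕⁻ φ := ⟨_, rfl⟩
  obtain ⟨χ, hχ⟩ : ∃ χ : 𝓢(Space d, ℂ), χ = SchwartzMap.smulLeftCLM ℂ a ψ := ⟨_, rfl⟩
  have e1 : φ = 𝓕 ψ := by rw [hψ, FourierTransform.fourier_fourierInv_eq]
  have e2 : dualMult a φ = 𝓕 χ := by rw [hχ, hψ, dualMult_apply]
  have h1 : eLpNorm (𝓕 χ : 𝓢(Space d, ℂ)) 2 volume = eLpNorm χ 2 volume := eLpNorm_fourier χ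
  have h2 : eLpNorm (𝓕 ψ : 𝓢(Space d, ℂ)) 2 volume = eLpNorm ψ 2 volume := eLpNorm_fourier ψ
  rw [e2, h1, e1, h2]
  refine eLpNorm_le_mul_eLpNorm_of_ae_le_mul (ae_of_all _ fun ξ => ?_) 2
  rw [hχ, SchwartzMap.smulLeftCLM_apply_apply ha, norm_smul]
  gcongr
  exact hB ξ

end HighFrequency
-- Extending the resolvent to weighted Sobolev spaces
section Extension

variable {d : ℕ} (P : DyadicPair d) {k : ℝ} {γ : Space d} {τ : ℝ}

lemma dualResolvent_add (hd : 2 ≤ d) (hk : 0 < k) (hτ : τ ≠ 0) (φ ψ : 𝓢(Space d, ℂ))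
    (x : Space d) : dualResolvent k γ τ (φ + ψ) x =
      dualResolvent k γ τ φ x + dualResolvent k γ τ ψ x := by
  have h := VectorFourier.fourierIntegral_add (μ := volume) (L := innerₗ (Space d))
    Real.continuous_fourierChar continuous_inner
    (integrable_schwartz_mul_invSymb (γ := γ) hd hk hτ (𝓕⁻ φ))
    (integrable_schwartz_mul_invSymb (γ := γ) hd hk hτ (𝓕⁻ ψ))
  have e : (fun ξ => 𝓕⁻ (φ + ψ) ξ * invSymb k γ τ ξ) =
      (fun ξ => 𝓕⁻ φ ξ * invSymb k γ τ ξ) + fun ξ => 𝓕⁻ ψ ξ * invSymb k γ τ ξ := by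
    funext ξ
    simp only [FourierTransform.fourierInv_add, add_apply, Pi.add_apply]
    ring
  have h2 := congrFun h x
  rw [← e] at h2
  exact h2

lemma dualResolvent_smul (c : ℂ) (φ : 𝓢(Space d, ℂ)) (x : Space d) :
    dualResolvent k γ τ (c • φ) x = c * dualResolvent k γ τ φ x := by
  have h := VectorFourier.fourierIntegral_const_smul Real.fourierChar (volume : Measure (Space d))
    (innerₗ (Space d)) (fun ξ => 𝓕⁻ φ ξ * invSymb k γ τ ξ) c
  have e : (fun ξ => 𝓕⁻ (c • φ) ξ * invSymb k γ τ ξ) =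
      c • fun ξ => 𝓕⁻ φ ξ * invSymb k γ τ ξ := by
    funext ξ
    simp only [FourierTransform.fourierInv_smul, smul_apply, Pi.smul_apply, smul_eq_mul, mul_assoc]
  have h2 := congrFun h x
  rw [← e] at h2
  exact h2

variable (hd : 2 ≤ d) (hk : 0 < k) (hτ : τ ≠ 0) {η K : ℝ} (hK : ResolventBound k γ τ η K)

include hd hk hτ

lemma aestronglyMeasurable_dualResolvent (φ : 𝓢(Space d, ℂ)) :
    AEStronglyMeasurable (dualResolvent k γ τ φ) volume :=
  (continuous_dualResolvent hd hk hτ φ).aestronglyMeasurable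

include hK

lemma weightedLp_dualResolvent_lt_top (φ : 𝓢(Space d, ℂ)) :
    weightedLp (-η) (dualResolvent k γ τ φ) < ⊤ :=
  (weightedLp_dualResolvent_le hd hk hτ hK φ).trans_lt
    (ENNReal.mul_lt_top ENNReal.ofReal_lt_top (weightedNorm_lt_top _ _))

lemma integrable_weighted_mul_dualResolvent {F : Space d → ℂ} (hF : AEStronglyMeasurable F volume)
    (hF' : weightedLp η F < ⊤) (φ : 𝓢(Space d, ℂ)) :
    Integrable fun x => F x * dualResolvent k γ τ φ x :=
  integrable_mul_of_weightedLp hF hF' (aestronglyMeasurable_dualResolvent hd hk hτ φ)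
    (weightedLp_dualResolvent_lt_top hd hk hτ hK φ)

lemma enorm_integral_mul_dualResolvent_le {F : Space d → ℂ} (hF : AEStronglyMeasurable F volume)
    (φ : 𝓢(Space d, ℂ)) : ‖∫ x, F x * dualResolvent k γ τ φ x‖ₑ ≤
      ENNReal.ofReal K * (weightedLp η F * weightedNorm η φ) := by
  refine (enorm_integral_mul_le η hF (aestronglyMeasurable_dualResolvent hd hk hτ φ)).trans ?_
  rw [mul_left_comm]
  gcongr
  exact weightedLp_dualResolvent_le hd hk hτ hK φ

lemma integral_mul_dualResolvent_eq_add {n : ℕ} (hn : 4 * radius k γ ≤ 2 ^ n) {F : Space d → ℂ}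
    (hF : AEStronglyMeasurable F volume) (hF' : weightedLp η F < ⊤) (φ : 𝓢(Space d, ℂ)) :
    ∫ x, F x * dualResolvent k γ τ φ x =
      (∫ x, F x * dualResolvent k γ τ (dualMult (P.lowS n) φ) x) +
        ∫ x, dualMult (highSymb P k γ τ n) φ x * F x := by
  have i2 : Integrable fun x => F x * dualMult (highSymb P k γ τ n) φ x :=
    integrable_mul_of_weightedLp hF hF' (dualMult (highSymb P k γ τ n) φ).continuous.aestronglyMeasurable
      (weightedLp_coe_lt_top _ _)
  simp only [mul_comm (dualMult _ _ _)]
  rw [← integral_add (integrable_weighted_mul_dualResolvent hd hk hτ hK hF hF' _) i2]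
  refine integral_congr_ae (ae_of_all _ fun x => ?_)
  simp only
  rw [dualResolvent_eq_add P γ hd hk hτ hn, mul_add]

/-- If the low frequencies of `v` vanish, commutation removes the low term of the splitting. The
remaining multiplier is bounded on plain `L²`, and for `η ≥ 0` the weights only help. -/
lemma enorm_integral_mul_dualResolvent_le_of_high (hη : 0 ≤ η) {S : ℝ}
    (hS : ∀ n ξ, |1 - P.low n ξ| ≤ S) {n : ℕ} (hn : 4 * radius k γ ≤ 2 ^ n)
    {v : 𝓢'(Space d, ℂ)} {F : Space d → ℂ} (hF : Represents v F) (hF' : weightedLp η F < ⊤)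
    (hv : TemperedDistribution.fourierMultiplierCLM ℂ (P.lowS n) v = 0) (φ : 𝓢(Space d, ℂ)) :
    ‖∫ x, F x * dualResolvent k γ τ φ x‖ₑ ≤
      ENNReal.ofReal (S * (4 / (2 ^ n) ^ 2)) * (weightedLp η F * weightedNorm η φ) := by
  have h0 : Represents (TemperedDistribution.fourierMultiplierCLM ℂ (P.lowS n) v) (0 : Space d → ℂ) := by
    rw [hv]
    exact ⟨aestronglyMeasurable_zero, fun φ => by simp⟩
  rw [integral_mul_dualResolvent_eq_add P hd hk hτ hK hn hF.1 hF',
    integral_mul_dualResolvent_dualMult hd hk hτ hK (P.lowS n) hF hF' h0]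
  simp only [Pi.zero_apply, zero_mul, integral_zero, zero_add]
  have hm := hasTemperateGrowth_highSymb P γ τ hk hn
  have h1 := enorm_integral_mul_le 0
    (dualMult (highSymb P k γ τ n) φ).continuous.aestronglyMeasurable hF.1
  rw [neg_zero] at h1
  have h2 : weightedLp 0 (dualMult (highSymb P k γ τ n) φ) ≤
      ENNReal.ofReal (S * (4 / (2 ^ n) ^ 2)) * weightedNorm η φ := by
    have e : weightedLp 0 (dualMult (highSymb P k γ τ n) φ) =
        eLpNorm (dualMult (highSymb P k γ τ n) φ) 2 volume := by
      simp [weightedLp, bracket]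
    rw [e]
    refine (eLpNorm_dualMult_le hm (norm_highSymb_le P k γ τ hS hn) φ).trans ?_
    gcongr
    exact eLpNorm_le_weightedNorm hη φ
  refine h1.trans ?_
  rw [mul_comm (weightedLp η F), ← mul_assoc]
  exact mul_le_mul' h2 (weightedLp_mono hη F)

/-- A general `u` cannot be integrated against `dualResolvent φ`. Only its low-frequency part,
represented by `G`, is; the rest goes through a multiplier of temperate growth, which acts on all
tempered distributions. -/
lemma exists_resolvent_distribution {n : ℕ} {u : 𝓢'(Space d, ℂ)} {G : Space d → ℂ}
    (hG : AEStronglyMeasurable G volume) (hG' : weightedLp η G < ⊤) :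
    ∃ w : 𝓢'(Space d, ℂ), ∀ φ, w φ = (∫ x, G x * dualResolvent k γ τ φ x) +
      u (dualMult (highSymb P k γ τ n) φ) := by
  let L : 𝓢(Space d, ℂ) →ₗ[ℂ] ℂ :=
    { toFun := fun φ => ∫ x, G x * dualResolvent k γ τ φ x
      map_add' := fun φ ψ => by
        simp only [dualResolvent_add hd hk hτ, mul_add]
        exact integral_add (integrable_weighted_mul_dualResolvent hd hk hτ hK hG hG' φ)
          (integrable_weighted_mul_dualResolvent hd hk hτ hK hG hG' ψ)
      map_smul' := fun c φ => by
        simp only [dualResolvent_smul, smul_eq_mul, RingHom.id_apply, mul_left_comm _ c]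
        exact integral_const_mul _ _ }
  have hL : ∀ φ, ‖L φ‖ₑ ≤ ENNReal.ofReal (K * (weightedLp η G).toReal) * weightedNorm η φ := by
    intro φ
    refine (enorm_integral_mul_dualResolvent_le hd hk hτ hK hG φ).trans (le_of_eq ?_)
    rw [ENNReal.ofReal_mul hK.1, ENNReal.ofReal_toReal hG'.ne, mul_assoc]
  obtain ⟨F, hF, hF', hFr⟩ := exists_eq_integral_of_le_weightedNorm L
    (mul_nonneg hK.1 ENNReal.toReal_nonneg) hL
  obtain ⟨w, hw⟩ := exists_represents hF (hF'.trans_lt ENNReal.ofReal_lt_top)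
  refine ⟨w + TemperedDistribution.fourierMultiplierCLM ℂ (highSymb P k γ τ n) u, fun φ => ?_⟩
  have h1 : w φ = L φ := by rw [(hw.2 φ).2, hFr]
  have h2 : (w + TemperedDistribution.fourierMultiplierCLM ℂ (highSymb P k γ τ n) u) φ =
    w φ + TemperedDistribution.fourierMultiplierCLM ℂ (highSymb P k γ τ n) u φ := rfl
  rw [h2, h1, fourierMultiplierCLM_apply_eq]
  rfl

/-- The blocks of the resolvent are the resolvents of the blocks. -/
lemma block_resolvent_apply {n : ℕ} (hn : 4 * radius k γ ≤ 2 ^ n) {u w : 𝓢'(Space d, ℂ)}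
    {G : Space d → ℂ}
    (hG : Represents (TemperedDistribution.fourierMultiplierCLM ℂ (P.lowS n) u) G)
    (hG' : weightedLp η G < ⊤)
    (hw : ∀ φ, w φ = (∫ x, G x * dualResolvent k γ τ φ x) + u (dualMult (highSymb P k γ τ n) φ))
    {l : ℕ} {F : Space d → ℂ} (hF : Represents (P.block l u) F) (hF' : weightedLp η F < ⊤)
    (φ : 𝓢(Space d, ℂ)) : P.block l w φ = ∫ x, F x * dualResolvent k γ τ φ x := by
  have hA : Function.HasTemperateGrowth (P.symS l) := (P.symS l).hasTemperateGrowth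
  have hB : Function.HasTemperateGrowth (P.lowS n) := (P.lowS n).hasTemperateGrowth
  have hm := hasTemperateGrowth_highSymb P γ τ hk hn
  obtain ⟨C, hC, hb⟩ := exists_represents_fourierMultiplierCLM (P.symS l) η
  -- `G₁` represents both the block of the low-frequency part and the low-frequency part of the
  -- block, so the two commutation identities meet in one integral.
  obtain ⟨G₁, hG₁, -⟩ := hb _ _ hG hG'
  have hG₂ := hG₁
  rw [fourierMultiplierCLM_comm hA hB, ← P.block_eq] at hG₂
  have h1 := integral_mul_dualResolvent_dualMult hd hk hτ hK (P.symS l) hG hG' hG₁ φ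
  have h2 := integral_mul_dualResolvent_dualMult hd hk hτ hK (P.lowS n) hF hF' hG₂ φ
  rw [P.block_eq, fourierMultiplierCLM_apply_eq, hw, h1, ← h2,
    integral_mul_dualResolvent_eq_add P hd hk hτ hK hn hF.1 hF' φ]
  congr 1
  rw [← (hF.2 _).2, P.block_eq, ← fourierMultiplierCLM_apply_eq, ← fourierMultiplierCLM_apply_eq,
    ← fourierMultiplierCLM_apply_eq, fourierMultiplierCLM_comm hA hm]

omit hd hk hτ hK

/-- Riesz representation shows that `w` is a function in the dual weighted space; without this its
norm would be infinite by definition. -/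
lemma weightedL2Norm_le_of_enorm_apply_le {w : 𝓢'(Space d, ℂ)} {B : ℝ} (hB : 0 ≤ B) {N : ℝ≥0∞}
    (hN : N < ⊤) (h : ∀ φ, ‖w φ‖ₑ ≤ ENNReal.ofReal B * (N * weightedNorm η φ)) :
    weightedL2Norm (bracket (-η)) w ≤ ENNReal.ofReal B * N := by
  obtain ⟨F, hF, hF', hFr⟩ := exists_eq_integral_of_le_weightedNorm (η := η)
    (L := (w : 𝓢(Space d, ℂ) →ₗ[ℂ] ℂ)) (C := B * N.toReal)
    (mul_nonneg hB ENNReal.toReal_nonneg) fun φ => by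
      rw [ENNReal.ofReal_mul hB, ENNReal.ofReal_toReal hN.ne, mul_assoc]
      exact h φ
  have hr : Represents w F := ⟨hF, fun φ => ⟨integrable_mul_of_weightedLp (η := η)
    φ.continuous.aestronglyMeasurable (weightedLp_coe_lt_top _ φ) hF
    (hF'.trans_lt ENNReal.ofReal_lt_top), hFr φ⟩⟩
  rw [hr.weightedL2Norm_eq]
  rwa [ENNReal.ofReal_mul hB, ENNReal.ofReal_toReal hN.ne] at hF'

lemma sobolevNorm_le_of_block_le {r r' : ℝ} {ρ ρ' : Space d → ℝ} {u w : 𝓢'(Space d, ℂ)} {c : ℝ≥0∞}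
    (h : ∀ n : ℕ, ENNReal.ofReal ((2 : ℝ) ^ (((n : ℝ) - 1) * r')) *
      weightedL2Norm ρ' (P.block n w) ≤ c * (ENNReal.ofReal ((2 : ℝ) ^ (((n : ℝ) - 1) * r)) *
        weightedL2Norm ρ (P.block n u))) :
    sobolevNorm P r' ρ' w ≤ c * sobolevNorm P r ρ u := by
  have h1 : c = (c ^ 2) ^ (1 / 2 : ℝ) := by
    rw [← ENNReal.rpow_natCast, ← ENNReal.rpow_mul]
    norm_num
  rw [sobolevNorm, sobolevNorm, h1, ← ENNReal.mul_rpow_of_nonneg _ _ (by norm_num),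
    ← ENNReal.tsum_mul_left]
  refine ENNReal.rpow_le_rpow (ENNReal.tsum_le_tsum fun n => ?_) (by norm_num)
  rw [← mul_pow]
  exact pow_le_pow_left' (h n) 2

lemma weightedL2Norm_block_lt_top {r : ℝ} {ρ : Space d → ℝ} {u : 𝓢'(Space d, ℂ)}
    (hu : sobolevNorm P r ρ u < ⊤) (n : ℕ) : weightedL2Norm ρ (P.block n u) < ⊤ := by
  rw [sobolevNorm_lt_top_iff] at hu
  have h1 := (ENNReal.le_tsum n).trans_lt hu
  by_contra hc
  rw [not_lt, top_le_iff] at hc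
  rw [hc, ENNReal.mul_top (by simp; positivity)] at h1
  simp at h1

lemma sobolevNorm_mono_weight {r η η' : ℝ} (h : η ≤ η') (u : 𝓢'(Space d, ℂ)) :
    sobolevNorm P r (bracket η) u ≤ sobolevNorm P r (bracket η') u := by
  have h1 := sobolevNorm_le_of_block_le P (r := r) (r' := r) (ρ := bracket η') (ρ' := bracket η)
    (u := u) (w := u) (c := 1) fun n => by
      rw [one_mul]
      gcongr
      exact iInf₂_mono fun F _ => weightedLp_mono h F
  rwa [one_mul] at h1

lemma exists_represents_lowS {r : ℝ} {u : 𝓢'(Space d, ℂ)} (hu : sobolevNorm P r (bracket η) u < ⊤)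
    (n : ℕ) : ∃ G, Represents (TemperedDistribution.fourierMultiplierCLM ℂ (P.lowS n) u) G ∧
      weightedLp η G < ⊤ := by
  apply exists_represents_of_weightedL2Norm_lt_top
  rw [P.fourierMultiplierCLM_lowS]
  induction n with
  | zero => simpa using weightedL2Norm_block_lt_top P hu 0
  | succ n ih =>
    rw [Finset.sum_range_succ]
    exact (weightedL2Norm_add_le (continuous_bracket η) _ _).trans_lt
      (ENNReal.add_lt_top.2 ⟨ih, weightedL2Norm_block_lt_top P hu _⟩)

include hd hk hτ hK

/-- The resolvent as an operator on a weighted Sobolev space. -/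
lemma exists_resolvent_operator (r : ℝ) {n : ℕ} :
    ∃ T : sobolev P r η →ₗ[ℂ] 𝓢'(Space d, ℂ), ∀ (u : sobolev P r η) (G : Space d → ℂ),
      Represents (TemperedDistribution.fourierMultiplierCLM ℂ (P.lowS n) (u : 𝓢'(Space d, ℂ))) G →
      weightedLp η G < ⊤ → ∀ φ, T u φ = (∫ x, G x * dualResolvent k γ τ φ x) +
        (u : 𝓢'(Space d, ℂ)) (dualMult (highSymb P k γ τ n) φ) := by
  have h1 : ∀ u : sobolev P r η, ∃ w : 𝓢'(Space d, ℂ), ∀ (G : Space d → ℂ),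
      Represents (TemperedDistribution.fourierMultiplierCLM ℂ (P.lowS n) (u : 𝓢'(Space d, ℂ))) G →
      weightedLp η G < ⊤ → ∀ φ, w φ = (∫ x, G x * dualResolvent k γ τ φ x) +
        (u : 𝓢'(Space d, ℂ)) (dualMult (highSymb P k γ τ n) φ) := by
    intro u
    obtain ⟨G, hG, hG'⟩ := exists_represents_lowS P u.2 n
    obtain ⟨w, hw⟩ := exists_resolvent_distribution P hd hk hτ hK (n := n)
      (u := (u : 𝓢'(Space d, ℂ))) hG.1 hG'
    refine ⟨w, fun G₁ hG₁ hG₁' φ => ?_⟩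
    rw [hw]
    congr 1
    refine integral_congr_ae ?_
    filter_upwards [hG.ae_eq hG₁] with x hx
    rw [hx]
  -- The formula holds for every representative `G`, so it determines `T u`; this makes the chosen
  -- map linear.
  choose T hT using h1
  refine ⟨{ toFun := T, map_add' := fun u v => ?_, map_smul' := fun c u => ?_ }, hT⟩
  · ext φ
    obtain ⟨G, hG, hG'⟩ := exists_represents_lowS P u.2 n
    obtain ⟨G₁, hG₁, hG₁'⟩ := exists_represents_lowS P v.2 n
    have h2 := hT (u + v) (G + G₁) (by
      rw [Submodule.coe_add, map_add]
      exact hG.add hG₁) ((weightedLp_add_le η hG.1 hG₁.1).trans_lt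
        (ENNReal.add_lt_top.2 ⟨hG', hG₁'⟩)) φ
    have h3 : (T u + T v) φ = T u φ + T v φ := rfl
    have h4 : ∀ ψ, ((u + v : sobolev P r η) : 𝓢'(Space d, ℂ)) ψ =
        (u : 𝓢'(Space d, ℂ)) ψ + (v : 𝓢'(Space d, ℂ)) ψ := fun _ => rfl
    rw [h2, h3, hT u G hG hG', hT v G₁ hG₁ hG₁', h4]
    simp only [Pi.add_apply, add_mul]
    rw [integral_add (integrable_weighted_mul_dualResolvent hd hk hτ hK hG.1 hG' φ)
      (integrable_weighted_mul_dualResolvent hd hk hτ hK hG₁.1 hG₁' φ)]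
    ring
  · ext φ
    obtain ⟨G, hG, hG'⟩ := exists_represents_lowS P u.2 n
    have h2 := hT (c • u) (c • G) (by
      rw [Submodule.coe_smul, map_smul]
      exact hG.smul c) (by
        have e : weightedLp η (c • G) = ‖c‖ₑ * weightedLp η G := by
          rw [weightedLp, weightedLp, ← eLpNorm_const_smul]
          congr 1
          funext x
          simp only [Pi.smul_apply, smul_eq_mul]
          ring
        rw [e]
        exact ENNReal.mul_lt_top enorm_lt_top hG') φ
    have h3 : (c • T u) φ = c * T u φ := rfl
    have h4 : ∀ ψ, ((c • u : sobolev P r η) : 𝓢'(Space d, ℂ)) ψ =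
        c * (u : 𝓢'(Space d, ℂ)) ψ := fun _ => rfl
    rw [RingHom.id_apply, h2, h3, hT u G hG hG', h4]
    simp only [Pi.smul_apply, smul_eq_mul, mul_assoc]
    rw [integral_const_mul]
    ring

end Extension

/-! ### Summing the blocks: the Sobolev estimate -/

section Bound

variable {d : ℕ} (P : DyadicPair d)

/-- With the shifted index, block `l = n + 2` lives at frequency `2^(l-1) = 2 * 2^n < 8R`, and `8^s
≤ 64`. Blocks `0` and `1` are always of low type, the hypothesis being vacuous for them. -/
lemma two_rpow_mul_low_le {R s : ℝ} (hR : 0 < R) (hs : s ∈ Icc (0 : ℝ) 2) {l : ℕ}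
    (hl : ∀ n, l = n + 2 → (2 : ℝ) ^ n < 4 * R) :
    (2 : ℝ) ^ (((l : ℝ) - 1) * s) ≤ 64 * (1 + R) ^ s := by
  have h1 : (2 : ℝ) ^ ((l : ℝ) - 1) ≤ 8 * (1 + R) := by
    rcases l with _ | _ | n
    · calc (2 : ℝ) ^ (((0 : ℕ) : ℝ) - 1) ≤ 2 ^ (0 : ℝ) :=
            Real.rpow_le_rpow_of_exponent_le one_le_two (by simp)
        _ ≤ _ := by rw [Real.rpow_zero]; linarith
    · simp
      linarith
    · have h2 := hl n rfl
      have e : (2 : ℝ) ^ (((n + 1 + 1 : ℕ) : ℝ) - 1) = 2 ^ n * 2 := by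
        rw [← pow_succ, ← Real.rpow_natCast]
        congr 1
        push_cast
        ring
      rw [e]
      linarith
  calc (2 : ℝ) ^ (((l : ℝ) - 1) * s) = ((2 : ℝ) ^ ((l : ℝ) - 1)) ^ s := Real.rpow_mul (by norm_num) _ _
    _ ≤ (8 * (1 + R)) ^ s := Real.rpow_le_rpow (by positivity) h1 hs.1
    _ = 8 ^ s * (1 + R) ^ s := Real.mul_rpow (by norm_num) (by linarith)
    _ ≤ 8 ^ (2 : ℝ) * (1 + R) ^ s := by
        gcongr
        · norm_num
        · exact hs.2
    _ = _ := by norm_num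

/-- With `X = 2^(l-1) = 2 * 2^n ≥ 1 + R`, the left side is `16 X^(s-2)`, which decreases in `X`
because `s ≤ 2`. -/
lemma two_rpow_mul_high_le {R s : ℝ} (hR : 0 < R) (hs : s ∈ Icc (0 : ℝ) 2) {n : ℕ}
    (hn : 4 * R ≤ 2 ^ n) :
    (2 : ℝ) ^ ((((n + 2 : ℕ) : ℝ) - 1) * s) * (4 / (2 ^ n) ^ 2) ≤
      16 * ((1 + R) ^ s / (1 + R) ^ 2) := by
  have e : (2 : ℝ) ^ (((n + 2 : ℕ) : ℝ) - 1) = 2 * 2 ^ n := by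
    rw [← pow_succ', ← Real.rpow_natCast]
    congr 1
    push_cast
    ring
  set X : ℝ := 2 * 2 ^ n with hX
  have h1 : (1 : ℝ) ≤ 2 ^ n := one_le_pow₀ one_le_two
  have hXR : 1 + R ≤ X := by linarith
  have hXpos : 0 < X := by positivity
  have e2 : 4 / ((2 : ℝ) ^ n) ^ 2 = 16 / X ^ 2 := by
    rw [hX]
    field_simp
    norm_num
  rw [Real.rpow_mul (by norm_num), e, e2]
  have h3 : ∀ Y : ℝ, 0 < Y → Y ^ s / Y ^ 2 = Y ^ (s - 2) := fun Y hY => by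
    rw [Real.rpow_sub hY, Real.rpow_two]
  rw [h3 _ (by linarith)]
  calc X ^ s * (16 / X ^ 2) = 16 * (X ^ s / X ^ 2) := by ring
    _ = 16 * X ^ (s - 2) := by rw [h3 _ hXpos]
    _ ≤ _ := mul_le_mul_of_nonneg_left (Real.rpow_le_rpow_of_nonpos (by linarith) hXR
        (show s - 2 ≤ 0 by linarith [hs.2])) (by norm_num)

/-- The resolvent estimate in weighted Sobolev spaces. -/
theorem exists_resolvent_operator_bound (hd : 2 ≤ d) (r s : ℝ) (hs : s ∈ Icc (0 : ℝ) 2) {η : ℝ}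
    (hη : 1 / 2 < η) :
    ∃ C : ℝ, 0 < C ∧ ∀ (k : ℝ) (γ : Space d) (τ ε₀ : ℝ), 0 < k → τ ≠ 0 → 0 < ε₀ →
      ε₀ < min (radius k γ / 4) 1 →
      ∃ T : sobolev P r η →ₗ[ℂ] 𝓢'(Space d, ℂ),
        (∀ (u : sobolev P r η),
          sobolevNorm P (r + s) (bracket (-η)) (T u) ≤
            ENNReal.ofReal (C * ((1 + radius k γ) ^ s / (ε₀ * radius k γ))) *
              sobolevNorm P r (bracket η) (u : 𝓢'(Space d, ℂ))) ∧
        ∀ (f : 𝓢(Space d, ℂ)) (hf : (f : 𝓢'(Space d, ℂ)) ∈ sobolev P r η) (φ : 𝓢(Space d, ℂ)),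
          T ⟨f, hf⟩ φ = ∫ x, f x * dualResolvent k γ τ φ x := by
  obtain ⟨C₀, hC₀, hcore⟩ := exists_enorm_integral_invSymb_le hd hη
  obtain ⟨S, hSpos, hS⟩ := P.exists_bound_one_sub_low
  refine ⟨128 * C₀ + 16 * S, by positivity, fun k γ τ ε₀ hk hτ hε hε' => ?_⟩
  set R := radius k γ with hR
  have hRpos : 0 < R := radius_pos hk γ
  obtain ⟨hε1, hε2⟩ := lt_min_iff.1 hε'
  set K : ℝ := C₀ * (1 / R + 1 / R ^ 2) with hKdef
  have hK : ResolventBound k γ τ η K := ⟨by positivity, hcore k γ τ hk hτ⟩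
  -- This level serves only to define the operator and does not enter the bound; high blocks are
  -- estimated with a cutoff adapted to each of them.
  obtain ⟨n, hn⟩ := pow_unbounded_of_one_lt (4 * R) (one_lt_two (α := ℝ))
  -- From `ε₀ < 1` comes `1/R ≤ 1/(ε₀ R)`, and from `ε₀ < R/4` comes `1/R² ≤ 1/(ε₀ R)`.
  have hKle : K ≤ 2 * C₀ / (ε₀ * R) := by
    have h1 : 1 / R ≤ 1 / (ε₀ * R) := by
      apply one_div_le_one_div_of_le (by positivity)
      nlinarith
    have h2 : 1 / R ^ 2 ≤ 1 / (ε₀ * R) := by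
      apply one_div_le_one_div_of_le (by positivity)
      nlinarith
    calc K ≤ C₀ * (1 / (ε₀ * R) + 1 / (ε₀ * R)) := by rw [hKdef]; gcongr
      _ = _ := by ring
  obtain ⟨T, hT⟩ := exists_resolvent_operator P hd hk hτ hK r (n := n)
  refine ⟨T, fun u => ?_, fun f hf φ => ?_⟩
  · obtain ⟨G, hG, hG'⟩ := exists_represents_lowS P u.2 n
    refine sobolevNorm_le_of_block_le P fun l => ?_
    obtain ⟨F, hF, hF'⟩ :=
      exists_represents_of_weightedL2Norm_lt_top (weightedL2Norm_block_lt_top P u.2 l)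
    have hblock := block_resolvent_apply P hd hk hτ hK hn.le hG hG' (hT u G hG hG') hF hF'
    have key : ∃ B : ℝ, 0 ≤ B ∧ (2 : ℝ) ^ (((l : ℝ) - 1) * s) * B ≤
        (128 * C₀ + 16 * S) * ((1 + R) ^ s / (ε₀ * R)) ∧
        ∀ φ, ‖P.block l (T u) φ‖ₑ ≤ ENNReal.ofReal B * (weightedLp η F * weightedNorm η φ) := by
      -- Either the frequency of the block is comparable to at most `1 + R`, or `l = m + 2` with
      -- `2^m ≥ 4R` and the block is annihilated by the cutoff at level `m`.
      by_cases hl : ∀ n, l = n + 2 → (2 : ℝ) ^ n < 4 * R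
      · refine ⟨K, hK.1, ?_, fun φ => ?_⟩
        · calc _ ≤ 64 * (1 + R) ^ s * (2 * C₀ / (ε₀ * R)) :=
                mul_le_mul (two_rpow_mul_low_le hRpos hs hl) hKle hK.1 (by positivity)
            _ = 128 * C₀ * ((1 + R) ^ s / (ε₀ * R)) := by ring
            _ ≤ _ := by
                gcongr
                linarith
        · rw [hblock]
          exact enorm_integral_mul_dualResolvent_le hd hk hτ hK hF.1 φ
      · push Not at hl
        obtain ⟨m, rfl, hm⟩ := hl
        refine ⟨S * (4 / (2 ^ m) ^ 2), by positivity, ?_, fun φ => ?_⟩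
        · calc _ = S * ((2 : ℝ) ^ ((((m + 2 : ℕ) : ℝ) - 1) * s) * (4 / (2 ^ m) ^ 2)) := by ring
            _ ≤ S * (16 * ((1 + R) ^ s / (1 + R) ^ 2)) :=
                mul_le_mul_of_nonneg_left (two_rpow_mul_high_le hRpos hs hm) hSpos.le
            _ ≤ S * (16 * ((1 + R) ^ s / (ε₀ * R))) := by
                gcongr
                nlinarith
            _ = 16 * S * ((1 + R) ^ s / (ε₀ * R)) := by ring
            _ ≤ _ := by
                gcongr
                linarith
        · rw [hblock]
          exact enorm_integral_mul_dualResolvent_le_of_high P hd hk hτ hK (by linarith) hS hm hF hF'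
            (P.lowS_block_eq_zero le_rfl _) φ
    obtain ⟨B, hB0, hB, hBφ⟩ := key
    have h1 := weightedL2Norm_le_of_enorm_apply_le hB0 hF' hBφ
    rw [← hF.weightedL2Norm_eq] at h1
    rw [← mul_assoc]
    calc _ ≤ ENNReal.ofReal (2 ^ (((l : ℝ) - 1) * (r + s))) *
          (ENNReal.ofReal B * weightedL2Norm (bracket η) (P.block l u)) := by gcongr
      _ = ENNReal.ofReal (2 ^ (((l : ℝ) - 1) * s) * B * 2 ^ (((l : ℝ) - 1) * r)) *
          weightedL2Norm (bracket η) (P.block l u) := by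
          rw [← mul_assoc, ← ENNReal.ofReal_mul (by positivity), mul_add,
            Real.rpow_add (by norm_num)]
          congr 2
          ring
      _ ≤ _ := by
          rw [ENNReal.ofReal_mul (by positivity)]
          gcongr
  · have hA : Function.HasTemperateGrowth (P.lowS n) := (P.lowS n).hasTemperateGrowth
    have h1 : Represents (TemperedDistribution.fourierMultiplierCLM ℂ (P.lowS n)
        (f : 𝓢'(Space d, ℂ))) (SchwartzMap.fourierMultiplierCLM ℂ (P.lowS n) f) := by
      rw [TemperedDistribution.fourierMultiplierCLM_toTemperedDistributionCLM_eq hA]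
      exact represents_schwartz _
    rw [hT ⟨f, hf⟩ _ h1 (weightedLp_coe_lt_top _ _), integral_mul_dualResolvent_eq_add P hd hk hτ hK
      hn.le f.continuous.aestronglyMeasurable (weightedLp_coe_lt_top _ _) φ,
      integral_mul_dualResolvent_dualMult hd hk hτ hK (P.lowS n) (represents_schwartz f)
        (weightedLp_coe_lt_top _ _) h1]
    rfl

end Bound

/-! ### Schwartz functions belong to every weighted Sobolev space -/

section SchwartzInSobolev

variable {d : ℕ} (P : DyadicPair d)

lemma DyadicPair.symS_succ_apply (n : ℕ) (ξ : Space d) :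
    P.symS (n + 1) ξ = P.symS 1 (((2 : ℝ) ^ n)⁻¹ • ξ) := by
  rw [P.symS_apply, P.symS_apply, smul_comm]
  simp [DyadicPair.symbol]

/-- All these symbols are dilates of one Schwartz function by factors `2^(-n) ≤ 1`, which can only
shrink derivatives. -/
lemma DyadicPair.norm_iteratedFDeriv_symS_succ_le (j : ℕ) :
    ∃ C : ℝ, 0 ≤ C ∧ ∀ n ξ, ‖iteratedFDeriv ℝ j (P.symS (n + 1)) ξ‖ ≤ C := by
  refine ⟨SchwartzMap.seminorm ℝ 0 j (P.symS 1), apply_nonneg _ _, fun n ξ => ?_⟩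
  have e : (P.symS (n + 1) : Space d → ℂ) = fun ξ => P.symS 1 (((2 : ℝ) ^ n)⁻¹ • ξ) := by
    funext ξ
    exact P.symS_succ_apply n ξ
  have h1 := (P.symS 1).norm_iteratedFDeriv_le_seminorm ℝ j (((2 : ℝ) ^ n)⁻¹ • ξ)
  rw [e, iteratedFDeriv_comp_const_smul _ ((P.symS 1).smooth j)]
  rw [norm_smul, norm_pow]
  refine (mul_le_of_le_one_left (norm_nonneg _) (pow_le_one₀ (norm_nonneg _) ?_)).trans h1
  rw [Real.norm_of_nonneg (by positivity)]
  exact inv_le_one_of_one_le₀ (one_le_pow₀ one_le_two)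

/-- The dyadic pieces of a Schwartz function decay rapidly. -/
lemma DyadicPair.exists_seminorm_symS_mul_le (h : 𝓢(Space d, ℂ)) (p i N : ℕ) :
    ∃ C : ℝ, 0 ≤ C ∧ ∀ n, SchwartzMap.seminorm ℝ p i
      (SchwartzMap.smulLeftCLM ℂ (P.symS (n + 1)) h) ≤ C * (((2 : ℝ) ^ n)⁻¹) ^ N := by
  choose C hC hCb using P.norm_iteratedFDeriv_symS_succ_le
  set D : ℝ := ∑ j ∈ Finset.range (i + 1), (i.choose j : ℝ) * C j *
    ((8 * Real.pi / 3) ^ N * SchwartzMap.seminorm ℝ (p + N) (i - j) h) with hD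
  have hD0 : 0 ≤ D := Finset.sum_nonneg fun j _ => mul_nonneg (mul_nonneg (by positivity) (hC j))
    (mul_nonneg (by positivity) (apply_nonneg _ _))
  refine ⟨D, hD0, fun n => SchwartzMap.seminorm_le_bound ℝ p i _ (by positivity) fun ξ => ?_⟩
  have e : (SchwartzMap.smulLeftCLM ℂ (P.symS (n + 1)) h : Space d → ℂ) =
      fun ξ => P.symS (n + 1) ξ * h ξ := by
    funext ξ
    rw [SchwartzMap.smulLeftCLM_apply_apply (P.symS (n + 1)).hasTemperateGrowth, smul_eq_mul]
  by_cases hξ : ‖(2 * Real.pi) • ξ‖ < 3 / 4 * 2 ^ n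
  · have h0 : iteratedFDeriv ℝ i (SchwartzMap.smulLeftCLM ℂ (P.symS (n + 1)) h) ξ = 0 := by
      by_contra hc
      have h1 : ξ ∈ tsupport (SchwartzMap.smulLeftCLM ℂ (P.symS (n + 1)) h) :=
        support_iteratedFDeriv_subset i hc
      have hcl : IsClosed {ξ : Space d | 3 / 4 * 2 ^ n ≤ ‖(2 * Real.pi) • ξ‖} :=
        isClosed_le continuous_const (by fun_prop)
      have h2 : tsupport (SchwartzMap.smulLeftCLM ℂ (P.symS (n + 1)) h) ⊆
          {ξ : Space d | 3 / 4 * 2 ^ n ≤ ‖(2 * Real.pi) • ξ‖} := by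
        refine closure_minimal (fun ζ hζ => ?_) hcl
        rw [Function.mem_support, e] at hζ
        have h3 := left_ne_zero_of_mul hζ
        rw [P.symS_apply, Complex.ofReal_ne_zero] at h3
        exact (P.symbol_succ_supp h3).1
      exact absurd (h2 h1) (not_le.2 hξ)
    rw [h0, norm_zero, mul_zero]
    positivity
  rw [not_lt, norm_smul, Real.norm_of_nonneg (by positivity)] at hξ
  -- In this range `2^n ≤ (8π/3) |ξ|`, so each factor `2^(-n)` is bought with one power of `|ξ|`.
  have hl : 1 ≤ (8 * Real.pi / 3) ^ N * ‖ξ‖ ^ N * (((2 : ℝ) ^ n)⁻¹) ^ N := by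
    rw [← mul_pow, ← mul_pow]
    refine one_le_pow₀ ?_
    rw [← div_eq_mul_inv, le_div_iff₀ (by positivity)]
    linarith
  rw [e]
  have hleib := norm_iteratedFDeriv_mul_le (𝕜 := ℝ) (n := i) ((P.symS (n + 1)).smooth i)
    (h.smooth i) ξ le_rfl
  calc _ ≤ ‖ξ‖ ^ p * ∑ j ∈ Finset.range (i + 1), (i.choose j : ℝ) *
        ‖iteratedFDeriv ℝ j (P.symS (n + 1)) ξ‖ * ‖iteratedFDeriv ℝ (i - j) h ξ‖ := by gcongr
    _ ≤ (∑ j ∈ Finset.range (i + 1), (i.choose j : ℝ) * C j *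
        (‖ξ‖ ^ p * ‖iteratedFDeriv ℝ (i - j) h ξ‖)) * 1 := by
        rw [Finset.mul_sum, mul_one]
        refine Finset.sum_le_sum fun j _ => ?_
        calc _ = (i.choose j : ℝ) * ‖iteratedFDeriv ℝ j (P.symS (n + 1)) ξ‖ *
              (‖ξ‖ ^ p * ‖iteratedFDeriv ℝ (i - j) h ξ‖) := by ring
          _ ≤ _ := by
            gcongr
            exact hCb j n ξ
    _ ≤ (∑ j ∈ Finset.range (i + 1), (i.choose j : ℝ) * C j *
        (‖ξ‖ ^ p * ‖iteratedFDeriv ℝ (i - j) h ξ‖)) *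
        ((8 * Real.pi / 3) ^ N * ‖ξ‖ ^ N * (((2 : ℝ) ^ n)⁻¹) ^ N) := by
        gcongr
        exact Finset.sum_nonneg fun j _ => mul_nonneg (mul_nonneg (by positivity) (hC j))
          (by positivity)
    _ = (∑ j ∈ Finset.range (i + 1), (i.choose j : ℝ) * C j *
        ((8 * Real.pi / 3) ^ N * (‖ξ‖ ^ (p + N) * ‖iteratedFDeriv ℝ (i - j) h ξ‖))) *
        (((2 : ℝ) ^ n)⁻¹) ^ N := by
        rw [← mul_assoc, Finset.sum_mul]
        congr 1
        refine Finset.sum_congr rfl fun j _ => ?_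
        rw [pow_add]
        ring
    _ ≤ _ := by
        rw [hD]
        gcongr with j hj
        · exact mul_nonneg (by positivity) (hC j)
        · exact h.le_seminorm ℝ (p + N) (i - j) ξ

lemma DyadicPair.block_coe (n : ℕ) (f : 𝓢(Space d, ℂ)) : P.block n (f : 𝓢'(Space d, ℂ)) =
    (𝓕⁻ (SchwartzMap.smulLeftCLM ℂ (P.symS n) (𝓕 f)) : 𝓢(Space d, ℂ)) := by
  rw [P.block_eq, TemperedDistribution.fourierMultiplierCLM_toTemperedDistributionCLM_eq
    (P.symS n).hasTemperateGrowth]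
  rfl

/-- The map `h ↦ ⟨x⟩^η 𝓕⁻ h` from Schwartz space to `L²` is continuous, hence controlled by finitely
many seminorms. -/
lemma exists_weightedNorm_fourierInv_le (η : ℝ) : ∃ (s : Finset (ℕ × ℕ)) (C : ℝ), 0 ≤ C ∧
    ∀ (h : 𝓢(Space d, ℂ)) (B : ℝ), 0 ≤ B → (∀ p ∈ s, SchwartzMap.seminorm ℝ p.1 p.2 h ≤ B) →
      weightedNorm η (𝓕⁻ h : 𝓢(Space d, ℂ)) ≤ ENNReal.ofReal (C * B) := by
  let L : 𝓢(Space d, ℂ) →L[ℂ] Lp ℂ 2 (volume : Measure (Space d)) :=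
    SchwartzMap.toLpCLM ℂ ℂ 2 volume ∘L weight η ∘L
      FourierTransform.fourierInvCLM ℂ 𝓢(Space d, ℂ)
  let q : Seminorm ℝ 𝓢(Space d, ℂ) :=
    (normSeminorm ℝ (Lp ℂ 2 (volume : Measure (Space d)))).comp
      ((L.restrictScalars ℝ : 𝓢(Space d, ℂ) →L[ℝ] Lp ℂ 2 (volume : Measure (Space d))) :
        𝓢(Space d, ℂ) →ₗ[ℝ] Lp ℂ 2 (volume : Measure (Space d)))
  have hq : Continuous q := continuous_norm.comp L.continuous
  obtain ⟨s, C, -, hC⟩ := Seminorm.bound_of_continuous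
    (schwartz_withSeminorms ℝ (Space d) ℂ) q hq
  refine ⟨s, C, C.2, fun h B hB hs => ?_⟩
  have h1 : q h ≤ C * B := by
    refine (hC h).trans ?_
    rw [smul_apply, NNReal.smul_def, smul_eq_mul]
    refine mul_le_mul_of_nonneg_left ?_ C.2
    exact Seminorm.finset_sup_apply_le hB fun p hp => hs p hp
  have h2 : q h = (weightedNorm η (𝓕⁻ h : 𝓢(Space d, ℂ))).toReal := by
    rw [weightedNorm_eq]
    exact SchwartzMap.norm_toLp
  rw [h2] at h1
  rw [← ENNReal.ofReal_toReal (weightedNorm_lt_top η _).ne]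
  exact ENNReal.ofReal_le_ofReal h1

lemma coe_mem_sobolev (r η : ℝ) (f : 𝓢(Space d, ℂ)) :
    (f : 𝓢'(Space d, ℂ)) ∈ sobolev P r η := by
  change sobolevNorm P r (bracket η) (f : 𝓢'(Space d, ℂ)) < ⊤
  rw [sobolevNorm_lt_top_iff]
  have hW : ∀ n, weightedL2Norm (bracket η) (P.block n (f : 𝓢'(Space d, ℂ))) =
      weightedNorm η (𝓕⁻ (SchwartzMap.smulLeftCLM ℂ (P.symS n) (𝓕 f)) : 𝓢(Space d, ℂ)) := by
    intro n
    rw [P.block_coe, (represents_schwartz _).weightedL2Norm_eq, weightedLp_coe]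
  obtain ⟨s, C, hC, hb⟩ := exists_weightedNorm_fourierInv_le (d := d) η
  -- One power more than `r` leaves `2^(nr - nN) ≤ 2^(-n)`, so the squares form a geometric series
  -- of ratio `1/4`.
  obtain ⟨N, hN⟩ := exists_nat_ge (r + 1)
  choose D hD hDb using fun p : ℕ × ℕ => P.exists_seminorm_symS_mul_le (𝓕 f) p.1 p.2 N
  have hD1 : 0 ≤ ∑ p ∈ s, D p := Finset.sum_nonneg fun p _ => hD p
  have hb' : ∀ n, weightedNorm η
      (𝓕⁻ (SchwartzMap.smulLeftCLM ℂ (P.symS (n + 1)) (𝓕 f)) : 𝓢(Space d, ℂ)) ≤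
      ENNReal.ofReal (C * ((∑ p ∈ s, D p) * (((2 : ℝ) ^ n)⁻¹) ^ N)) := by
    intro n
    refine hb _ _ (by positivity) fun p hp => (hDb p n).trans ?_
    gcongr
    exact Finset.single_le_sum (fun p _ => hD p) hp
  set E : ℝ := C * ∑ p ∈ s, D p with hE
  have hE0 : 0 ≤ E := mul_nonneg hC hD1
  have hterm : ∀ n : ℕ, (ENNReal.ofReal ((2 : ℝ) ^ ((((n + 1 : ℕ) : ℝ) - 1) * r)) *
      weightedL2Norm (bracket η) (P.block (n + 1) (f : 𝓢'(Space d, ℂ)))) ^ 2 ≤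
      ENNReal.ofReal (E ^ 2 * (1 / 4 : ℝ) ^ n) := by
    intro n
    have h1 : (2 : ℝ) ^ ((((n + 1 : ℕ) : ℝ) - 1) * r) * (C * ((∑ p ∈ s, D p) *
        (((2 : ℝ) ^ n)⁻¹) ^ N)) ≤ E * (1 / 2) ^ n := by
      have e1 : (((n + 1 : ℕ) : ℝ) - 1) * r = n * r := by
        push_cast
        ring
      have e2 : (((2 : ℝ) ^ n)⁻¹) ^ N = (2 : ℝ) ^ (-(n * N : ℝ)) := by
        rw [Real.rpow_neg (by norm_num), inv_pow, ← pow_mul, ← Real.rpow_natCast]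
        push_cast
        rfl
      have e3 : (1 / 2 : ℝ) ^ n = (2 : ℝ) ^ (-(n : ℝ)) := by
        rw [Real.rpow_neg (by norm_num), Real.rpow_natCast, one_div, inv_pow]
      rw [e1, e2, e3, hE]
      calc _ = C * (∑ p ∈ s, D p) * ((2 : ℝ) ^ ((n : ℝ) * r) * (2 : ℝ) ^ (-(n * N : ℝ))) := by ring
        _ = C * (∑ p ∈ s, D p) * (2 : ℝ) ^ ((n : ℝ) * r + -(n * N : ℝ)) := by
            rw [← Real.rpow_add (by norm_num)]
        _ ≤ _ := by
            gcongr
            · norm_num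
            · have : (0 : ℝ) ≤ n := Nat.cast_nonneg n
              nlinarith
    calc _ ≤ (ENNReal.ofReal (E * (1 / 2) ^ n)) ^ 2 := by
          refine pow_le_pow_left' ?_ 2
          rw [hW]
          refine (mul_le_mul_right (hb' n) _).trans ?_
          rw [← ENNReal.ofReal_mul (by positivity)]
          exact ENNReal.ofReal_le_ofReal h1
      _ = _ := by
          rw [← ENNReal.ofReal_pow (by positivity)]
          congr 1
          rw [mul_pow, ← pow_mul, mul_comm n 2, pow_mul]
          norm_num
  rw [tsum_eq_zero_add' ENNReal.summable]
  refine ENNReal.add_lt_top.2 ⟨?_, ?_⟩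
  · rw [hW]
    exact ENNReal.pow_lt_top (ENNReal.mul_lt_top ENNReal.ofReal_lt_top (weightedNorm_lt_top _ _))
  · refine (ENNReal.tsum_le_tsum hterm).trans_lt (Summable.tsum_ofReal_lt_top ?_)
    exact (summable_geometric_of_lt_one (by norm_num) (by norm_num)).mul_left _

end SchwartzInSobolev

/-! ### Polar coordinates -/

section Polar

variable {d : ℕ}

lemma measurePreserving_polar (hd : 2 ≤ d) :
    MeasurePreserving (fun p : Ioi (0 : ℝ) × Sph d => (p.1 : ℝ) • (p.2 : Space d))
      ((Measure.volumeIoiPow (d - 1)).prod ((volume : Measure (Space d)).toSphere)) volume := by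
  have hnt : Nontrivial (Space d) := by
    have : Nonempty (Fin d) := ⟨⟨0, by omega⟩⟩
    infer_instance
  have h1 := (volume : Measure (Space d)).measurePreserving_homeomorphUnitSphereProd
  rw [finrank_euclideanSpace_fin] at h1
  have h2 := h1.symm (homeomorphUnitSphereProd (Space d)).toMeasurableEquiv
  have h3 : MeasurePreserving (Subtype.val : ({0}ᶜ : Set (Space d)) → Space d)
      ((volume : Measure (Space d)).comap Subtype.val) volume := by
    have h := measurePreserving_subtype_coe (μa := (volume : Measure (Space d)))
      (measurableSet_singleton (0 : Space d)).compl
    rwa [Measure.restrict_eq_self_of_ae_mem] at h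
    exact compl_mem_ae_iff.2 (measure_singleton 0)
  have h4 := (h3.comp h2).comp Measure.measurePreserving_swap
  exact h4

/-- Integration in polar coordinates. -/
lemma integrable_polar (hd : 2 ≤ d) {G : Space d → ℂ} (hG : Integrable G) :
    Integrable (fun p : ℝ × Sph d => ((p.1 ^ (d - 1) : ℝ) : ℂ) * G (p.1 • (p.2 : Space d)))
      ((volume.restrict (Ioi (0 : ℝ))).prod ((volume : Measure (Space d)).toSphere)) ∧
    ∫ p : ℝ × Sph d, ((p.1 ^ (d - 1) : ℝ) : ℂ) * G (p.1 • (p.2 : Space d))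
      ∂((volume.restrict (Ioi (0 : ℝ))).prod ((volume : Measure (Space d)).toSphere)) =
      ∫ ξ, G ξ := by
  set ν := (volume : Measure (Space d)).toSphere
  have hmp := measurePreserving_polar hd
  have i1 := hmp.integrable_comp_of_integrable hG
  have e1 : ∫ p, G ((p.1 : ℝ) • (p.2 : Space d)) ∂((Measure.volumeIoiPow (d - 1)).prod ν) =
      ∫ ξ, G ξ := by
    have h := integral_map (μ := (Measure.volumeIoiPow (d - 1)).prod ν) hmp.measurable.aemeasurable
      (f := G) (by rw [hmp.map_eq]; exact hG.aestronglyMeasurable)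
    rw [hmp.map_eq] at h
    exact h.symm
  have hf : Measurable fun r : Ioi (0 : ℝ) => ENNReal.ofReal ((r : ℝ) ^ (d - 1)) := by fun_prop
  have hf2 : Measurable fun p : Ioi (0 : ℝ) × Sph d => ENNReal.ofReal ((p.1 : ℝ) ^ (d - 1)) := by
    fun_prop
  have hft : ∀ᵐ p : Ioi (0 : ℝ) × Sph d ∂((Measure.comap Subtype.val volume).prod ν),
      ENNReal.ofReal ((p.1 : ℝ) ^ (d - 1)) < ⊤ := ae_of_all _ fun _ => ENNReal.ofReal_lt_top
  have : SigmaFinite (Measure.comap (Subtype.val : Ioi (0 : ℝ) → ℝ) volume) := by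
    refine SigmaFinite.of_map _ (f := (Subtype.val : Ioi (0 : ℝ) → ℝ))
      measurable_subtype_coe.aemeasurable ?_
    rw [map_comap_subtype_coe measurableSet_Ioi]
    infer_instance
  rw [Measure.volumeIoiPow, prod_withDensity_left hf] at i1 e1
  rw [integrable_withDensity_iff_integrable_smul' hf2 hft] at i1
  rw [integral_withDensity_eq_integral_toReal_smul hf2 hft] at e1
  have hval : MeasurePreserving (Prod.map (Subtype.val : Ioi (0 : ℝ) → ℝ) (id : Sph d → Sph d))
      ((Measure.comap Subtype.val volume).prod ν) ((volume.restrict (Ioi (0 : ℝ))).prod ν) :=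
    (measurePreserving_subtype_coe measurableSet_Ioi).prod (MeasurePreserving.id ν)
  have hemb : MeasurableEmbedding (Prod.map (Subtype.val : Ioi (0 : ℝ) → ℝ) (id : Sph d → Sph d)) :=
    (MeasurableEmbedding.subtype_coe measurableSet_Ioi).prodMap MeasurableEmbedding.id
  have hpt : ∀ p : Ioi (0 : ℝ) × Sph d, (ENNReal.ofReal ((p.1 : ℝ) ^ (d - 1))).toReal •
      G ((p.1 : ℝ) • (p.2 : Space d)) = (fun p : ℝ × Sph d => ((p.1 ^ (d - 1) : ℝ) : ℂ) *
        G (p.1 • (p.2 : Space d))) (Prod.map Subtype.val id p) := by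
    intro p
    have hp : (0 : ℝ) < p.1 := p.1.2
    rw [ENNReal.toReal_ofReal (by positivity)]
    rfl
  constructor
  · rw [← hval.integrable_comp_emb hemb]
    exact i1.congr (ae_of_all _ hpt)
  · rw [← hval.integral_comp hemb, ← e1]
    exact integral_congr_ae (ae_of_all _ fun p => (hpt p).symm)

lemma polarIntegral_eq {F : ℝ → Sph d → ℂ} (hF : PolarIntegrable F) :
    polarIntegral F = ∫ p, Function.uncurry F p
      ∂((volume.restrict (Ioi (0 : ℝ))).prod ((volume : Measure (Space d)).toSphere)) :=
  (integral_prod _ hF).symm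

lemma ae_polar {p : ℝ × Sph d → Prop} (h : ∀ q : ℝ × Sph d, 0 < q.1 → p q) :
    ∀ᵐ q ∂((volume.restrict (Ioi (0 : ℝ))).prod ((volume : Measure (Space d)).toSphere)), p q := by
  have h1 : ∀ᵐ r ∂(volume.restrict (Ioi (0 : ℝ))), r ∈ Ioi (0 : ℝ) :=
    ae_restrict_mem measurableSet_Ioi
  have h2 := (Measure.quasiMeasurePreserving_fst (μ := volume.restrict (Ioi (0 : ℝ)))
    (ν := (volume : Measure (Space d)).toSphere)).ae h1
  filter_upwards [h2] with q hq using h q hq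

end Polar

/-! ### Absolute convergence and the sum of the three integrals -/

section Duality

variable {d : ℕ}

/-- The normalised Fourier transform as a Schwartz function. -/
def fhatS (f : 𝓢(Space d, ℂ)) : 𝓢(Space d, ℂ) :=
  (((2 * Real.pi) ^ (-(d : ℝ) / 2) : ℝ) : ℂ) • SchwartzMap.compCLMOfContinuousLinearEquiv ℂ
    (ContinuousLinearEquiv.smulLeft (Units.mk0 ((2 * Real.pi)⁻¹ : ℝ) (by positivity))) (𝓕 f)

lemma fhatS_apply (f : 𝓢(Space d, ℂ)) (ξ : Space d) : fhatS f ξ = fhat f ξ := rfl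

lemma exists_bound_fg (f g : 𝓢(Space d, ℂ)) : ∃ B : ℝ, ∀ ξ, ‖fg f g ξ‖ ≤ B := by
  obtain ⟨B, hB, h⟩ := exists_bound_schwartz (fhatS f)
  obtain ⟨B', -, h'⟩ := exists_bound_schwartz (fhatS g)
  refine ⟨B * B', fun ξ => ?_⟩
  rw [fg, norm_mul, RCLike.norm_conj]
  exact mul_le_mul (h ξ) (h' ξ) (norm_nonneg _) hB

lemma continuous_fg (f g : 𝓢(Space d, ℂ)) : Continuous (fg f g) :=
  (fhatS f).continuous.mul (Complex.continuous_conj.comp (fhatS g).continuous)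

/-- The integrand of the resolvent form is absolutely integrable, also after multiplication by a
bounded function. -/
lemma integrable_bracket_fg_inv_symb (hd : 2 ≤ d) {k τ : ℝ} (hk : 0 < k) (γ : Space d) (hτ : τ ≠ 0)
    (σ : ℝ) (f g : 𝓢(Space d, ℂ)) {w : Space d → ℝ} (hw : Measurable w) (hw1 : ∀ ξ, |w ξ| ≤ 1) :
    Integrable fun ξ => (bracket σ ξ : ℂ) * fg f g ξ * (w ξ : ℂ) * (symb k γ τ ξ)⁻¹ := by
  obtain ⟨B, hB, h⟩ := exists_bound_schwartz (weight σ (fhatS f))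
  obtain ⟨B', -, h'⟩ := exists_bound_schwartz (fhatS g)
  have e : ∀ ξ, (bracket σ ξ : ℂ) * fg f g ξ * (w ξ : ℂ) =
      weight σ (fhatS f) ξ * ((starRingEnd ℂ) (fhatS g ξ) * (w ξ : ℂ)) := by
    intro ξ
    rw [weight_apply, fg, fhatS_apply, fhatS_apply]
    ring
  have hb : ∀ ξ, ‖(starRingEnd ℂ) (fhatS g ξ) * (w ξ : ℂ)‖ ≤ B' := by
    intro ξ
    rw [norm_mul, RCLike.norm_conj, Complex.norm_real, Real.norm_eq_abs]
    exact (mul_le_of_le_one_right (norm_nonneg _) (hw1 ξ)).trans (h' ξ)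
  refine integrable_mul_inv_symb k γ τ hd hk hτ (B := B * B') ?_ fun ξ => ?_
  · simp only [e]
    refine (weight σ (fhatS f)).integrable.mul_bdd (c := B') ?_ (ae_of_all _ hb)
    exact ((Complex.continuous_conj.comp (fhatS g).continuous).measurable.mul
      (Complex.measurable_ofReal.comp hw)).aestronglyMeasurable
  · rw [e, norm_mul]
    exact mul_le_mul (h ξ) (hb ξ) (norm_nonneg _) hB

variable {k : ℝ} {γ : Space d} {τ ε₀ : ℝ} {ψ : ℝ → ℝ}

lemma cutoffAt_eq_zero (hψ : IsCutoff ψ) (hε : 0 < ε₀) {r₀ x : ℝ} (h : ε₀ ≤ |x - r₀|) :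
    cutoffAt ψ r₀ ε₀ x = 0 := by
  by_contra hc
  have h1 := hψ.supp (subset_closure (Function.mem_support.2 hc))
  rw [mem_ball_zero_iff, Real.norm_eq_abs, abs_of_nonneg (by positivity), ← div_eq_mul_inv,
    div_lt_one hε] at h1
  linarith

lemma continuous_cutoffAt (hψ : IsCutoff ψ) (r₀ : ℝ) : Continuous (cutoffAt ψ r₀ ε₀) :=
  hψ.smooth.continuous.comp (by fun_prop)

lemma cutoffAt_mem_Icc (hψ : IsCutoff ψ) (r₀ x : ℝ) : cutoffAt ψ r₀ ε₀ x ∈ Icc (0 : ℝ) 1 :=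
  hψ.mem_Icc _

lemma abs_cutoffAt_le (hψ : IsCutoff ψ) (r₀ x : ℝ) : |cutoffAt ψ r₀ ε₀ x| ≤ 1 := by
  have h := cutoffAt_mem_Icc (ε₀ := ε₀) hψ r₀ x
  exact abs_le.2 ⟨by linarith [h.1], h.2⟩

lemma abs_one_sub_cutoffAt_le (hψ : IsCutoff ψ) (r₀ x : ℝ) : |1 - cutoffAt ψ r₀ ε₀ x| ≤ 1 := by
  have h := cutoffAt_mem_Icc (ε₀ := ε₀) hψ r₀ x
  exact abs_le.2 ⟨by linarith [h.2], by linarith [h.1]⟩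

/-- The values on the sphere extend to space as a function homogeneous of degree zero away from the
origin, bounded and measurable; the radial cutoff supplies compact support. -/
lemma integrable_frozen (hd : 2 ≤ d) (hψ : IsCutoff ψ) (hk : 0 < k) (hτ : τ ≠ 0) (hε : 0 < ε₀)
    (σ : ℝ) (f g : 𝓢(Space d, ℂ)) :
    Integrable fun ξ => (bracket σ ξ : ℂ) * fg f g (radius k γ • (‖ξ‖⁻¹ • ξ)) *
      (cutoffAt ψ (radius k γ) ε₀ ‖ξ‖ : ℂ) * (symb k γ τ ξ)⁻¹ := by
  obtain ⟨B, hB⟩ := exists_bound_fg f g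
  set R := radius k γ + ε₀ with hR
  have hc : Continuous fun ξ : Space d => (bracket σ ξ : ℂ) * (cutoffAt ψ (radius k γ) ε₀ ‖ξ‖ : ℂ) :=
    (Complex.continuous_ofReal.comp (continuous_bracket σ)).mul
      (Complex.continuous_ofReal.comp ((continuous_cutoffAt hψ _).comp continuous_norm))
  have hcs : HasCompactSupport
      fun ξ : Space d => (bracket σ ξ : ℂ) * (cutoffAt ψ (radius k γ) ε₀ ‖ξ‖ : ℂ) := by
    refine HasCompactSupport.of_support_subset_isCompact (isCompact_closedBall (0 : Space d) R)
      fun ξ hξ => ?_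
    rw [mem_closedBall_zero_iff]
    by_contra hc
    refine hξ ?_
    simp only
    rw [cutoffAt_eq_zero hψ hε, Complex.ofReal_zero, mul_zero]
    rw [not_le, hR] at hc
    exact le_trans (by linarith) (le_abs_self _)
  obtain ⟨B', hB'⟩ := hcs.exists_bound_of_continuous hc
  have hm : Measurable fun ξ : Space d => fg f g (radius k γ • (‖ξ‖⁻¹ • ξ)) :=
    (continuous_fg f g).measurable.comp (by fun_prop)
  have e : ∀ ξ, (bracket σ ξ : ℂ) * fg f g (radius k γ • (‖ξ‖⁻¹ • ξ)) *
      (cutoffAt ψ (radius k γ) ε₀ ‖ξ‖ : ℂ) = ((bracket σ ξ : ℂ) *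
        (cutoffAt ψ (radius k γ) ε₀ ‖ξ‖ : ℂ)) * fg f g (radius k γ • (‖ξ‖⁻¹ • ξ)) := fun ξ => by ring
  have hB0 : 0 ≤ B' := (norm_nonneg _).trans (hB' 0)
  refine integrable_mul_inv_symb k γ τ hd hk hτ (B := B' * B) ?_ fun ξ => ?_
  · simp only [e]
    exact (hc.integrable_of_hasCompactSupport hcs).mul_bdd (c := B) hm.aestronglyMeasurable
      (ae_of_all _ fun ξ => hB _)
  · rw [e, norm_mul]
    exact mul_le_mul (hB' ξ) (hB _) (norm_nonneg _) hB0

lemma norm_smul_sphere {r : ℝ} (hr : 0 < r) (θ : Sph d) : ‖r • (θ : Space d)‖ = r := by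
  rw [norm_smul, Real.norm_of_nonneg hr.le, norm_eq_of_mem_sphere, mul_one]

lemma kernel_mul_eq {k τ s : ℝ} {γ : Space d} {r : ℝ} (hr : 0 < r) (θ : Sph d) (z : ℂ) :
    kernel k γ τ s r θ * z = ((r ^ (d - 1) : ℝ) : ℂ) *
      ((bracket s (r • (θ : Space d)) : ℂ) * z * (symb k γ τ (r • (θ : Space d)))⁻¹) := by
  rw [kernel, bracket, norm_smul_sphere hr, div_eq_mul_inv]
  push_cast
  ring

/-- Absolute convergence of the integrals, and the value of their sum. -/
lemma integralsConverge_and_dualityForm_eq (hd : 2 ≤ d) (hψ : IsCutoff ψ) (hk : 0 < k) (hτ : τ ≠ 0)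
    (hε : 0 < ε₀) (σ : ℝ) (f g : 𝓢(Space d, ℂ)) :
    IntegralsConverge k γ τ ψ ε₀ σ f g ∧ dualityForm k γ τ ψ ε₀ σ f g =
      ∫ ξ, (bracket σ ξ : ℂ) * fg f g ξ * (symb k γ τ ξ)⁻¹ := by
  set r₀ := radius k γ with hr₀
  have hcut : Measurable fun ξ : Space d => cutoffAt ψ r₀ ε₀ ‖ξ‖ :=
    (continuous_cutoffAt hψ r₀).measurable.comp measurable_norm
  have g1 := integrable_bracket_fg_inv_symb hd hk γ hτ σ f g (w := fun ξ => 1 - cutoffAt ψ r₀ ε₀ ‖ξ‖)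
    (measurable_const.sub hcut)
    (fun ξ => abs_one_sub_cutoffAt_le (ε₀ := ε₀) hψ r₀ ‖ξ‖)
  have g0 := integrable_bracket_fg_inv_symb hd hk γ hτ σ f g hcut
    (fun ξ => abs_cutoffAt_le (ε₀ := ε₀) hψ r₀ ‖ξ‖)
  have g2 := integrable_frozen (γ := γ) (ε₀ := ε₀) hd hψ hk hτ hε σ f g
  have hfrozen : ∀ (r : ℝ) (θ : Sph d), 0 < r →
      r₀ • (‖r • (θ : Space d)‖⁻¹ • r • (θ : Space d)) = r₀ • (θ : Space d) := by
    intro r θ hr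
    rw [norm_smul_sphere hr, smul_smul r⁻¹, inv_mul_cancel₀ hr.ne', one_smul]
  have p1 : PolarIntegrable (integrand₁ k γ τ ψ ε₀ σ f g) := by
    refine (integrable_polar hd g1).1.congr (ae_polar fun q hq => ?_)
    simp only [Function.uncurry, integrand₁]
    rw [mul_assoc (kernel _ _ _ _ _ _), kernel_mul_eq hq, norm_smul_sphere hq]
    ring
  have p2 : PolarIntegrable (integrand₂ k γ τ ψ ε₀ σ f g) := by
    refine (integrable_polar hd g2).1.congr (ae_polar fun q hq => ?_)
    simp only [Function.uncurry, integrand₂]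
    rw [mul_assoc (kernel _ _ _ _ _ _), kernel_mul_eq hq, hfrozen _ _ hq, norm_smul_sphere hq]
    ring
  have p3 : PolarIntegrable (integrand₃ k γ τ ψ ε₀ σ f g) := by
    refine (integrable_polar hd (g0.sub g2)).1.congr (ae_polar fun q hq => ?_)
    simp only [Function.uncurry, integrand₃, Pi.sub_apply]
    rw [mul_assoc (kernel _ _ _ _ _ _), kernel_mul_eq hq, hfrozen _ _ hq, norm_smul_sphere hq]
    ring
  refine ⟨⟨p1, p2, p3⟩, ?_⟩
  have p12 := p1.add p2
  rw [dualityForm, polarIntegral_eq p1, polarIntegral_eq p2, polarIntegral_eq p3]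
  have h0 := integrable_bracket_fg_inv_symb hd hk γ hτ σ f g (w := fun _ => (1 : ℝ))
    measurable_const (fun _ => by simp)
  simp only [Complex.ofReal_one, mul_one] at h0
  rw [← (integrable_polar hd h0).2, ← integral_add p1 p2]
  refine (integral_add p12 p3).symm.trans ?_
  -- The frozen terms cancel: `(1 - ψ₀) F + ψ₀ F₀ + ψ₀ (F - F₀) = F`.
  refine integral_congr_ae (ae_polar fun q hq => ?_)
  simp only [Function.uncurry, integrand₁, integrand₂, integrand₃, Pi.add_apply]
  rw [← kernel_mul_eq hq]
  push_cast
  ring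

end Duality

/-! ### The duality formula in terms of the inverse symbol -/

section DualityFormula

variable {d : ℕ} {k : ℝ} {γ : Space d} {τ ε₀ : ℝ} {ψ : ℝ → ℝ}

lemma conjS_apply (g : 𝓢(Space d, ℂ)) (x : Space d) : conjS g x = (starRingEnd ℂ) (g x) := rfl

lemma conjS_conjS (g : 𝓢(Space d, ℂ)) : conjS (conjS g) = g := by
  ext x
  simp [conjS_apply]

lemma fourierInv_conjS (g : 𝓢(Space d, ℂ)) (ξ : Space d) :
    𝓕⁻ (conjS g) ξ = (starRingEnd ℂ) (𝓕 g ξ) := by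
  rw [SchwartzMap.fourierInv_coe, SchwartzMap.fourier_coe, Real.fourierInv_eq', Real.fourier_eq',
    ← integral_conj]
  refine integral_congr_ae (ae_of_all _ fun x => ?_)
  simp only [smul_eq_mul, map_mul, conjS_apply, ← Complex.exp_conj, Complex.conj_ofReal,
    Complex.conj_I]
  push_cast
  ring_nf

lemma hasTemperateGrowth_bracket_smul (σ : ℝ) :
    (fun ξ : Space d => (bracket σ ((2 * Real.pi) • ξ) : ℂ)).HasTemperateGrowth := by
  have h : (fun ξ : Space d => (2 * Real.pi) • ξ).HasTemperateGrowth := by fun_prop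
  exact (hasTemperateGrowth_bracket σ).comp h

/-- Substituting `2πξ` for `ξ`, the Jacobian `(2π)^d` cancels the two normalising factors
`(2π)^(-d/2)`. -/
lemma integral_fg_eq (σ : ℝ) (f g : 𝓢(Space d, ℂ)) :
    ∫ ξ, (bracket σ ξ : ℂ) * fg f g ξ * (symb k γ τ ξ)⁻¹ =
      ∫ ξ, 𝓕 f ξ * ((bracket σ ((2 * Real.pi) • ξ) : ℂ) * (starRingEnd ℂ) (𝓕 g ξ)) *
        invSymb k γ τ ξ := by
  have hpi : (0 : ℝ) < 2 * Real.pi := by positivity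
  have hc : ((2 * Real.pi) ^ (-(d : ℝ) / 2) : ℝ) * ((2 * Real.pi) ^ (-(d : ℝ) / 2) : ℝ) =
      ((2 * Real.pi) ^ d)⁻¹ := by
    rw [← Real.rpow_add hpi, ← Real.rpow_natCast, ← Real.rpow_neg hpi.le]
    congr 1
    ring
  have h := Measure.integral_comp_smul (volume : Measure (Space d))
    (fun ξ => (bracket σ ξ : ℂ) * fg f g ξ * (symb k γ τ ξ)⁻¹) (2 * Real.pi)
  rw [finrank_euclideanSpace_fin, abs_of_pos (by positivity)] at h
  have e : ∀ ξ : Space d, (bracket σ ((2 * Real.pi) • ξ) : ℂ) * fg f g ((2 * Real.pi) • ξ) *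
      (symb k γ τ ((2 * Real.pi) • ξ))⁻¹ = (((2 * Real.pi) ^ d)⁻¹ : ℝ) •
        (𝓕 f ξ * ((bracket σ ((2 * Real.pi) • ξ) : ℂ) * (starRingEnd ℂ) (𝓕 g ξ)) *
          invSymb k γ τ ξ) := by
    intro ξ
    rw [fg, fhat, fhat, smul_smul, inv_mul_cancel₀ hpi.ne', one_smul, invSymb, Complex.real_smul,
      ← hc, map_mul, Complex.conj_ofReal, Complex.ofReal_mul]
    ring
  simp only [e] at h
  rw [integral_smul] at h
  exact (smul_right_injective ℂ (inv_ne_zero (pow_ne_zero d hpi.ne')) h).symm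

lemma pairing_bessel (σ : ℝ) (u : 𝓢'(Space d, ℂ)) (g : 𝓢(Space d, ℂ)) :
    pairing (bessel σ u) g =
      u (dualMult (fun ξ => (bracket σ ((2 * Real.pi) • ξ) : ℂ)) (conjS g)) := rfl

lemma isRegularizedFaddeev_of_eq (hd : 2 ≤ d) (hψ : IsCutoff ψ) (hk : 0 < k) (hτ : τ ≠ 0)
    (hε : 0 < ε₀) {H : 𝓢(Space d, ℂ) →ₗ[ℂ] 𝓢'(Space d, ℂ)}
    (hH : ∀ f φ, H f φ = ∫ ξ, 𝓕 f ξ * 𝓕⁻ φ ξ * invSymb k γ τ ξ) :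
    IsRegularizedFaddeev k γ τ ψ ε₀ H := by
  intro σ _ f g
  rw [(integralsConverge_and_dualityForm_eq hd hψ hk hτ hε σ f g).2, pairing_bessel, hH,
    integral_fg_eq]
  simp only [fourierInv_dualMult (hasTemperateGrowth_bracket_smul σ), fourierInv_conjS]

lemma fourierInv_injective :
    Function.Injective fun φ : 𝓢(Space d, ℂ) => (𝓕⁻ φ : 𝓢(Space d, ℂ)) :=
  Function.LeftInverse.injective (g := fun φ : 𝓢(Space d, ℂ) => (𝓕 φ : 𝓢(Space d, ℂ)))
    fun φ => FourierTransform.fourier_fourierInv_eq φ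

lemma dualMult_bracket_zero (φ : 𝓢(Space d, ℂ)) :
    dualMult (fun ξ => (bracket 0 ((2 * Real.pi) • ξ) : ℂ)) φ = φ := by
  refine fourierInv_injective (SchwartzMap.ext fun ξ => ?_)
  rw [fourierInv_dualMult (hasTemperateGrowth_bracket_smul 0)]
  simp [bracket]

/-- The duality formula determines the operator. -/
lemma IsRegularizedFaddeev.unique {H H' : 𝓢(Space d, ℂ) →ₗ[ℂ] 𝓢'(Space d, ℂ)}
    (h : IsRegularizedFaddeev k γ τ ψ ε₀ H) (h' : IsRegularizedFaddeev k γ τ ψ ε₀ H') : H = H' := by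
  ext f φ
  have e : ∀ {H : 𝓢(Space d, ℂ) →ₗ[ℂ] 𝓢'(Space d, ℂ)}, IsRegularizedFaddeev k γ τ ψ ε₀ H →
      H f φ = dualityForm k γ τ ψ ε₀ 0 f (conjS φ) := by
    intro H h
    rw [← h 0 ⟨le_rfl, by norm_num⟩, pairing_bessel, conjS_conjS, dualMult_bracket_zero]
  rw [e h, e h']

lemma isRegularizedFaddeev_faddeev {H : 𝓢(Space d, ℂ) →ₗ[ℂ] 𝓢'(Space d, ℂ)}
    (h : IsRegularizedFaddeev k γ τ ψ ε₀ H) :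
    IsRegularizedFaddeev k γ τ ψ ε₀ (faddeev k γ τ ψ ε₀) := by
  have hex : ∃ H : 𝓢(Space d, ℂ) →ₗ[ℂ] 𝓢'(Space d, ℂ), IsRegularizedFaddeev k γ τ ψ ε₀ H := ⟨H, h⟩
  rw [faddeev, dif_pos hex]
  exact hex.choose_spec

end DualityFormula

/-! ### The differential operator and its inverse -/

section Inverse

variable {d : ℕ} (k : ℝ) (γ : Space d) (τ : ℝ)

lemma symb_two_pi_smul (ξ : Space d) : symb k γ τ ((2 * Real.pi) • ξ) =
    (2 * Real.pi) ^ 2 * ((‖ξ‖ ^ 2 : ℝ) : ℂ) - ((k ^ 2 + ‖γ‖ ^ 2 : ℝ) : ℂ) +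
      2 * (2 * Real.pi * Complex.I) * ((inner ℝ ξ γ : ℝ) : ℂ) - Complex.I * τ := by
  rw [symb, norm_smul, inner_smul_right, Real.norm_of_nonneg (by positivity), real_inner_comm]
  push_cast
  ring

/-- The Laplacian and the directional derivative are multipliers; transposing them and adding their
symbols reassembles `m`. -/
lemma diffOp_apply (u : 𝓢'(Space d, ℂ)) (φ : 𝓢(Space d, ℂ)) :
    diffOp k γ τ u φ = u (dualMult (fun ξ => symb k γ τ ((2 * Real.pi) • ξ)) φ) := by
  have hq : (fun ξ : Space d => ((‖ξ‖ ^ 2 : ℝ) : ℂ)).HasTemperateGrowth := by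
    have h : (fun ξ : Space d => ‖ξ‖ ^ 2).HasTemperateGrowth := by fun_prop
    exact Function.Complex.hasTemperateGrowth_ofReal.comp h
  have hl : (fun ξ : Space d => ((inner ℝ ξ γ : ℝ) : ℂ)).HasTemperateGrowth := by fun_prop
  have e : dualMult (fun ξ => symb k γ τ ((2 * Real.pi) • ξ)) φ =
      ((2 * Real.pi) ^ 2 : ℂ) • dualMult (fun ξ : Space d => ((‖ξ‖ ^ 2 : ℝ) : ℂ)) φ -
        ((k ^ 2 + ‖γ‖ ^ 2 : ℝ) : ℂ) • φ +
        (2 * (2 * Real.pi * Complex.I)) • dualMult (fun ξ : Space d => ((inner ℝ ξ γ : ℝ) : ℂ)) φ -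
        (Complex.I * τ) • φ := by
    refine fourierInv_injective ?_
    change FourierTransform.fourierInvCLM ℂ 𝓢(Space d, ℂ) _ =
      FourierTransform.fourierInvCLM ℂ 𝓢(Space d, ℂ) _
    simp only [map_sub, map_add, map_smul, FourierTransform.fourierInvCLM_apply]
    ext ξ
    simp only [sub_apply, add_apply, smul_apply, smul_eq_mul]
    rw [fourierInv_dualMult (hasTemperateGrowth_symb k γ τ), fourierInv_dualMult hq,
      fourierInv_dualMult hl, symb_two_pi_smul]
    ring
  rw [e, diffOp, TemperedDistribution.laplacian_eq_fourierMultiplierCLM,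
    TemperedDistribution.lineDeriv_eq_fourierMultiplierCLM]
  simp only [map_sub, map_add, map_smul]
  simp only [← fourierMultiplierCLM_apply_eq]
  have hr : ∀ (c : ℝ) (v : 𝓢'(Space d, ℂ)) (φ : 𝓢(Space d, ℂ)), (c • v) φ = (c : ℂ) * v φ :=
    fun c v φ => rfl
  have hs : ∀ (c : ℂ) (v : 𝓢'(Space d, ℂ)) (φ : 𝓢(Space d, ℂ)), (c • v) φ = c * v φ :=
    fun c v φ => rfl
  have ha : ∀ (v w : 𝓢'(Space d, ℂ)) (φ : 𝓢(Space d, ℂ)), (v + w) φ = v φ + w φ :=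
    fun v w φ => rfl
  have hb : ∀ (v w : 𝓢'(Space d, ℂ)) (φ : 𝓢(Space d, ℂ)), (v - w) φ = v φ - w φ :=
    fun v w φ => rfl
  have hn : ∀ (v : 𝓢'(Space d, ℂ)) (φ : 𝓢(Space d, ℂ)), (-v) φ = -v φ := fun v φ => rfl
  simp only [hr, hs, ha, hb, hn, smul_eq_mul]
  push_cast
  ring

lemma fourier_diffOp (f : 𝓢(Space d, ℂ)) (ξ : Space d) :
    𝓕 (diffOp k γ τ f) ξ = symb k γ τ ((2 * Real.pi) • ξ) * 𝓕 f ξ := by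
  have hq : (‖·‖ ^ 2 : Space d → ℝ).HasTemperateGrowth := by fun_prop
  have hl : (fun ξ : Space d => inner ℝ ξ γ).HasTemperateGrowth := by fun_prop
  rw [diffOp, SchwartzMap.laplacian_eq_fourierMultiplierCLM,
    SchwartzMap.lineDeriv_eq_fourierMultiplierCLM]
  change FourierTransform.fourierCLM ℂ 𝓢(Space d, ℂ) _ ξ = _
  simp only [map_neg, map_sub, map_add, map_smul, ContinuousLinearMap.map_smul_of_tower,
    FourierTransform.fourierCLM_apply]
  simp only [SchwartzMap.fourierMultiplierCLM_apply, FourierTransform.fourier_fourierInv_eq,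
    neg_apply, sub_apply, add_apply, smul_apply, SchwartzMap.smulLeftCLM_apply_apply hq,
    SchwartzMap.smulLeftCLM_apply_apply hl, smul_eq_mul, Complex.real_smul, symb_two_pi_smul]
  push_cast
  ring

variable {k γ τ}

/-- The real part of `m` vanishes only on a sphere of positive radius, which is a null set. -/
lemma ae_symb_mul_invSymb (hk : 0 < k) : ∀ᵐ ξ : Space d,
    symb k γ τ ((2 * Real.pi) • ξ) * invSymb k γ τ ξ = 1 := by
  have hr : 0 < radius k γ / (2 * Real.pi) := by
    have : 0 < radius k γ := Real.sqrt_pos.2 (by positivity)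
    positivity
  filter_upwards [ae_norm_sq_sub_ne_zero (d := d) hr] with ξ hξ
  refine mul_inv_cancel₀ fun h => hξ ?_
  have h1 := symb_re k γ τ ((2 * Real.pi) • ξ)
  rw [h, Complex.zero_re, norm_smul, Real.norm_of_nonneg (by positivity)] at h1
  have hpi : (2 * Real.pi : ℝ) ≠ 0 := by positivity
  field_simp
  linarith

lemma integral_fourier_mul_fourierInv (f φ : 𝓢(Space d, ℂ)) :
    ∫ ξ, 𝓕 f ξ * 𝓕⁻ φ ξ = (f : 𝓢'(Space d, ℂ)) φ := by
  rw [SchwartzMap.integral_fourier_mul_eq, FourierTransform.fourier_fourierInv_eq,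
    ((represents_schwartz f).2 φ).2]
  exact integral_congr_ae (ae_of_all _ fun x => mul_comm _ _)

/-- The resolvent is a two-sided inverse of the differential operator. -/
lemma diffOp_inverse (hk : 0 < k) {H : 𝓢(Space d, ℂ) →ₗ[ℂ] 𝓢'(Space d, ℂ)}
    (hH : ∀ f φ, H f φ = ∫ ξ, 𝓕 f ξ * 𝓕⁻ φ ξ * invSymb k γ τ ξ) (f : 𝓢(Space d, ℂ)) :
    diffOp k γ τ (H f) = (f : 𝓢'(Space d, ℂ)) ∧ H (diffOp k γ τ f) = (f : 𝓢'(Space d, ℂ)) := by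
  constructor
  · ext φ
    rw [diffOp_apply, hH, ← integral_fourier_mul_fourierInv]
    refine integral_congr_ae ?_
    filter_upwards [ae_symb_mul_invSymb (γ := γ) (τ := τ) hk] with ξ hξ
    rw [fourierInv_dualMult (hasTemperateGrowth_symb k γ τ)]
    linear_combination (𝓕 f ξ * 𝓕⁻ φ ξ) * hξ
  · ext φ
    rw [hH, ← integral_fourier_mul_fourierInv]
    refine integral_congr_ae ?_
    filter_upwards [ae_symb_mul_invSymb (γ := γ) (τ := τ) hk] with ξ hξ
    rw [fourier_diffOp]
    linear_combination (𝓕 f ξ * 𝓕⁻ φ ξ) * hξ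

end Inverse

/-! ### Restriction to larger weights -/

section Extension

variable {d : ℕ} (P : DyadicPair d) {r η : ℝ}

lemma mem_sobolev {u : 𝓢'(Space d, ℂ)} : u ∈ sobolev P r η ↔ sobolevNorm P r (bracket η) u < ⊤ :=
  Iff.rfl

lemma exists_schwartz_restriction (T : sobolev P r η →ₗ[ℂ] 𝓢'(Space d, ℂ)) :
    ∃ H : 𝓢(Space d, ℂ) →ₗ[ℂ] 𝓢'(Space d, ℂ), ∀ f, H f = T ⟨f, coe_mem_sobolev P r η f⟩ := by
  refine ⟨{ toFun := fun f => T ⟨f, coe_mem_sobolev P r η f⟩, map_add' := ?_, map_smul' := ?_ },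
    fun f => rfl⟩
  · intro f g
    rw [← map_add]
    exact congrArg T (Subtype.ext (map_add _ f g))
  · intro c f
    rw [RingHom.id_apply, ← map_smul]
    exact congrArg T (Subtype.ext (map_smul _ c f))

/-- A bounded operator between weighted spaces restricts to one for larger weights. -/
lemma exists_restriction_of_le {t η₀ : ℝ} (h : η₀ ≤ η) {A : ℝ}
    (T : sobolev P r η₀ →ₗ[ℂ] 𝓢'(Space d, ℂ))
    (hT : ∀ u, sobolevNorm P t (bracket (-η₀)) (T u) ≤
      ENNReal.ofReal A * sobolevNorm P r (bracket η₀) (u : 𝓢'(Space d, ℂ))) :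
    ∃ T' : sobolev P r η →ₗ[ℂ] sobolev P t (-η),
      (∀ (u : 𝓢'(Space d, ℂ)) (hu : u ∈ sobolev P r η) (hu' : u ∈ sobolev P r η₀),
        (T' ⟨u, hu⟩ : 𝓢'(Space d, ℂ)) = T ⟨u, hu'⟩) ∧
      ∀ u : sobolev P r η, sobolevNorm P t (bracket (-η)) (T' u : 𝓢'(Space d, ℂ)) ≤
        ENNReal.ofReal A * sobolevNorm P r (bracket η) (u : 𝓢'(Space d, ℂ)) := by
  have hle : sobolev P r η ≤ sobolev P r η₀ := fun u hu =>
    (mem_sobolev P).2 ((sobolevNorm_mono_weight P h u).trans_lt ((mem_sobolev P).1 hu))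
  obtain ⟨T₁, hT₁⟩ : ∃ T₁ : sobolev P r η →ₗ[ℂ] 𝓢'(Space d, ℂ),
      ∀ u, T₁ u = T (Submodule.inclusion hle u) := ⟨T ∘ₗ Submodule.inclusion hle, fun _ => rfl⟩
  have hb : ∀ u : sobolev P r η, sobolevNorm P t (bracket (-η)) (T₁ u) ≤
      ENNReal.ofReal A * sobolevNorm P r (bracket η) (u : 𝓢'(Space d, ℂ)) := by
    intro u
    rw [hT₁]
    refine (sobolevNorm_mono_weight P (neg_le_neg h) _).trans ((hT _).trans ?_)
    rw [Submodule.coe_inclusion]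
    gcongr
    exact sobolevNorm_mono_weight P h _
  have hmem : ∀ u, T₁ u ∈ sobolev P t (-η) := fun u => (mem_sobolev P).2
    ((hb u).trans_lt (ENNReal.mul_lt_top ENNReal.ofReal_lt_top ((mem_sobolev P).1 u.2)))
  refine ⟨T₁.codRestrict (sobolev P t (-η)) hmem, fun u hu hu' => ?_, fun u => ?_⟩
  · rw [LinearMap.codRestrict_apply, hT₁]
    exact congrArg T (Subtype.ext (Submodule.coe_inclusion hle _))
  · rw [LinearMap.codRestrict_apply]
    exact hb u

end Extension

end Faddeev

end

/-! ### Assembly of the theorem -/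

theorem theorem3p1 (d : ℕ) (hd : 2 ≤ d) (P : DyadicPair d) (r s η₀ : ℝ)
    (hs : s ∈ Set.Icc (0 : ℝ) 2) (hη₀ : 1 / 2 < η₀) :
    ∃ C : ℝ, 0 < C ∧
      ∀ (ψ : ℝ → ℝ), IsCutoff ψ → ∀ (k : ℝ), 0 < k → ∀ (γ : Space d) (ε₀ : ℝ), 0 < ε₀ →
        ε₀ < min (radius k γ / 4) 1 → ∀ (τ : ℝ), τ ≠ 0 → |τ| < ε₀ ^ 2 →
        -- the operator is well defined by its duality formula
        ((∀ σ ∈ Set.Icc (0 : ℝ) 2, ∀ f g : 𝓢(Space d, ℂ), IntegralsConverge k γ τ ψ ε₀ σ f g) ∧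
          IsRegularizedFaddeev k γ τ ψ ε₀ (faddeev k γ τ ψ ε₀)) ∧
        -- it extends to a bounded operator between the weighted spaces
        (∀ η : ℝ, η₀ ≤ η →
          ∃ T : sobolev P r η →ₗ[ℂ] sobolev P (r + s) (-η),
            (∀ f : 𝓢(Space d, ℂ), ∃ hf : (f : 𝓢'(Space d, ℂ)) ∈ sobolev P r η,
              (T ⟨(f : 𝓢'(Space d, ℂ)), hf⟩ : 𝓢'(Space d, ℂ)) = faddeev k γ τ ψ ε₀ f) ∧
            ∀ u : sobolev P r η,
              sobolevNorm P (r + s) (bracket (-η)) (T u : 𝓢'(Space d, ℂ)) ≤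
                ENNReal.ofReal (C * ((1 + radius k γ) ^ s / (ε₀ * radius k γ))) *
                  sobolevNorm P r (bracket η) (u : 𝓢'(Space d, ℂ))) ∧
        -- it is a two-sided inverse in the sense of distributions
        (∀ f : 𝓢(Space d, ℂ),
          diffOp k γ τ (faddeev k γ τ ψ ε₀ f) = (f : 𝓢'(Space d, ℂ)) ∧
            faddeev k γ τ ψ ε₀ (diffOp k γ τ f) = (f : 𝓢'(Space d, ℂ))) := by
  -- The estimate is used for the weight exponent `η₀` only, so the constant does not depend on `η`.
  obtain ⟨C, hC, hbound⟩ := exists_resolvent_operator_bound P hd r s hs hη₀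
  refine ⟨C, hC, fun ψ hψ k hk γ ε₀ hε hε' τ hτ _ => ?_⟩
  obtain ⟨T, hTb, hT⟩ := hbound k γ τ ε₀ hk hτ hε hε'
  obtain ⟨H, hHT⟩ := exists_schwartz_restriction P T
  have hH : ∀ f φ, H f φ = ∫ ξ, 𝓕 f ξ * 𝓕⁻ φ ξ * invSymb k γ τ ξ := fun f φ => by
    rw [hHT, hT, integral_mul_dualResolvent hd hk hτ]
  have hreg := isRegularizedFaddeev_of_eq hd hψ hk hτ hε hH
  have hF := isRegularizedFaddeev_faddeev hreg
  -- By uniqueness the operator defined by choice is the multiplier `1 / m`, for which all claims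
  -- have been established.
  rw [hF.unique hreg]
  refine ⟨⟨fun σ _ f g => (integralsConverge_and_dualityForm_eq hd hψ hk hτ hε σ f g).1, hreg⟩,
    fun η hη => ?_, diffOp_inverse hk hH⟩
  obtain ⟨T', hTT', hTb'⟩ := exists_restriction_of_le P hη T hTb
  exact ⟨T', fun f => ⟨coe_mem_sobolev P r η f, by rw [hTT', hHT]⟩, hTb'⟩
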